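/- Let $\sigma_+,\sigma_-\in[0,2\pi)$ and consider the two-phase quantum walk on $\mathbb Z$ with coins $$U_x=\frac1{\sqrt2}\begin{bmatrix}1&e^{i\sigma_\pm}\\ e^{-i\sigma_\pm}&-1\end{bmatrix}\quad(\pm x\ge 1),\qquad U_0=\begin{bmatrix}1&0\\0&-1\end{bmatrix}.$$ Let $P_x$ (resp. $Q_x$) be $U_x$ with its lower (resp. upper) row replaced by $0$. The state $\Psi_t(x)\in\mathbb C^2$ evolves by $\Psi_{t+1}(x)=P_{x+1}\Psi_t(x+1)+Q_{x-1}\Psi_t(x-1)$ with $\Psi_0(0)={}^T[\alpha,\beta]$ and $\Psi_0(x)=0$ for $x\ne0$, where $\alpha=ae^{i\phi_1}$, $\beta=be^{i\phi_2}$, $a,b\ge0$, $a^2+b^2=1$, $\phi_1,\phi_2\in\mathbb R$. Let $X_t$ be the position at time $t$, $P(X_t=x)=\|\Psi_t(x)\|^2$, and put $\sigma=(\sigma_+-\sigma_-)/2$, $\tilde\sigma=(\sigma_++\sigma_-)/2$, $\tilde\phi_{12}=\phi_1-\phi_2$. The time-averaged limit measure $\overline\mu_\infty(x)=\lim_{T\to\infty}\frac1T\sum_{t=0}^{T-1}P(X_t=x)$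 exists for every $x\in\mathbb Z$ and equals $$\overline\mu_\infty(x)=\mathbf 1_{\{\sin\sigma\ge-1/\sqrt2\}}\,\nu^{(+)}(x)+\mathbf 1_{\{\sin\sigma\le1/\sqrt2\}}\,\nu^{(-)}(x),$$ $$\nu^{(\pm)}(x)=\Bigl(\tfrac{1\pm\sqrt2\sin\sigma}{3\pm2\sqrt2\sin\sigma}\Bigr)^2\{1\pm2ab\sin(\tilde\phi_{12}-\tilde\sigma)\}\Bigl\{\delta_0(x)+(1-\delta_0(x))(2\pm\sqrt2\sin\sigma)\Bigl(\tfrac1{3\pm2\sqrt2\sin\sigma}\Bigr)^{|x|}\Bigr\}$$ (where $\delta_0(x)=1$ if $x=0$ and $0$ otherwise); it is summable, and its total mass $C=\sum_{x\in\mathbb Z}\overline\mu_\infty(x)$ satisfies $0\le C<1$. As $t\to\infty$, $X_t/t$ converges weakly to the probability law $$\mu(dx)=C\,\delta_0(dx)+w(x)f_K(x;1/\sqrt2)\,dx,\qquad f_K(x;r)=\frac{\sqrt{1-r^2}}{\pi(1-x^2)\sqrt{r^2-x^2}}\mathbf 1_{(-r,r)}(x),$$ where the second term is a non-negative density and $$w(x)=\frac{t_3x^5+t_2x^4+t_1x^3+t_0x^2}{s_2x^4+s_1x^2+s_0},$$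 $$s_2=4\cos^4\sigma,\quad s_1=4\cos^2\sigma(1+2\sin^2\sigma),\quad s_0=\cos^22\sigma,$$ $$t_3=4\cos^2\sigma\,(b^2-a^2),\qquad t_1=2(b^2-a^2),$$ $$t_2=4\bigl[\cos^2\sigma\,(1+\sqrt2ab\,\mathrm{sgn}(x)\cos\gamma(x))+\sqrt2ab\,\mathrm{sgn}(x)\sin\gamma(x)\sin2\sigma\bigr],$$ $$t_0=2\bigl\{1+\sqrt2ab\,\mathrm{sgn}(x)\cos\gamma(x)-\sqrt2ab\,\mathrm{sgn}(x)\sin\gamma(x)\sin2\sigma\bigr\},$$ with $\gamma(x)=\tilde\phi_{12}-\sigma_-$ for $x\ge0$ and $\gamma(x)=-\tilde\phi_{12}+\sigma_+$ for $x<0$. -/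

import Mathlib

open MeasureTheory Filter Topology

namespace TwoPhaseWalk

noncomputable section

/-- The Hadamard-type coin with phase `s`. -/
def phaseCoin (s : ℝ) : Matrix (Fin 2) (Fin 2) ℂ :=
  ((1 / Real.sqrt 2 : ℝ) : ℂ) •
    !![1, Complex.exp (Complex.I * s); Complex.exp (-(Complex.I * s)), -1]

/-- The coin `U_x` at site `x`: phase `σp` on `x ≥ 1`, phase `σm` on `x ≤ -1`, and the defect
`diag(1, -1)` at the origin. -/
def coin (σp σm : ℝ) (x : ℤ) : Matrix (Fin 2) (Fin 2) ℂ :=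
  if 1 ≤ x then phaseCoin σp else if x ≤ -1 then phaseCoin σm else !![1, 0; 0, -1]

/-- The upper row of the coin, `P_x` (left movement). -/
def leftPart (σp σm : ℝ) (x : ℤ) : Matrix (Fin 2) (Fin 2) ℂ :=
  !![coin σp σm x 0 0, coin σp σm x 0 1; 0, 0]

/-- The lower row of the coin, `Q_x` (right movement). -/
def rightPart (σp σm : ℝ) (x : ℤ) : Matrix (Fin 2) (Fin 2) ℂ :=
  !![0, 0; coin σp σm x 1 0, coin σp σm x 1 1]

/-- The state `Ψ_t(x)` of the walk started at the origin in the coin state `ᵀ[α, β]`: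
`Ψ_{t+1}(x) = P_{x+1} Ψ_t(x+1) + Q_{x-1} Ψ_t(x-1)`. -/
def state (σp σm : ℝ) (α β : ℂ) : ℕ → ℤ → Fin 2 → ℂ
  | 0, x => if x = 0 then ![α, β] else 0
  | t + 1, x =>
      Matrix.mulVec (leftPart σp σm (x + 1)) (state σp σm α β t (x + 1)) +
        Matrix.mulVec (rightPart σp σm (x - 1)) (state σp σm α β t (x - 1))

/-- The probability `P(X_t = x) = ‖Ψ_t(x)‖²`. -/
def prob (σp σm : ℝ) (α β : ℂ) (t : ℕ) (x : ℤ) : ℝ :=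
  ‖state σp σm α β t x 0‖ ^ 2 + ‖state σp σm α β t x 1‖ ^ 2

/-- The law of `X_t`, a measure on `ℤ`. -/
def positionLaw (σp σm : ℝ) (α β : ℂ) (t : ℕ) : Measure ℤ :=
  Measure.sum fun x : ℤ => ENNReal.ofReal (prob σp σm α β t x) • Measure.dirac x

/-- The law of `X_t / t`, a measure on `ℝ`. -/
def rescaledLaw (σp σm : ℝ) (α β : ℂ) (t : ℕ) : Measure ℝ :=
  (positionLaw σp σm α β t).map fun x : ℤ => (x : ℝ) / (t : ℝ)

/-- The summand `ν^{(ε)}(x)` of the time-averaged limit measure, for a sign `ε = ±1`;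
`φ` is the difference of the arguments of `α` and `β`. -/
def nu (ε σp σm a b φ : ℝ) (x : ℤ) : ℝ :=
  ((1 + ε * Real.sqrt 2 * Real.sin ((σp - σm) / 2)) /
      (3 + 2 * ε * Real.sqrt 2 * Real.sin ((σp - σm) / 2))) ^ 2 *
    (1 + 2 * ε * a * b * Real.sin (φ - (σp + σm) / 2)) *
    (if x = 0 then 1 else
      (2 + ε * Real.sqrt 2 * Real.sin ((σp - σm) / 2)) *
        (1 / (3 + 2 * ε * Real.sqrt 2 * Real.sin ((σp - σm) / 2))) ^ x.natAbs)

open Classical in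
/-- The explicit time-averaged limit measure. -/
def timeAveragedLimit (σp σm a b φ : ℝ) (x : ℤ) : ℝ :=
  (if -(1 / Real.sqrt 2) ≤ Real.sin ((σp - σm) / 2) then nu 1 σp σm a b φ x else 0) +
    (if Real.sin ((σp - σm) / 2) ≤ 1 / Real.sqrt 2 then nu (-1) σp σm a b φ x else 0)

/-- `C`, the total mass of the time-averaged limit measure. -/
def localizedMass (σp σm a b φ : ℝ) : ℝ :=
  ∑' x : ℤ, timeAveragedLimit σp σm a b φ x

/-- Konno's density `f_K(x; r)`. -/
def konnoDensity (x r : ℝ) : ℝ :=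
  Set.indicator (Set.Ioo (-r) r)
    (fun y => Real.sqrt (1 - r ^ 2) / (Real.pi * (1 - y ^ 2) * Real.sqrt (r ^ 2 - y ^ 2))) x

open Classical in
/-- The phase `γ(x)`. -/
def gam (σp σm φ x : ℝ) : ℝ :=
  if 0 ≤ x then φ - σm else -φ + σp

/-- The rational weight `w(x)`. -/
def weight (σp σm a b φ x : ℝ) : ℝ :=
  let σ := (σp - σm) / 2
  let γ := gam σp σm φ x
  let s₂ := 4 * Real.cos σ ^ 4
  let s₁ := 4 * Real.cos σ ^ 2 * (1 + 2 * Real.sin σ ^ 2)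
  let s₀ := Real.cos (2 * σ) ^ 2
  let t₃ := 4 * Real.cos σ ^ 2 * (b ^ 2 - a ^ 2)
  let t₂ := 4 * (Real.cos σ ^ 2 * (1 + Real.sqrt 2 * a * b * Real.sign x * Real.cos γ) +
    Real.sqrt 2 * a * b * Real.sign x * Real.sin γ * Real.sin (2 * σ))
  let t₁ := 2 * (b ^ 2 - a ^ 2)
  let t₀ := 2 * (1 + Real.sqrt 2 * a * b * Real.sign x * Real.cos γ -
    Real.sqrt 2 * a * b * Real.sign x * Real.sin γ * Real.sin (2 * σ))
  (t₃ * x ^ 5 + t₂ * x ^ 4 + t₁ * x ^ 3 + t₀ * x ^ 2) / (s₂ * x ^ 4 + s₁ * x ^ 2 + s₀)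

/-- The limit law `C δ₀(dx) + w(x) f_K(x; 1/√2) dx`. -/
def limitLaw (σp σm a b φ : ℝ) : Measure ℝ :=
  ENNReal.ofReal (localizedMass σp σm a b φ) • Measure.dirac 0 +
    volume.withDensity fun x =>
      ENNReal.ofReal (weight σp σm a b φ x * konnoDensity x (1 / Real.sqrt 2))

end

end TwoPhaseWalk

namespace TwoPhaseWalk

open ComplexConjugate

/-! The time generating functions of the walk solve a scattering problem. On a homogeneous half-line
the recursion in space has one growing and one decaying mode, and since all amplitudes are bounded
by one, the growing mode is absent (`growing_mode_eq_zero`). Each half-line therefore acts on the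
origin only as a reflector, whose amplitude y = `refl Z` depends on Z = z² alone and involves s =
√(1 + Z²). The two reflectors and the initial coin state give a 2×2 linear system at the origin with
determinant (1 - cy)(1 + cy), where c = i e^{iσ}; its solution is a combination of the scalar
resolvents 1/(1 ∓ cy) (`gen_origin`).

In the unit disc each resolvent is a principal part with pole on the unit circle, whose residue may
vanish, plus a remainder that grows at most like 1/|s| (`resid_cases`, `norm_remainder_le`). A pole
in Z is a pair of bound states with eigenvalues ±μ. By Parseval the remainder vanishes in quadratic
Cesàro mean (`cesNull_of_gen`), so the amplitude at the origin is quasi-periodic in that sense. The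
recursion carries this to every site (`cesNull_state`), and orthogonality of distinct characters
yields the time average (`tendsto_average_prob_nat`).

For the weak limit, conservation of probability expresses the tail P(X_t > n) as an accumulated
flux, and the Abel sum of the tails becomes a circle mean of |λ²|ⁿ times a fixed density, λ being
the decaying multiplier (`abel_tail`). At radius e^{-η/n} the left arc of the circle contributes
nothing in the limit, because |λ| < 1 there. On the right arc |λ| = 1, and |λ²|ⁿ tends to e^{-η/v}
with v the group velocity. Taking v as coordinate turns the limit into ∫ e^{-η/v} f(v) dv with f = w
f_K (`tendsto_abel_tail`, `weight_eq_bandDensity`). Weierstrass approximation and the monotonicity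
of tails inside the light cone upgrade these Abel limits to convergence of the tails themselves
(`tendsto_of_tendsto_abelMean`).

The left half-line is the right half-line of a reflected walk (`state_reflect`). No mass escapes:
the mean value property for the resolvents gives the density total mass 1 - C (`integral_energy`,
`integral_density`), so the distribution functions converge, away from the atom at 0, to that of a
probability law. -/

/-! ### One-step recursion and conservation of probability. -/

theorem state_succ_zero (σp σm : ℝ) (α β : ℂ) (t : ℕ) (x : ℤ) :
    state σp σm α β (t + 1) x 0 = coin σp σm (x + 1) 0 0 * state σp σm α β t (x + 1) 0 +
      coin σp σm (x + 1) 0 1 * state σp σm α β t (x + 1) 1 := by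
  simp [state, leftPart, rightPart, dotProduct, Fin.sum_univ_two]

theorem state_succ_one (σp σm : ℝ) (α β : ℂ) (t : ℕ) (x : ℤ) :
    state σp σm α β (t + 1) x 1 = coin σp σm (x - 1) 1 0 * state σp σm α β t (x - 1) 0 +
      coin σp σm (x - 1) 1 1 * state σp σm α β t (x - 1) 1 := by
  simp [state, leftPart, rightPart, dotProduct, Fin.sum_univ_two]

theorem coin_of_pos (σp σm : ℝ) {x : ℤ} (hx : 1 ≤ x) : coin σp σm x = phaseCoin σp := by
  simp [coin, hx]

theorem coin_of_neg (σp σm : ℝ) {x : ℤ} (hx : x ≤ -1) : coin σp σm x = phaseCoin σm := by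
  have : ¬ 1 ≤ x := by omega
  simp [coin, hx, this]

theorem coin_zero (σp σm : ℝ) : coin σp σm 0 = !![1, 0; 0, -1] := by
  simp [coin]

theorem state_zero (σp σm : ℝ) (α β : ℂ) (x : ℤ) :
    state σp σm α β 0 x = if x = 0 then ![α, β] else 0 := rfl

/-- The walk has speed at most one. -/
theorem state_eq_zero_of_lt (σp σm : ℝ) (α β : ℂ) (t : ℕ) (x : ℤ) (h : (t : ℤ) < |x|) (i : Fin 2) :
    state σp σm α β t x i = 0 := by
  induction t generalizing x i with
  | zero =>
    have : x ≠ 0 := by rintro rfl; simp at h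
    simp [state_zero, this]
  | succ t ih =>
    have h1 : (t : ℤ) < |x + 1| := by
      push_cast at h
      rcases abs_cases x with h2 | h2 <;> rcases abs_cases (x + 1) with h3 | h3 <;> omega
    have h2 : (t : ℤ) < |x - 1| := by
      push_cast at h
      rcases abs_cases x with h2 | h2 <;> rcases abs_cases (x - 1) with h3 | h3 <;> omega
    fin_cases i
    · simpa [ih _ h1] using state_succ_zero σp σm α β t x
    · simpa [ih _ h2] using state_succ_one σp σm α β t x

theorem norm_exp_I_mul_ofReal' (s : ℝ) : ‖Complex.exp (Complex.I * s)‖ = 1 := by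
  rw [mul_comm]; exact Complex.norm_exp_ofReal_mul_I s

theorem sqrtTwo_inv_sq : ((1 / Real.sqrt 2 : ℝ)) ^ 2 = 1 / 2 := by
  rw [div_pow, Real.sq_sqrt (by norm_num)]; norm_num

theorem phaseCoin_norm_sq (s : ℝ) (A B : ℂ) :
    ‖phaseCoin s 0 0 * A + phaseCoin s 0 1 * B‖ ^ 2 +
      ‖phaseCoin s 1 0 * A + phaseCoin s 1 1 * B‖ ^ 2 = ‖A‖ ^ 2 + ‖B‖ ^ 2 := by
  set e := Complex.exp (Complex.I * s) with he
  have he' : Complex.exp (-(Complex.I * s)) = (starRingEnd ℂ) e := by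
    rw [he, ← Complex.exp_conj]; simp
  have hn : e.re ^ 2 + e.im ^ 2 = 1 := by
    have := norm_exp_I_mul_ofReal' s
    rw [← he] at this
    have h2 := Complex.sq_norm e
    rw [this, Complex.normSq_apply] at h2
    nlinarith
  have h1 : phaseCoin s 0 0 * A + phaseCoin s 0 1 * B = ((1 / Real.sqrt 2 : ℝ) : ℂ) * (A + e * B) := by
    simp [phaseCoin, ← he]; ring
  have h2 : phaseCoin s 1 0 * A + phaseCoin s 1 1 * B =
      ((1 / Real.sqrt 2 : ℝ) : ℂ) * ((starRingEnd ℂ) e * A - B) := by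
    simp [phaseCoin, ← he, he']; ring
  rw [h1, h2, norm_mul, norm_mul, mul_pow, mul_pow, Complex.norm_real, Real.norm_eq_abs, sq_abs,
    sqrtTwo_inv_sq, Complex.sq_norm, Complex.sq_norm, Complex.sq_norm, Complex.sq_norm]
  simp only [Complex.normSq_apply, Complex.add_re, Complex.add_im, Complex.mul_re, Complex.mul_im,
    Complex.sub_re, Complex.sub_im, Complex.conj_re, Complex.conj_im]
  linear_combination (1 / 2 * (A.re ^ 2 + A.im ^ 2 + B.re ^ 2 + B.im ^ 2)) * hn

theorem coin_norm_sq (σp σm : ℝ) (x : ℤ) (A B : ℂ) :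
    ‖coin σp σm x 0 0 * A + coin σp σm x 0 1 * B‖ ^ 2 +
      ‖coin σp σm x 1 0 * A + coin σp σm x 1 1 * B‖ ^ 2 = ‖A‖ ^ 2 + ‖B‖ ^ 2 := by
  rcases lt_trichotomy x 0 with h | h | h
  · rw [coin_of_neg σp σm (by omega)]; exact phaseCoin_norm_sq _ _ _
  · subst h; simp [coin_zero]
  · rw [coin_of_pos σp σm (by omega)]; exact phaseCoin_norm_sq _ _ _

theorem prob_nonneg (σp σm : ℝ) (α β : ℂ) (t : ℕ) (x : ℤ) : 0 ≤ prob σp σm α β t x := by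
  unfold prob; positivity

/-- The coin at x is unitary and sends its two outputs to different neighbours, so the mass at x is
carried at the next time by one component on each side. Probability thus moves as a current through
the bonds. -/
theorem prob_eq_split (σp σm : ℝ) (α β : ℂ) (t : ℕ) (x : ℤ) :
    prob σp σm α β t x = ‖state σp σm α β (t + 1) (x - 1) 0‖ ^ 2 +
      ‖state σp σm α β (t + 1) (x + 1) 1‖ ^ 2 := by
  rw [state_succ_zero, state_succ_one]
  simp only [sub_add_cancel, add_sub_cancel_right]
  rw [coin_norm_sq]; rfl

theorem prob_eq_zero_of_lt (σp σm : ℝ) (α β : ℂ) (t : ℕ) (x : ℤ) (h : (t : ℤ) < |x|) :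
    prob σp σm α β t x = 0 := by
  simp [prob, state_eq_zero_of_lt σp σm α β t x h]

theorem finite_support_int {f : ℤ → ℝ} (t : ℕ) (h : ∀ x : ℤ, (t : ℤ) < |x| → f x = 0) :
    f.HasFiniteSupport := by
  refine (Set.finite_Icc (-(t : ℤ)) t).subset fun x hx => ?_
  by_contra hc
  refine hx (h x ?_)
  rw [Set.mem_Icc, ← abs_le] at hc
  omega

theorem summable_norm_sq_state (σp σm : ℝ) (α β : ℂ) (t : ℕ) (i : Fin 2) :
    Summable fun x : ℤ => ‖state σp σm α β t x i‖ ^ 2 :=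
  summable_of_hasFiniteSupport (finite_support_int t fun x hx => by
    simp [state_eq_zero_of_lt σp σm α β t x hx])

theorem summable_prob (σp σm : ℝ) (α β : ℂ) (t : ℕ) : Summable (prob σp σm α β t) :=
  summable_of_hasFiniteSupport (finite_support_int t fun x hx =>
    prob_eq_zero_of_lt σp σm α β t x hx)

theorem tsum_prob (σp σm : ℝ) (α β : ℂ) (h : ‖α‖ ^ 2 + ‖β‖ ^ 2 = 1) (t : ℕ) :
    ∑' x, prob σp σm α β t x = 1 := by
  induction t with
  | zero =>
    rw [tsum_eq_single 0]
    · simpa [prob, state_zero] using h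
    · intro x hx; simp [prob, state_zero, hx]
  | succ t ih =>
    rw [← ih]
    have s0 := summable_norm_sq_state σp σm α β (t + 1) 0
    have s1 := summable_norm_sq_state σp σm α β (t + 1) 1
    have e1 : ∑' x : ℤ, ‖state σp σm α β (t + 1) (x - 1) 0‖ ^ 2 =
        ∑' x : ℤ, ‖state σp σm α β (t + 1) x 0‖ ^ 2 :=
      (Equiv.subRight (1 : ℤ)).tsum_eq fun x => ‖state σp σm α β (t + 1) x 0‖ ^ 2
    have e2 : ∑' x : ℤ, ‖state σp σm α β (t + 1) (x + 1) 1‖ ^ 2 =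
        ∑' x : ℤ, ‖state σp σm α β (t + 1) x 1‖ ^ 2 :=
      (Equiv.addRight (1 : ℤ)).tsum_eq fun x => ‖state σp σm α β (t + 1) x 1‖ ^ 2
    simp_rw [prob_eq_split σp σm α β t]
    unfold prob
    rw [s0.tsum_add s1, Summable.tsum_add, e1, e2]
    · exact ((Equiv.subRight (1 : ℤ)).summable_iff
        (f := fun x => ‖state σp σm α β (t + 1) x 0‖ ^ 2)).2 s0
    · exact ((Equiv.addRight (1 : ℤ)).summable_iff
        (f := fun x => ‖state σp σm α β (t + 1) x 1‖ ^ 2)).2 s1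

theorem prob_le_one (σp σm : ℝ) (α β : ℂ) (h : ‖α‖ ^ 2 + ‖β‖ ^ 2 = 1) (t : ℕ) (x : ℤ) :
    prob σp σm α β t x ≤ 1 := by
  rw [← tsum_prob σp σm α β h t]
  exact (summable_prob σp σm α β t).le_tsum x fun y _ => prob_nonneg _ _ _ _ _ _

theorem norm_state_le_one (σp σm : ℝ) (α β : ℂ) (h : ‖α‖ ^ 2 + ‖β‖ ^ 2 = 1) (t : ℕ) (x : ℤ)
    (i : Fin 2) : ‖state σp σm α β t x i‖ ≤ 1 := by
  have h1 := prob_le_one σp σm α β h t x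
  unfold prob at h1
  have h2 := sq_nonneg ‖state σp σm α β t x 0‖
  have h3 := sq_nonneg ‖state σp σm α β t x 1‖
  rw [← abs_norm, ← sq_le_one_iff_abs_le_one]
  fin_cases i
  · show ‖state σp σm α β t x 0‖ ^ 2 ≤ 1
    linarith
  · show ‖state σp σm α β t x 1‖ ^ 2 ≤ 1
    linarith

/-! ### Tail probabilities and the flux through a bond. -/

/-- The probability that the walker is to the right of `n`. -/
noncomputable def tail (σp σm : ℝ) (α β : ℂ) (n : ℤ) (t : ℕ) : ℝ :=
  ∑' k : ℕ, prob σp σm α β t (n + 1 + k)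

theorem injective_shift (n : ℤ) : Function.Injective fun k : ℕ => n + k := fun a b h => by
  simpa using h

theorem summable_shift {f : ℤ → ℝ} (hf : Summable f) (n : ℤ) : Summable fun k : ℕ => f (n + k) :=
  hf.comp_injective (injective_shift n)

theorem tail_eq_add (σp σm : ℝ) (α β : ℂ) (n : ℤ) (t : ℕ) :
    tail σp σm α β n t = prob σp σm α β t (n + 1) + tail σp σm α β (n + 1) t := by
  unfold tail
  rw [(summable_shift (summable_prob σp σm α β t) (n + 1)).tsum_eq_zero_add]
  simp only [Nat.cast_zero, add_zero, Nat.cast_add, Nat.cast_one]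
  congr 1
  exact tsum_congr fun k => by congr 1; ring

theorem tail_nonneg (σp σm : ℝ) (α β : ℂ) (n : ℤ) (t : ℕ) : 0 ≤ tail σp σm α β n t :=
  tsum_nonneg fun _ => prob_nonneg _ _ _ _ _ _

theorem tail_le_one (σp σm : ℝ) (α β : ℂ) (h : ‖α‖ ^ 2 + ‖β‖ ^ 2 = 1) (n : ℤ) (t : ℕ) :
    tail σp σm α β n t ≤ 1 := by
  rw [← tsum_prob σp σm α β h t]
  exact tsum_comp_le_tsum_of_inj (summable_prob σp σm α β t)
    (fun y => prob_nonneg _ _ _ _ _ _) (injective_shift (n + 1))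

/-- The probability flux through the bond between `n` and `n + 1`. -/
theorem tail_succ (σp σm : ℝ) (α β : ℂ) (n : ℤ) (t : ℕ) :
    tail σp σm α β n (t + 1) = tail σp σm α β n t +
      (‖state σp σm α β (t + 1) (n + 1) 1‖ ^ 2 - ‖state σp σm α β (t + 1) n 0‖ ^ 2) := by
  have s0 := summable_norm_sq_state σp σm α β (t + 1) 0
  have s1 := summable_norm_sq_state σp σm α β (t + 1) 1
  have a0 := summable_shift s0 (n + 1)
  have a1 := summable_shift s1 (n + 1)
  have b0 := summable_shift s0 n
  have b1 := summable_shift s1 (n + 1 + 1)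
  have e1 : tail σp σm α β n t = ∑' k : ℕ, ‖state σp σm α β (t + 1) (n + k) 0‖ ^ 2 +
      ∑' k : ℕ, ‖state σp σm α β (t + 1) (n + 1 + 1 + k) 1‖ ^ 2 := by
    rw [← b0.tsum_add b1]
    unfold tail
    refine tsum_congr fun k => ?_
    rw [prob_eq_split]
    congr 4 <;> ring
  have e2 : tail σp σm α β n (t + 1) = ∑' k : ℕ, ‖state σp σm α β (t + 1) (n + 1 + k) 0‖ ^ 2 +
      ∑' k : ℕ, ‖state σp σm α β (t + 1) (n + 1 + k) 1‖ ^ 2 := by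
    rw [← a0.tsum_add a1]; rfl
  rw [e1, e2, b0.tsum_eq_zero_add, a1.tsum_eq_zero_add]
  have c1 : ∀ k : ℕ, n + ((k + 1 : ℕ) : ℤ) = n + 1 + k := fun k => by push_cast; ring
  have c2 : ∀ k : ℕ, n + 1 + ((k + 1 : ℕ) : ℤ) = n + 1 + 1 + k := fun k => by push_cast; ring
  simp only [c1, c2, Nat.cast_zero, add_zero]
  ring

/-- Speed at most one: beyond n + 1 one step later requires being beyond n now. With the next two
inequalities this is the light-cone monotonicity that drives the Tauberian argument. -/
theorem tail_succ_succ_le (σp σm : ℝ) (α β : ℂ) (n : ℤ) (t : ℕ) :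
    tail σp σm α β (n + 1) (t + 1) ≤ tail σp σm α β n t := by
  have h1 := tail_succ σp σm α β n t
  have h2 := tail_eq_add σp σm α β n (t + 1)
  unfold prob at h2
  nlinarith [sq_nonneg ‖state σp σm α β (t + 1) (n + 1) 0‖,
    sq_nonneg ‖state σp σm α β (t + 1) n 0‖]

theorem tail_succ_le_tail_succ (σp σm : ℝ) (α β : ℂ) (n : ℤ) (t : ℕ) :
    tail σp σm α β (n + 1) t ≤ tail σp σm α β n (t + 1) := by
  have h1 := tail_succ σp σm α β (n + 1) t
  have h2 := tail_eq_add σp σm α β n (t + 1)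
  unfold prob at h2
  nlinarith [sq_nonneg ‖state σp σm α β (t + 1) (n + 1 + 1) 1‖,
    sq_nonneg ‖state σp σm α β (t + 1) (n + 1) 1‖]

theorem tail_succ_le (σp σm : ℝ) (α β : ℂ) (n : ℤ) (t : ℕ) :
    tail σp σm α β (n + 1) t ≤ tail σp σm α β n t := by
  have h2 := tail_eq_add σp σm α β n t
  linarith [prob_nonneg σp σm α β t (n + 1)]

/-! ### Reflection symmetry. -/

/-- Swapping the chiralities exchanges the diagonal entries 1 and -1. An overall sign restores them
and turns the off-diagonal e^{-is} into -e^{-is} = e^{i(π - s)}, which is why reflected phases are π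
minus the original ones. -/
theorem phaseCoin_reflect (s : ℝ) :
    phaseCoin (Real.pi - s) = !![-phaseCoin s 1 1, -phaseCoin s 1 0;
      -phaseCoin s 0 1, -phaseCoin s 0 0] := by
  have h1 : Complex.exp (Complex.I * ((Real.pi - s : ℝ) : ℂ)) = -Complex.exp (-(Complex.I * s)) := by
    push_cast
    rw [mul_sub, sub_eq_add_neg, Complex.exp_add, mul_comm Complex.I, Complex.exp_pi_mul_I]; ring
  have h2 : Complex.exp (-(Complex.I * ((Real.pi - s : ℝ) : ℂ))) = -Complex.exp (Complex.I * s) := by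
    push_cast
    rw [mul_sub, neg_sub, sub_eq_add_neg, Complex.exp_add, Complex.exp_neg, mul_comm Complex.I Real.pi,
      Complex.exp_pi_mul_I]
    ring
  unfold phaseCoin
  rw [h1, h2]
  ext i j
  fin_cases i <;> fin_cases j <;> simp

theorem coin_reflect (σp σm : ℝ) (x : ℤ) :
    coin (Real.pi - σm) (Real.pi - σp) x = !![-coin σp σm (-x) 1 1, -coin σp σm (-x) 1 0;
      -coin σp σm (-x) 0 1, -coin σp σm (-x) 0 0] := by
  rcases lt_trichotomy x 0 with h | h | h
  · rw [coin_of_neg _ _ (by omega), coin_of_pos σp σm (x := -x) (by omega), phaseCoin_reflect]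
  · subst h; simp [coin_zero]
  · rw [coin_of_pos _ _ (by omega), coin_of_neg σp σm (x := -x) (by omega), phaseCoin_reflect]

/-- Reflecting space exchanges the two chiralities. -/
theorem state_reflect (σp σm : ℝ) (α β : ℂ) (t : ℕ) (x : ℤ) :
    state (Real.pi - σm) (Real.pi - σp) β α t x 0 = (-1) ^ t * state σp σm α β t (-x) 1 ∧
    state (Real.pi - σm) (Real.pi - σp) β α t x 1 = (-1) ^ t * state σp σm α β t (-x) 0 := by
  induction t generalizing x with
  | zero =>
    by_cases h : x = 0 <;> simp [state_zero, h]
  | succ t ih =>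
    rw [state_succ_zero, state_succ_one, state_succ_zero, state_succ_one, coin_reflect, coin_reflect,
      (ih _).1, (ih _).2, (ih _).1, (ih _).2]
    have h1 : -(x + 1) = -x - 1 := by ring
    have h2 : -(x - 1) = -x + 1 := by ring
    rw [h1, h2]
    simp
    constructor <;> ring

theorem prob_reflect (σp σm : ℝ) (α β : ℂ) (t : ℕ) (x : ℤ) :
    prob (Real.pi - σm) (Real.pi - σp) β α t x = prob σp σm α β t (-x) := by
  unfold prob
  rw [(state_reflect σp σm α β t x).1, (state_reflect σp σm α β t x).2]
  simp; ring

/-! ### The square root √(1 + Z²) on the closed unit disc. -/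

/-- The principal square root of `1 + Z ^ 2`. -/
noncomputable def branchRoot (Z : ℂ) : ℂ := Complex.sqrt (1 + Z ^ 2)

theorem branchRoot_sq (Z : ℂ) : branchRoot Z ^ 2 = 1 + Z ^ 2 := by
  unfold branchRoot Complex.sqrt
  have h := Complex.cpow_nat_inv_pow (1 + Z ^ 2) (n := 2) (by norm_num)
  rwa [Nat.cast_ofNat] at h

theorem branchRoot_re_nonneg (Z : ℂ) : 0 ≤ (branchRoot Z).re := by
  unfold branchRoot Complex.sqrt
  rw [Complex.cpow_inv_two_re]
  positivity

theorem branchRoot_neg (Z : ℂ) : branchRoot (-Z) = branchRoot Z := by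
  unfold branchRoot; rw [neg_sq]

theorem re_sq_nonneg_of_norm_le {Z : ℂ} (hZ : ‖Z‖ ≤ 1) : 0 ≤ (1 + Z ^ 2).re := by
  have h : ‖Z ^ 2‖ ≤ 1 := by rw [norm_pow]; exact pow_le_one₀ (norm_nonneg _) hZ
  have := (abs_le.1 ((Complex.abs_re_le_norm (Z ^ 2)).trans h)).1
  simp only [Complex.add_re, Complex.one_re]; linarith

theorem abs_im_le_re_of_sq {w : ℂ} (h : 0 ≤ (w ^ 2).re) (h0 : 0 ≤ w.re) : |w.im| ≤ w.re := by
  rw [sq, Complex.mul_re] at h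
  exact abs_le_of_sq_le_sq (by nlinarith) h0

theorem re_mul_conj_nonneg {a b : ℂ} (ha : |a.im| ≤ a.re) (hb : |b.im| ≤ b.re) :
    0 ≤ (a * conj b).re := by
  simp only [Complex.mul_re, Complex.conj_re, Complex.conj_im]
  have h1 := abs_le.1 ha
  have h2 := abs_le.1 hb
  nlinarith [abs_nonneg a.im, abs_nonneg b.im, mul_nonneg (abs_nonneg a.im) (abs_nonneg b.im)]

theorem norm_le_norm_add {a b : ℂ} (h : 0 ≤ (a * conj b).re) : ‖a‖ ≤ ‖a + b‖ := by
  rw [← abs_norm, ← abs_norm (a + b), ← sq_le_sq, Complex.sq_norm, Complex.sq_norm,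
    Complex.normSq_add]
  nlinarith [Complex.normSq_nonneg b]

theorem branchRoot_abs_im_le {Z : ℂ} (hZ : ‖Z‖ ≤ 1) : |(branchRoot Z).im| ≤ (branchRoot Z).re :=
  abs_im_le_re_of_sq (by rw [branchRoot_sq]; exact re_sq_nonneg_of_norm_le hZ)
    (branchRoot_re_nonneg Z)

/-- Both roots lie in the sector |arg| ≤ π/4, so their sum is at least as long as either of them;
now use that the product of difference and sum is W² - Z². This weighted Lipschitz bound is the
source of the inverse square-root estimate for `remainder`. -/
theorem norm_branchRoot_sub_mul_le {Z W : ℂ} (hZ : ‖Z‖ ≤ 1) (hW : ‖W‖ ≤ 1) :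
    ‖branchRoot W - branchRoot Z‖ * ‖branchRoot Z‖ ≤ 2 * ‖W - Z‖ := by
  calc ‖branchRoot W - branchRoot Z‖ * ‖branchRoot Z‖
      ≤ ‖branchRoot W - branchRoot Z‖ * ‖branchRoot Z + branchRoot W‖ := by
        gcongr
        exact norm_le_norm_add (re_mul_conj_nonneg (branchRoot_abs_im_le hZ)
          (branchRoot_abs_im_le hW))
    _ = ‖(W + Z) * (W - Z)‖ := by
        rw [← norm_mul]; congr 1
        linear_combination branchRoot_sq W - branchRoot_sq Z
    _ ≤ 2 * ‖W - Z‖ := by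
        rw [norm_mul]; gcongr
        exact (norm_add_le _ _).trans (by linarith)

theorem mem_slitPlane_of_norm_le {Z : ℂ} (hZ : ‖Z‖ ≤ 1) (h : 1 + Z ^ 2 ≠ 0) :
    1 + Z ^ 2 ∈ Complex.slitPlane := by
  rw [Complex.mem_slitPlane_iff]
  by_contra! hc
  have := re_sq_nonneg_of_norm_le hZ
  exact h (Complex.ext (by simp only [Complex.zero_re]; linarith) hc.2)

theorem one_add_sq_ne_zero {Z : ℂ} (hZ : ‖Z‖ < 1) : 1 + Z ^ 2 ≠ 0 := by
  intro h
  have h1 : Z ^ 2 = -1 := by linear_combination h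
  have h2 : ‖Z‖ ^ 2 = 1 := by rw [← norm_pow, h1]; simp
  nlinarith [norm_nonneg Z]

theorem branchRoot_ne_zero {Z : ℂ} (h : 1 + Z ^ 2 ≠ 0) : branchRoot Z ≠ 0 := fun h0 => by
  apply h; rw [← branchRoot_sq, h0]; simp

theorem branchRoot_eq {Z w : ℂ} (h : w ^ 2 = 1 + Z ^ 2) (h0 : 0 < w.re) : branchRoot Z = w := by
  have h1 : (branchRoot Z - w) * (branchRoot Z + w) = 0 := by
    linear_combination branchRoot_sq Z - h
  rcases mul_eq_zero.1 h1 with h2 | h2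
  · exact sub_eq_zero.1 h2
  · have := congrArg Complex.re h2
    simp only [Complex.add_re, Complex.zero_re] at this
    linarith [branchRoot_re_nonneg Z]

theorem continuousAt_branchRoot {Z : ℂ} (hZ : ‖Z‖ ≤ 1) (h : 1 + Z ^ 2 ≠ 0) :
    ContinuousAt branchRoot Z := by
  unfold branchRoot Complex.sqrt
  exact ContinuousAt.cpow (by fun_prop) (by fun_prop) (mem_slitPlane_of_norm_le hZ h)

theorem hasDerivAt_branchRoot {Z : ℂ} (hZ : ‖Z‖ ≤ 1) (h : 1 + Z ^ 2 ≠ 0) :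
    HasDerivAt branchRoot (Z / branchRoot Z) Z := by
  have h0 : HasDerivAt (fun W : ℂ => 1 + W ^ 2) (2 * Z) Z := by
    simpa using (hasDerivAt_pow 2 Z).const_add 1
  have h1 : HasDerivAt branchRoot _ Z := h0.cpow_const (c := 2⁻¹) (mem_slitPlane_of_norm_le hZ h)
  convert h1 using 1
  have h2 : (1 + Z ^ 2) ^ ((2 : ℂ)⁻¹ - 1) = branchRoot Z / (1 + Z ^ 2) := by
    rw [Complex.cpow_sub _ _ h, Complex.cpow_one]; rfl
  rw [h2]
  have h3 := branchRoot_ne_zero h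
  field_simp
  rw [branchRoot_sq]

theorem norm_sub_lt_norm_add {a b : ℂ} (h : 0 < (a * conj b).re) : ‖a - b‖ < ‖a + b‖ := by
  rw [← abs_norm, ← abs_norm (a + b), ← sq_lt_sq, Complex.sq_norm, Complex.sq_norm,
    Complex.normSq_add, Complex.normSq_sub]
  linarith

theorem norm_sub_le_norm_add {a b : ℂ} (h : 0 ≤ (a * conj b).re) : ‖a - b‖ ≤ ‖a + b‖ := by
  rw [← abs_norm, ← abs_norm (a + b), ← sq_le_sq, Complex.sq_norm, Complex.sq_norm,
    Complex.normSq_add, Complex.normSq_sub]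
  linarith

/-- If the product were purely imaginary, (1 - Z)² would be a nonpositive real multiple of 1 + Z².
Comparing real and imaginary parts, this forces |Z| = 1 for non-real Z and is impossible for real Z
in the disc. -/
theorem re_one_sub_mul_conj_branchRoot_ne_zero {Z : ℂ} (hZ : ‖Z‖ < 1) :
    ((1 - Z) * conj (branchRoot Z)).re ≠ 0 := by
  intro h
  set s := branchRoot Z with hs
  have hs2 := branchRoot_sq Z
  rw [← hs] at hs2
  have hs0 : s ≠ 0 := branchRoot_ne_zero (one_add_sq_ne_zero hZ)
  set k : ℝ := ((1 - Z) * conj s).im with hk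
  have h1 : (1 - Z) * conj s = k * Complex.I := by
    apply Complex.ext <;> simp [h, hk]
  have hN : s * conj s = (Complex.normSq s : ℂ) := Complex.mul_conj s
  have hNpos : 0 < Complex.normSq s := Complex.normSq_pos.2 hs0
  set N := Complex.normSq s
  have h2 : (1 - Z) * N = k * Complex.I * s := by rw [← hN, ← h1]; ring
  have h3 : (1 - Z) ^ 2 * (N : ℂ) ^ 2 = -(k : ℂ) ^ 2 * (1 + Z ^ 2) := by
    rw [← mul_pow, h2, ← hs2]
    linear_combination (k : ℂ) ^ 2 * s ^ 2 * Complex.I_sq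
  have hre := congrArg Complex.re h3
  have him := congrArg Complex.im h3
  have e1 : ((1 - Z) ^ 2 * (N : ℂ) ^ 2).re = ((1 - Z.re) ^ 2 - Z.im ^ 2) * N ^ 2 := by
    rw [← Complex.ofReal_pow, Complex.re_mul_ofReal]; simp [sq]
  have e2 : ((1 - Z) ^ 2 * (N : ℂ) ^ 2).im = (-2 * (1 - Z.re) * Z.im) * N ^ 2 := by
    rw [← Complex.ofReal_pow, Complex.im_mul_ofReal]; simp [sq]; ring
  have e3 : (-(k : ℂ) ^ 2 * (1 + Z ^ 2)).re = -k ^ 2 * (1 + Z.re ^ 2 - Z.im ^ 2) := by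
    rw [← Complex.ofReal_pow, ← Complex.ofReal_neg, Complex.re_ofReal_mul]
    congr 1; simp [sq]; ring
  have e4 : (-(k : ℂ) ^ 2 * (1 + Z ^ 2)).im = -k ^ 2 * (2 * Z.re * Z.im) := by
    rw [← Complex.ofReal_pow, ← Complex.ofReal_neg, Complex.im_ofReal_mul]
    congr 1; simp [sq]; ring
  rw [e1, e3] at hre
  rw [e2, e4] at him
  have hlt : Z.re ^ 2 + Z.im ^ 2 < 1 := by
    have := Complex.sq_norm Z
    rw [Complex.normSq_apply] at this
    nlinarith [norm_nonneg Z]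
  have hN2 : 0 < N ^ 2 := by positivity
  have hk2 : 0 ≤ k ^ 2 := sq_nonneg k
  by_cases hb : Z.im = 0
  · rw [hb] at hre hlt
    have : 0 < (1 - Z.re) ^ 2 := by
      have : Z.re < 1 := by nlinarith
      have : 0 < 1 - Z.re := by linarith
      positivity
    nlinarith [mul_pos this hN2, mul_nonneg hk2 (sq_nonneg Z.re)]
  · have h5 : (1 - Z.re) * N ^ 2 = k ^ 2 * Z.re := by
      apply mul_right_cancel₀ hb; linarith
    have h6 : Z.re < 1 := by nlinarith [sq_nonneg Z.im]
    have h7 : 0 < k ^ 2 * Z.re := by rw [← h5]; exact mul_pos (by linarith) hN2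
    have h8 : 0 < k ^ 2 := by
      rcases hk2.lt_or_eq with h | h
      · exact h
      · rw [← h] at h7; simp at h7
    have h9 : 0 < Z.re := by
      by_contra hc
      nlinarith
    -- Inserting `h5` into the real-part equation eliminates k² and leaves (1 - |Z|²) N² = 0.
    have h10 : Z.re * (((1 - Z.re) ^ 2 - Z.im ^ 2) * N ^ 2) =
        -(1 - Z.re) * N ^ 2 * (1 + Z.re ^ 2 - Z.im ^ 2) := by
      rw [hre]; linear_combination (-(1 + Z.re ^ 2 - Z.im ^ 2)) * (-h5)
    have h11 : (1 - Z.re ^ 2 - Z.im ^ 2) * N ^ 2 = 0 := by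
      linear_combination h10
    have : 0 < (1 - Z.re ^ 2 - Z.im ^ 2) * N ^ 2 := mul_pos (by linarith) hN2
    linarith

/-- The value at 0 is 1 and zero is never attained, so the intermediate value theorem along the
segment from 0 to Z settles the sign. This sign decides which of the two multipliers decays. -/
theorem re_one_sub_mul_conj_branchRoot_pos {Z : ℂ} (hZ : ‖Z‖ < 1) :
    0 < ((1 - Z) * conj (branchRoot Z)).re := by
  have hn : ∀ t ∈ Set.Icc (0 : ℝ) 1, ‖(t : ℂ) * Z‖ < 1 := fun t ht => by
    rw [norm_mul, Complex.norm_real, Real.norm_eq_abs, abs_of_nonneg ht.1]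
    nlinarith [ht.2, norm_nonneg Z]
  set f : ℝ → ℝ := fun t => ((1 - (t : ℂ) * Z) * conj (branchRoot ((t : ℂ) * Z))).re with hf
  have hc : ContinuousOn f (Set.Icc 0 1) := by
    intro t ht
    have h1 : ContinuousAt (fun t : ℝ => branchRoot ((t : ℂ) * Z)) t :=
      ContinuousAt.comp (f := fun t : ℝ => (t : ℂ) * Z) (g := branchRoot)
        (continuousAt_branchRoot (hn t ht).le (one_add_sq_ne_zero (hn t ht))) (by fun_prop)
    have h2 : ContinuousAt (fun t : ℝ => conj (branchRoot ((t : ℂ) * Z))) t :=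
      Complex.continuous_conj.continuousAt.comp h1
    exact (Complex.continuous_re.continuousAt.comp
      (ContinuousAt.mul (by fun_prop) h2)).continuousWithinAt
  have h0 : f 0 = 1 := by simp [hf, branchRoot]
  have h1 : f 1 = ((1 - Z) * conj (branchRoot Z)).re := by simp [hf]
  rw [← h1]
  by_contra! hcon
  have : (0 : ℝ) ∈ Set.Icc (f 1) (f 0) := ⟨hcon, by rw [h0]; norm_num⟩
  obtain ⟨t, ht, hft⟩ := intermediate_value_Icc' (by norm_num) hc this
  exact re_one_sub_mul_conj_branchRoot_ne_zero (hn t ht) hft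

theorem re_one_sub_mul_conj_branchRoot_nonneg {Z : ℂ} (hZ : ‖Z‖ ≤ 1) (h : 1 + Z ^ 2 ≠ 0) :
    0 ≤ ((1 - Z) * conj (branchRoot Z)).re := by
  have hlim : Tendsto (fun t : ℝ => ((1 - (t : ℂ) * Z) * conj (branchRoot ((t : ℂ) * Z))).re)
      (𝓝[<] 1) (𝓝 ((1 - Z) * conj (branchRoot Z)).re) := by
    have h1 : Tendsto (fun t : ℝ => (t : ℂ) * Z) (𝓝[<] 1) (𝓝 Z) := by
      have : ContinuousAt (fun t : ℝ => (t : ℂ) * Z) 1 := by fun_prop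
      simpa [ContinuousAt] using this.tendsto.mono_left nhdsWithin_le_nhds
    have h2 := (continuousAt_branchRoot hZ h).tendsto.comp h1
    exact (Complex.continuous_re.tendsto _).comp ((tendsto_const_nhds.sub h1).mul
      ((Complex.continuous_conj.tendsto _).comp h2))
  refine ge_of_tendsto hlim ?_
  filter_upwards [Ioo_mem_nhdsLT (show (0 : ℝ) < 1 by norm_num)] with t ht
  refine (re_one_sub_mul_conj_branchRoot_pos ?_).le
  rw [norm_mul, Complex.norm_real, Real.norm_eq_abs, abs_of_pos ht.1]
  nlinarith [ht.1, ht.2, norm_nonneg Z]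

theorem re_one_add_mul_conj_branchRoot_pos {Z : ℂ} (hZ : ‖Z‖ < 1) :
    0 < ((1 + Z) * conj (branchRoot Z)).re := by
  have := re_one_sub_mul_conj_branchRoot_pos (Z := -Z) (by simpa using hZ)
  rwa [branchRoot_neg, sub_neg_eq_add] at this

theorem re_one_add_mul_conj_branchRoot_nonneg {Z : ℂ} (hZ : ‖Z‖ ≤ 1) (h : 1 + Z ^ 2 ≠ 0) :
    0 ≤ ((1 + Z) * conj (branchRoot Z)).re := by
  have := re_one_sub_mul_conj_branchRoot_nonneg (Z := -Z) (by simpa using hZ) (by simpa using h)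
  rwa [branchRoot_neg, sub_neg_eq_add] at this

/-! ### Reflection amplitude and transfer multiplier of a half-line. -/

/-- The reflection amplitude of a homogeneous half-line, as a function of `Z = z ^ 2`. -/
noncomputable def refl (Z : ℂ) : ℂ := (1 + Z - branchRoot Z) / (Real.sqrt 2 : ℝ)

/-- The conjugate branch of `refl`. -/
noncomputable def reflConj (Z : ℂ) : ℂ := (1 + Z + branchRoot Z) / (Real.sqrt 2 : ℝ)

/-- The square of the transfer multiplier of a homogeneous half-line. -/
noncomputable def multSq (Z : ℂ) : ℂ := (1 - Z - branchRoot Z) ^ 2 / (2 * Z)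

theorem sqrtTwo_sq : ((Real.sqrt 2 : ℝ) : ℂ) ^ 2 = 2 := by
  rw [← Complex.ofReal_pow, Real.sq_sqrt (by norm_num)]; norm_num

theorem sqrtTwo_ne_zero : ((Real.sqrt 2 : ℝ) : ℂ) ≠ 0 := by
  simp

/-- `refl Z` and `reflConj Z` are the two roots of y² - √2 (1 + Z) y + Z = 0. Their product and sum
eliminate the square root in later computations. -/
theorem refl_mul_reflConj (Z : ℂ) : refl Z * reflConj Z = Z := by
  unfold refl reflConj
  have h := sqrtTwo_ne_zero
  field_simp
  rw [sqrtTwo_sq]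
  linear_combination -branchRoot_sq Z

theorem refl_add_reflConj (Z : ℂ) : refl Z + reflConj Z = (Real.sqrt 2 : ℝ) * (1 + Z) := by
  unfold refl reflConj
  have h := sqrtTwo_ne_zero
  field_simp
  rw [sqrtTwo_sq]; ring

theorem norm_refl_lt_norm_reflConj {Z : ℂ} (hZ : ‖Z‖ < 1) : ‖refl Z‖ < ‖reflConj Z‖ := by
  unfold refl reflConj
  rw [norm_div, norm_div]
  have : 0 < ‖((Real.sqrt 2 : ℝ) : ℂ)‖ := norm_pos_iff.2 sqrtTwo_ne_zero
  gcongr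
  exact norm_sub_lt_norm_add (re_one_add_mul_conj_branchRoot_pos hZ)

theorem norm_refl_le_norm_reflConj {Z : ℂ} (hZ : ‖Z‖ ≤ 1) (h : 1 + Z ^ 2 ≠ 0) :
    ‖refl Z‖ ≤ ‖reflConj Z‖ := by
  unfold refl reflConj
  rw [norm_div, norm_div]
  gcongr
  exact norm_sub_le_norm_add (re_one_add_mul_conj_branchRoot_nonneg hZ h)

theorem norm_refl_sq_le {Z : ℂ} (hZ : ‖Z‖ < 1) : ‖refl Z‖ ^ 2 ≤ ‖Z‖ := by
  nth_rewrite 2 [← refl_mul_reflConj Z]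
  rw [norm_mul, sq]
  gcongr
  exact (norm_refl_lt_norm_reflConj hZ).le

theorem norm_refl_lt_one {Z : ℂ} (hZ : ‖Z‖ < 1) : ‖refl Z‖ < 1 := by
  nlinarith [norm_refl_sq_le hZ, norm_nonneg (refl Z)]

theorem norm_sq_mul_sq_eq (Z : ℂ) :
    ‖1 - Z - branchRoot Z‖ * ‖1 - Z + branchRoot Z‖ = 2 * ‖Z‖ := by
  rw [← norm_mul, show (1 - Z - branchRoot Z) * (1 - Z + branchRoot Z) = -(2 * Z) by
    linear_combination -branchRoot_sq Z]
  simp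

/-- The decaying and growing multipliers have product -1, and the sign of Re((1 - Z) s̄) says that
the numerator with -s is the shorter one. -/
theorem norm_multSq_lt_one {Z : ℂ} (hZ : ‖Z‖ < 1) : ‖multSq Z‖ < 1 := by
  rcases eq_or_ne Z 0 with rfl | h0
  · simp [multSq]
  unfold multSq
  have hp : 0 < ‖2 * Z‖ := by simp [h0]
  rw [norm_div, div_lt_one hp, norm_pow, norm_mul, Complex.norm_ofNat, ← norm_sq_mul_sq_eq, sq]
  have h1 := norm_sub_lt_norm_add (re_one_sub_mul_conj_branchRoot_pos hZ)
  have h2 : 0 < ‖1 - Z - branchRoot Z‖ := by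
    rw [norm_pos_iff]; intro h
    have := norm_sq_mul_sq_eq Z
    rw [h] at this
    simp [h0] at this
  gcongr

theorem continuousAt_refl {Z : ℂ} (hZ : ‖Z‖ ≤ 1) (h : 1 + Z ^ 2 ≠ 0) : ContinuousAt refl Z := by
  have := continuousAt_branchRoot hZ h
  unfold refl
  exact ((continuousAt_const.add continuousAt_id).sub this).div_const _

theorem continuousAt_multSq {Z : ℂ} (hZ : ‖Z‖ ≤ 1) (h : 1 + Z ^ 2 ≠ 0) (h0 : Z ≠ 0) :
    ContinuousAt multSq Z := by
  have := continuousAt_branchRoot hZ h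
  unfold multSq
  exact (((continuousAt_const.sub continuousAt_id).sub this).pow 2).div
    (continuousAt_const.mul continuousAt_id) (by simpa using h0)

/-- Only the logarithmic derivative (1 + Z)/(sZ) matters later: on the unit circle it produces the
inverse group velocity. -/
theorem hasDerivAt_multSq {Z : ℂ} (hZ : ‖Z‖ ≤ 1) (h : 1 + Z ^ 2 ≠ 0) (h0 : Z ≠ 0) :
    HasDerivAt multSq (multSq Z * (1 + Z) / (branchRoot Z * Z)) Z := by
  have h1 := hasDerivAt_branchRoot hZ h
  have h2 : HasDerivAt multSq _ Z := ((((hasDerivAt_id Z).const_sub 1).sub h1).pow 2).div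
    ((hasDerivAt_id Z).const_mul 2) (by simpa using h0)
  convert h2 using 1
  have hs := branchRoot_ne_zero h
  have hs2 := branchRoot_sq Z
  unfold multSq
  simp only [id, Pi.sub_apply, Pi.pow_apply]
  field_simp
  simp only [Nat.cast_ofNat, Nat.add_one_sub_one, pow_one]
  linear_combination (Z + branchRoot Z - 1) * hs2

/-! ### Generating functions in time. -/

theorem summable_mul_pow {a : ℕ → ℂ} {K : ℝ} (ha : ∀ t, ‖a t‖ ≤ K) {z : ℂ} (hz : ‖z‖ < 1) :
    Summable fun t => a t * z ^ t := by
  refine Summable.of_norm_bounded (g := fun t => K * ‖z‖ ^ t)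
    ((summable_geometric_of_lt_one (norm_nonneg _) hz).mul_left K) fun t => ?_
  rw [norm_mul, norm_pow]
  gcongr
  exact ha t

theorem norm_tsum_mul_pow_le {a : ℕ → ℂ} {K : ℝ} (ha : ∀ t, ‖a t‖ ≤ K) {z : ℂ} (hz : ‖z‖ < 1) :
    ‖∑' t, a t * z ^ t‖ ≤ K * (1 - ‖z‖)⁻¹ := by
  refine tsum_of_norm_bounded ((hasSum_geometric_of_lt_one (norm_nonneg _) hz).mul_left K)
    fun t => ?_
  rw [norm_mul, norm_pow]
  gcongr
  exact ha t

theorem tsum_mul_pow_eq_add {a : ℕ → ℂ} {K : ℝ} (ha : ∀ t, ‖a t‖ ≤ K) {z : ℂ} (hz : ‖z‖ < 1) :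
    ∑' t, a t * z ^ t = a 0 + z * ∑' t, a (t + 1) * z ^ t := by
  rw [(summable_mul_pow ha hz).tsum_eq_zero_add, ← tsum_mul_left]
  simp only [pow_zero, mul_one]
  congr 1
  exact tsum_congr fun t => by ring

/-- The generating function in time of a component of the state at `x`. -/
noncomputable def gen (σp σm : ℝ) (α β : ℂ) (x : ℤ) (i : Fin 2) (z : ℂ) : ℂ :=
  ∑' t : ℕ, state σp σm α β t x i * z ^ t

section
variable (σp σm : ℝ) (α β : ℂ) (h : ‖α‖ ^ 2 + ‖β‖ ^ 2 = 1) {z : ℂ} (hz : ‖z‖ < 1)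
include h hz

theorem norm_gen_le (x : ℤ) (i : Fin 2) : ‖gen σp σm α β x i z‖ ≤ (1 - ‖z‖)⁻¹ := by
  have := norm_tsum_mul_pow_le (fun t => norm_state_le_one σp σm α β h t x i) hz
  rwa [one_mul] at this

theorem tsum_two_mul_pow (x : ℤ) (a b : ℂ) :
    ∑' t, (a * state σp σm α β t x 0 + b * state σp σm α β t x 1) * z ^ t =
      a * gen σp σm α β x 0 z + b * gen σp σm α β x 1 z := by
  have s0 := (summable_mul_pow (fun t => norm_state_le_one σp σm α β h t x 0) hz).mul_left a
  have s1 := (summable_mul_pow (fun t => norm_state_le_one σp σm α β h t x 1) hz).mul_left b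
  unfold gen
  rw [← tsum_mul_left, ← tsum_mul_left, ← s0.tsum_add s1]
  exact tsum_congr fun t => by ring

theorem gen_zero_eq (x : ℤ) : gen σp σm α β x 0 z = state σp σm α β 0 x 0 +
    z * (coin σp σm (x + 1) 0 0 * gen σp σm α β (x + 1) 0 z +
      coin σp σm (x + 1) 0 1 * gen σp σm α β (x + 1) 1 z) := by
  rw [← tsum_two_mul_pow σp σm α β h hz]
  unfold gen
  rw [tsum_mul_pow_eq_add (fun t => norm_state_le_one σp σm α β h t x 0) hz]
  simp_rw [state_succ_zero]

theorem gen_one_eq (x : ℤ) : gen σp σm α β x 1 z = state σp σm α β 0 x 1 +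
    z * (coin σp σm (x - 1) 1 0 * gen σp σm α β (x - 1) 0 z +
      coin σp σm (x - 1) 1 1 * gen σp σm α β (x - 1) 1 z) := by
  rw [← tsum_two_mul_pow σp σm α β h hz]
  unfold gen
  rw [tsum_mul_pow_eq_add (fun t => norm_state_le_one σp σm α β h t x 1) hz]
  simp_rw [state_succ_one]

theorem sqrtTwo_mul_gen_zero (n : ℕ) : (Real.sqrt 2 : ℝ) *
    (gen σp σm α β n 0 z - state σp σm α β 0 n 0) =
      z * (gen σp σm α β (n + 1) 0 z + Complex.exp (Complex.I * σp) * gen σp σm α β (n + 1) 1 z) := by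
  rw [gen_zero_eq σp σm α β h hz, coin_of_pos σp σm (by omega)]
  simp [phaseCoin]
  have := sqrtTwo_ne_zero
  field_simp

theorem gen_one_one : gen σp σm α β 1 1 z = -(z * gen σp σm α β 0 1 z) := by
  rw [gen_one_eq σp σm α β h hz]
  simp [coin_zero, state_zero]

theorem sqrtTwo_mul_gen_one (n : ℕ) (hn : 1 ≤ n) : (Real.sqrt 2 : ℝ) *
    (Complex.exp (Complex.I * σp) * gen σp σm α β (n + 1) 1 z) =
      z * (gen σp σm α β n 0 z - Complex.exp (Complex.I * σp) * gen σp σm α β n 1 z) := by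
  rw [gen_one_eq σp σm α β h hz, add_sub_cancel_right, coin_of_pos σp σm (by omega), state_zero,
    if_neg (by omega)]
  have h1 := sqrtTwo_ne_zero
  have h2 : Complex.exp (Complex.I * σp) * Complex.exp (-(Complex.I * σp)) = 1 := by
    rw [← Complex.exp_add]; simp
  simp [phaseCoin]
  field_simp
  linear_combination z * gen σp σm α β n 0 z * h2

end

/-! ### The transfer recursion on the right half-line. -/

theorem mul_conj_branches (Z : ℂ) :
    (1 - Z - branchRoot Z) * (1 - Z + branchRoot Z) = -(2 * Z) := by
  linear_combination -branchRoot_sq Z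

theorem one_add_branchRoot_ne_zero (Z : ℂ) : 1 + branchRoot Z ≠ 0 := fun h => by
  have := congrArg Complex.re h
  simp at this
  linarith [branchRoot_re_nonneg Z]

theorem one_lt_norm_growing {z : ℂ} (h0 : z ≠ 0) (hz : ‖z‖ < 1) :
    1 < ‖(1 - z ^ 2 + branchRoot (z ^ 2)) / ((Real.sqrt 2 : ℝ) * z)‖ := by
  have hZ : ‖z ^ 2‖ < 1 := by rw [norm_pow]; exact pow_lt_one₀ (norm_nonneg _) hz (by norm_num)
  have h1 := norm_sub_lt_norm_add (re_one_sub_mul_conj_branchRoot_pos hZ)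
  have h2 := norm_sq_mul_sq_eq (z ^ 2)
  have hp : 0 < ‖((Real.sqrt 2 : ℝ) : ℂ) * z‖ := by
    rw [norm_pos_iff]; exact mul_ne_zero sqrtTwo_ne_zero h0
  rw [norm_div, one_lt_div hp, ← abs_norm, ← abs_norm (1 - z ^ 2 + _), ← sq_lt_sq, norm_mul,
    mul_pow, ← norm_pow, sqrtTwo_sq, ← norm_pow, Complex.norm_ofNat, ← h2]
  nlinarith [(norm_nonneg _).trans_lt h1]

/-- The decaying transfer multiplier of a homogeneous half-line. -/
noncomputable def mult (z : ℂ) : ℂ :=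
  (1 - z ^ 2 - branchRoot (z ^ 2)) / ((Real.sqrt 2 : ℝ) * z)

theorem mult_sq (z : ℂ) : mult z ^ 2 = multSq (z ^ 2) := by
  unfold mult multSq
  rw [div_pow, mul_pow, sqrtTwo_sq]

theorem norm_mult_sq (z : ℂ) : ‖mult z‖ ^ 2 = ‖multSq (z ^ 2)‖ := by
  rw [← norm_pow, mult_sq]

section
variable (σp σm : ℝ) (α β : ℂ) (h : ‖α‖ ^ 2 + ‖β‖ ^ 2 = 1) {z : ℂ} (hz : ‖z‖ < 1) (h0 : z ≠ 0)
include h hz h0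

/-- The growing mode of the transfer recursion is absent. -/
theorem growing_mode_eq_zero (n : ℕ) (hn : 1 ≤ n) :
    z ^ 2 * (Complex.exp (Complex.I * σp) * gen σp σm α β n 1 z) +
      (1 + branchRoot (z ^ 2)) * gen σp σm α β n 0 z = 0 := by
  set e := Complex.exp (Complex.I * σp)
  set s := branchRoot (z ^ 2)
  have hs2 : s ^ 2 = 1 + (z ^ 2) ^ 2 := branchRoot_sq _
  set m : ℂ := ((Real.sqrt 2 : ℝ) : ℂ)
  have hm : m ≠ 0 := sqrtTwo_ne_zero
  have hm2 : m ^ 2 = 2 := sqrtTwo_sq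
  set τ := (1 - z ^ 2 + s) / (m * z) with hτ
  have hτ1 : 1 < ‖τ‖ := one_lt_norm_growing h0 hz
  -- The functional `l` is a left eigenvector of the transfer matrix with eigenvalue τ of modulus
  -- above one. The generating functions are bounded uniformly in the site, so `l` cannot grow and
  -- must vanish.
  set l : ℕ → ℂ := fun n => z ^ 2 * (e * gen σp σm α β n 1 z) + (1 + s) * gen σp σm α β n 0 z
    with hl
  have hstep : ∀ n : ℕ, 1 ≤ n → l (n + 1) = τ * l n := by
    intro n hn
    have h1 := sqrtTwo_mul_gen_zero σp σm α β h hz n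
    have h2 := sqrtTwo_mul_gen_one σp σm α β h hz n hn
    rw [state_zero, if_neg (by omega)] at h1
    simp only [hl, Nat.cast_add, Nat.cast_one]
    simp only [Pi.zero_apply, sub_zero] at h1
    set U := gen σp σm α β n 0 z
    set D := e * gen σp σm α β n 1 z
    set U' := gen σp σm α β (n + 1) 0 z
    set D' := e * gen σp σm α β (n + 1) 1 z
    rw [hτ]
    field_simp
    linear_combination (z ^ 3 - z * (1 + s)) * h2 - (1 + s) * m * h1 + (1 + s) * U * hm2 - U * hs2
  have hpow : ∀ k : ℕ, l (n + k) = τ ^ k * l n := by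
    intro k
    induction k with
    | zero => simp
    | succ k ih => rw [← add_assoc, hstep _ (by omega), ih]; ring
  have hbd : ∀ k : ℕ, ‖τ‖ ^ k * ‖l n‖ ≤ (‖z ^ 2 * e‖ + ‖1 + s‖) * (1 - ‖z‖)⁻¹ := by
    intro k
    rw [← norm_pow, ← norm_mul, ← hpow]
    simp only [hl]
    rw [← mul_assoc]
    refine (norm_add_le _ _).trans ?_
    rw [norm_mul, norm_mul (1 + s), add_mul]
    gcongr <;> exact norm_gen_le σp σm α β h hz _ _
  by_contra hne
  have hpos : 0 < ‖l n‖ := norm_pos_iff.2 hne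
  have ht := (tendsto_pow_atTop_atTop_of_one_lt hτ1).atTop_mul_const hpos
  obtain ⟨k, hk⟩ := (ht.eventually_gt_atTop ((‖z ^ 2 * e‖ + ‖1 + s‖) * (1 - ‖z‖)⁻¹)).exists
  exact absurd (hbd k) (not_le.2 hk)

/-- Vanishing of the growing mode ties the lower component to the upper one; eliminating it from the
recursion leaves multiplication by the decaying multiplier. The initial state enters only at site 0.
-/
theorem gen_zero_succ (n : ℕ) :
    gen σp σm α β (n + 1) 0 z = mult z * (gen σp σm α β n 0 z - state σp σm α β 0 n 0) := by
  have h1 := sqrtTwo_mul_gen_zero σp σm α β h hz n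
  have h2 := growing_mode_eq_zero σp σm α β h hz h0 (n + 1) (by omega)
  have h3 := mul_conj_branches (z ^ 2)
  have hm := sqrtTwo_ne_zero
  have hm2 := sqrtTwo_sq
  rw [Nat.cast_add, Nat.cast_one] at h2
  unfold mult
  set e := Complex.exp (Complex.I * σp)
  set s := branchRoot (z ^ 2)
  set m : ℂ := ((Real.sqrt 2 : ℝ) : ℂ)
  set U := gen σp σm α β n 0 z - state σp σm α β 0 n 0
  set U' := gen σp σm α β (n + 1) 0 z
  set D' := e * gen σp σm α β (n + 1) 1 z
  field_simp
  apply mul_left_cancel₀ (mul_ne_zero h0 hm)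
  linear_combination -z * (1 - z ^ 2 - s) * h1 - (1 - z ^ 2 - s) * h2 + U' * h3 + z ^ 2 * U' * hm2

theorem gen_one_succ (n : ℕ) (hn : 1 ≤ n) :
    gen σp σm α β (n + 1) 1 z = mult z * gen σp σm α β n 1 z := by
  have h1 := gen_zero_succ σp σm α β h hz h0 n
  rw [state_zero, if_neg (by omega), Pi.zero_apply, sub_zero] at h1
  have h2 := growing_mode_eq_zero σp σm α β h hz h0 n hn
  have h3 := growing_mode_eq_zero σp σm α β h hz h0 (n + 1) (by omega)
  rw [Nat.cast_add, Nat.cast_one, h1] at h3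
  apply mul_left_cancel₀ (mul_ne_zero (pow_ne_zero 2 h0) (Complex.exp_ne_zero (Complex.I * σp)))
  linear_combination h3 - mult z * h2

theorem gen_one_eq_pow (n : ℕ) :
    gen σp σm α β (n + 1) 1 z = mult z ^ n * -(z * gen σp σm α β 0 1 z) := by
  induction n with
  | zero => simpa using gen_one_one σp σm α β h hz
  | succ n ih =>
    have := gen_one_succ σp σm α β h hz h0 (n + 1) (by omega)
    push_cast at this ⊢
    rw [this, ih]; ring

theorem gen_zero_eq_pow (n : ℕ) :
    gen σp σm α β (n + 1) 0 z = mult z ^ (n + 1) * (gen σp σm α β 0 0 z - α) := by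
  induction n with
  | zero => simpa [state_zero] using gen_zero_succ σp σm α β h hz h0 0
  | succ n ih =>
    have := gen_zero_succ σp σm α β h hz h0 (n + 1)
    rw [state_zero, if_neg (by omega), Pi.zero_apply, sub_zero] at this
    push_cast at this ⊢
    rw [this, ih]; ring

/-- What leaves the origin to the right comes back multiplied by the reflection amplitude and a
phase. The identity is obtained after multiplication by (1 + s)(1 - z² - s), both factors being
nonzero. -/
theorem gen_origin_upper : gen σp σm α β 0 0 z =
    α - Complex.exp (Complex.I * σp) * refl (z ^ 2) * gen σp σm α β 0 1 z := by
  have h1 := gen_zero_succ σp σm α β h hz h0 0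
  have h2 := growing_mode_eq_zero σp σm α β h hz h0 1 le_rfl
  have h3 := mul_conj_branches (z ^ 2)
  have hm := sqrtTwo_ne_zero
  have hm2 := sqrtTwo_sq
  have hs2 := branchRoot_sq (z ^ 2)
  have hs := one_add_branchRoot_ne_zero (z ^ 2)
  simp only [Nat.cast_one] at h2
  rw [gen_one_one σp σm α β h hz] at h2
  simp [state_zero, mult] at h1
  rw [h1] at h2
  unfold refl
  set e := Complex.exp (Complex.I * σp)
  set s := branchRoot (z ^ 2)
  set m : ℂ := ((Real.sqrt 2 : ℝ) : ℂ)
  set d := gen σp σm α β 0 1 z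
  set u := gen σp σm α β 0 0 z
  have hl : 1 - z ^ 2 - s ≠ 0 := fun hc => by
    rw [hc] at h3; simp [h0] at h3
  field_simp at h2 ⊢
  apply mul_left_cancel₀ (mul_ne_zero hs hl)
  have h4 : (1 + s) * (1 - z ^ 2 - s) * (u - α) = z ^ 4 * e * d * m := by
    linear_combination h2
  have h5 : (1 + s) * (1 - z ^ 2 - s) * (1 + z ^ 2 - s) = -2 * z ^ 4 := by
    linear_combination (s - 1) * hs2
  linear_combination m * h4 + e * d * h5 + z ^ 4 * e * d * hm2

end

/-! ### Circle means and Parseval's identity. -/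

/-- The point of modulus `ϱ` and argument `θ`. -/
noncomputable def pt (ϱ θ : ℝ) : ℂ := ϱ * Complex.exp (θ * Complex.I)

theorem norm_pt {ϱ : ℝ} (h : 0 ≤ ϱ) (θ : ℝ) : ‖pt ϱ θ‖ = ϱ := by
  rw [pt, norm_mul, Complex.norm_exp_ofReal_mul_I, Complex.norm_real, Real.norm_eq_abs,
    abs_of_nonneg h, mul_one]

theorem pt_sq (ϱ θ : ℝ) : pt ϱ θ ^ 2 = pt (ϱ ^ 2) (2 * θ) := by
  unfold pt
  rw [mul_pow, ← Complex.exp_nat_mul]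
  push_cast; ring_nf

theorem pt_pow (ϱ θ : ℝ) (t : ℕ) : pt ϱ θ ^ t = ϱ ^ t * Complex.exp (t * θ * Complex.I) := by
  unfold pt
  rw [mul_pow, ← Complex.exp_nat_mul]; ring_nf

theorem continuous_pt (ϱ : ℝ) : Continuous (pt ϱ) := by unfold pt; fun_prop

/-- The mean over the circle `(-π, π]`. -/
noncomputable def circleMean {E : Type*} [NormedAddCommGroup E] [NormedSpace ℝ E] (f : ℝ → E) : E :=
  (2 * Real.pi)⁻¹ • ∫ θ in (-Real.pi)..Real.pi, f θ

theorem circleMean_congr {E : Type*} [NormedAddCommGroup E] [NormedSpace ℝ E] {f g : ℝ → E}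
    (h : ∀ θ, f θ = g θ) : circleMean f = circleMean g := by
  rw [funext h]

/-- The map z ↦ z² doubles the angle and preserves means of periodic functions. Parseval is applied
in z, while all integrands are functions of Z = z². -/
theorem circleMean_comp_two_mul {f : ℂ → ℝ} {ϱ : ℝ} (hf : Continuous fun θ => f (pt ϱ θ)) :
    circleMean (fun θ => f (pt ϱ (2 * θ))) = circleMean fun θ => f (pt ϱ θ) := by
  unfold circleMean
  congr 1
  set g : ℝ → ℝ := fun θ => f (pt ϱ θ) with hg
  have hp : Function.Periodic g (2 * Real.pi) := by
    intro θ
    simp only [hg, pt]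
    push_cast
    rw [add_mul, Complex.exp_add, Complex.exp_two_pi_mul_I, mul_one]
  have h1 : ∫ θ in (-Real.pi)..Real.pi, g (2 * θ) = (2 : ℝ)⁻¹ • ∫ θ in (2 * -Real.pi)..(2 * Real.pi), g θ :=
    intervalIntegral.integral_comp_mul_left g (by norm_num)
  have h2 := hp.intervalIntegral_add_zsmul_eq 2 (2 * -Real.pi) fun a b => hf.intervalIntegrable a b
  have h3 := hp.intervalIntegral_add_eq (2 * -Real.pi) (-Real.pi)
  rw [show (2 * -Real.pi + (2 : ℤ) • (2 * Real.pi)) = 2 * Real.pi by rw [zsmul_eq_mul]; push_cast; ring] at h2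
  rw [show -Real.pi + 2 * Real.pi = Real.pi by ring] at h3
  rw [h1, h2, h3, zsmul_eq_mul, smul_eq_mul]
  push_cast; ring

theorem integral_exp_int (n : ℤ) :
    ∫ θ in (-Real.pi)..Real.pi, Complex.exp (n * θ * Complex.I) = if n = 0 then (2 * Real.pi : ℂ) else 0 := by
  split_ifs with h
  · subst h; simp; ring
  · have hc : (n * Complex.I : ℂ) ≠ 0 := by simp [h]
    have h1 := integral_exp_mul_complex (a := -Real.pi) (b := Real.pi) hc
    have h2 : ∀ θ : ℝ, Complex.exp (n * θ * Complex.I) = Complex.exp (n * Complex.I * θ) := fun θ => by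
      congr 1; ring
    simp_rw [h2]
    rw [h1, div_eq_zero_iff]
    left
    have h3 : (n * Complex.I * (Real.pi : ℝ) : ℂ) =
        n * Complex.I * ((-Real.pi : ℝ) : ℂ) + n * (2 * Real.pi * Complex.I) := by
      push_cast; ring
    rw [h3, Complex.exp_add, Complex.exp_int_mul_two_pi_mul_I]; ring

section
variable {a : ℕ → ℂ} {K : ℝ} (ha : ∀ t, ‖a t‖ ≤ K) {r : ℝ} (hr0 : 0 ≤ r) (hr : r < 1)
include ha hr0 hr

theorem summable_majorant : Summable fun t => K * r ^ t :=
  (summable_geometric_of_lt_one hr0 hr).mul_left K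

theorem norm_mul_pt_pow_le (t : ℕ) (θ : ℝ) : ‖a t * pt r θ ^ t‖ ≤ K * r ^ t := by
  rw [norm_mul, norm_pow, norm_pt hr0]
  gcongr
  exact ha t

theorem continuous_tsum_pt : Continuous fun θ => ∑' t, a t * pt r θ ^ t :=
  continuous_tsum (fun t => continuous_const.mul ((continuous_pt r).pow t))
    (summable_majorant ha hr0 hr) fun t θ => norm_mul_pt_pow_le ha hr0 hr t θ

theorem hasSum_integral_tsum_mul {g : ℝ → ℂ} (hg : Continuous g) :
    HasSum (fun t => ∫ θ in (-Real.pi)..Real.pi, a t * pt r θ ^ t * g θ)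
      (∫ θ in (-Real.pi)..Real.pi, (∑' t, a t * pt r θ ^ t) * g θ) := by
  refine intervalIntegral.hasSum_integral_of_dominated_convergence
    (fun t θ => K * r ^ t * ‖g θ‖) (fun t => ?_) (fun t => ?_) ?_ ?_ ?_
  · exact ((continuous_const.mul ((continuous_pt r).pow t)).mul hg).aestronglyMeasurable
  · refine Eventually.of_forall fun θ _ => ?_
    rw [norm_mul]
    gcongr
    exact norm_mul_pt_pow_le ha hr0 hr t θ
  · exact Eventually.of_forall fun θ _ => (summable_majorant ha hr0 hr).mul_right _
  · simp_rw [tsum_mul_right]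
    exact (continuous_const.mul hg.norm).intervalIntegrable _ _
  · refine Eventually.of_forall fun θ _ => HasSum.mul_right _ ?_
    exact (Summable.of_norm_bounded (summable_majorant ha hr0 hr)
      fun t => norm_mul_pt_pow_le ha hr0 hr t θ).hasSum

theorem integral_tsum_mul_exp_neg (s : ℕ) :
    ∫ θ in (-Real.pi)..Real.pi, (∑' t, a t * pt r θ ^ t) * Complex.exp (-(s * θ * Complex.I)) =
      2 * Real.pi * (a s * r ^ s) := by
  have h := hasSum_integral_tsum_mul ha hr0 hr
    (g := fun θ : ℝ => Complex.exp (-(s * θ * Complex.I))) (by fun_prop)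
  rw [← h.tsum_eq, tsum_eq_single s]
  · have h1 : ∀ θ : ℝ, a s * pt r θ ^ s * Complex.exp (-(s * θ * Complex.I)) = a s * r ^ s := by
      intro θ
      rw [pt_pow, mul_assoc, mul_assoc, ← Complex.exp_add]; simp
    simp_rw [h1]
    simp; ring
  · intro t ht
    have h1 : ∀ θ : ℝ, a t * pt r θ ^ t * Complex.exp (-(s * θ * Complex.I)) =
        a t * r ^ t * Complex.exp (((t - s : ℤ) : ℂ) * θ * Complex.I) := by
      intro θ
      have hk : Complex.exp (((t - s : ℤ) : ℂ) * θ * Complex.I) =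
          Complex.exp (t * θ * Complex.I) * Complex.exp (-(s * θ * Complex.I)) := by
        rw [← Complex.exp_add]; congr 1; push_cast; ring
      rw [pt_pow, hk]; ring
    simp_rw [h1, intervalIntegral.integral_const_mul, integral_exp_int]
    rw [if_neg (by omega), mul_zero]

/-- Parseval's identity for a power series on a circle. -/
theorem hasSum_norm_sq_mul_pow : HasSum (fun t => ‖a t‖ ^ 2 * (r ^ 2) ^ t)
    (circleMean fun θ => ‖∑' t, a t * pt r θ ^ t‖ ^ 2) := by
  set F : ℝ → ℂ := fun θ => ∑' t, a t * pt r θ ^ t with hF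
  have hFc : Continuous F := continuous_tsum_pt ha hr0 hr
  have h := hasSum_integral_tsum_mul ha hr0 hr (g := fun θ => conj (F θ))
    (Complex.continuous_conj.comp hFc)
  have h1 : ∀ t, ∫ θ in (-Real.pi)..Real.pi, a t * pt r θ ^ t * conj (F θ) =
      ((2 * Real.pi * (‖a t‖ ^ 2 * (r ^ 2) ^ t) : ℝ) : ℂ) := by
    intro t
    have h2 : ∀ θ : ℝ, a t * pt r θ ^ t * conj (F θ) =
        a t * r ^ t * conj (F θ * Complex.exp (-(t * θ * Complex.I))) := by
      intro θ
      rw [pt_pow, map_mul, ← Complex.exp_conj]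
      simp; ring
    simp_rw [h2, intervalIntegral.integral_const_mul]
    have h3 : ∫ θ in (-Real.pi)..Real.pi, conj (F θ * Complex.exp (-(t * θ * Complex.I))) =
        conj (∫ θ in (-Real.pi)..Real.pi, F θ * Complex.exp (-(t * θ * Complex.I))) := by
      rw [intervalIntegral.integral_of_le (by linarith [Real.pi_pos]),
        intervalIntegral.integral_of_le (by linarith [Real.pi_pos]), integral_conj]
    rw [h3, integral_tsum_mul_exp_neg ha hr0 hr]
    have h4 : a t * conj (a t) = ((‖a t‖ ^ 2 : ℝ) : ℂ) := by
      rw [Complex.mul_conj, Complex.normSq_eq_norm_sq]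
    simp only [map_mul, map_pow, Complex.conj_ofReal, map_ofNat]
    push_cast at h4 ⊢
    linear_combination (2 * Real.pi * r ^ t * r ^ t) * h4
  have h5 : ∫ θ in (-Real.pi)..Real.pi, F θ * conj (F θ) =
      ((∫ θ in (-Real.pi)..Real.pi, ‖F θ‖ ^ 2 : ℝ) : ℂ) := by
    rw [← intervalIntegral.integral_ofReal]
    congr 1; ext θ
    rw [Complex.mul_conj, Complex.normSq_eq_norm_sq]
  simp_rw [h1] at h
  rw [h5, Complex.hasSum_ofReal] at h
  have h6 := h.mul_left (2 * Real.pi)⁻¹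
  have h7 : (2 * Real.pi) ≠ 0 := by positivity
  simpa only [inv_mul_cancel_left₀ h7] using! h6

end

/-! ### Solving the scattering system at the origin. -/

section
variable (σp σm : ℝ) (α β : ℂ)

theorem gen_reflect_neg (x : ℤ) (z : ℂ) :
    gen (Real.pi - σm) (Real.pi - σp) β α x 0 (-z) = gen σp σm α β (-x) 1 z ∧
    gen (Real.pi - σm) (Real.pi - σp) β α x 1 (-z) = gen σp σm α β (-x) 0 z := by
  have h1 : ∀ t : ℕ, ((-1 : ℂ) ^ t) * (-1) ^ t = 1 := fun t => by rw [← mul_pow]; simp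
  constructor
  · refine tsum_congr fun t => ?_
    rw [(state_reflect σp σm α β t x).1, neg_pow z]
    linear_combination state σp σm α β t (-x) 1 * z ^ t * h1 t
  · refine tsum_congr fun t => ?_
    rw [(state_reflect σp σm α β t x).2, neg_pow z]
    linear_combination state σp σm α β t (-x) 0 * z ^ t * h1 t

theorem exp_I_pi_sub (s : ℝ) :
    Complex.exp (Complex.I * ((Real.pi - s : ℝ) : ℂ)) = -Complex.exp (-(Complex.I * s)) := by
  push_cast
  rw [mul_sub, sub_eq_add_neg, Complex.exp_add, mul_comm Complex.I, Complex.exp_pi_mul_I]; ring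

/-- The reflected walk has generating functions at -z, and `refl` sees only z², so the upper
equation of the reflected walk is the lower equation of the original one. -/
theorem gen_origin_lower (h : ‖α‖ ^ 2 + ‖β‖ ^ 2 = 1) {z : ℂ} (hz : ‖z‖ < 1) (h0 : z ≠ 0) :
    gen σp σm α β 0 1 z =
      β + Complex.exp (-(Complex.I * σm)) * refl (z ^ 2) * gen σp σm α β 0 0 z := by
  have h1 := gen_origin_upper (Real.pi - σm) (Real.pi - σp) β α (by rw [add_comm]; exact h)
    (z := -z) (by simpa using hz) (by simpa using h0)
  have h2 := gen_reflect_neg σp σm α β 0 z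
  rw [h2.1, h2.2, exp_I_pi_sub, neg_sq, neg_zero] at h1
  rw [h1]; ring

/-- The unimodular eigenvalue of the scattering at the origin. -/
noncomputable def phase : ℂ := Complex.I * Complex.exp (Complex.I * (((σp - σm) / 2 : ℝ) : ℂ))

theorem norm_phase : ‖phase σp σm‖ = 1 := by
  rw [phase, norm_mul, norm_exp_I_mul_ofReal', Complex.norm_I, one_mul]

theorem phase_ne_zero : phase σp σm ≠ 0 := norm_ne_zero_iff.1 (by rw [norm_phase]; exact one_ne_zero)

theorem phase_sq : phase σp σm ^ 2 =
    -(Complex.exp (Complex.I * σp) * Complex.exp (-(Complex.I * σm))) := by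
  rw [phase, mul_pow, Complex.I_sq, ← Complex.exp_nat_mul, ← Complex.exp_add, neg_one_mul]
  congr 2; push_cast; ring

/-- The scalar resolvent `1 / (1 - c y)`. -/
noncomputable def resolv (c Z : ℂ) : ℂ := (1 - c * refl Z)⁻¹

/-- The upper component of the origin generating function, as a function of `z ^ 2`. -/
noncomputable def originUpper (Z : ℂ) : ℂ :=
  2⁻¹ * ((α - (phase σp σm)⁻¹ * Complex.exp (Complex.I * σp) * β) * resolv (phase σp σm) Z +
    (α + (phase σp σm)⁻¹ * Complex.exp (Complex.I * σp) * β) * resolv (-phase σp σm) Z)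

/-- The lower component of the origin generating function, as a function of `z ^ 2`. -/
noncomputable def originLower (Z : ℂ) : ℂ :=
  2⁻¹ * ((β - phase σp σm * Complex.exp (-(Complex.I * σp)) * α) * resolv (phase σp σm) Z +
    (β + phase σp σm * Complex.exp (-(Complex.I * σp)) * α) * resolv (-phase σp σm) Z)

theorem one_sub_mul_refl_ne_zero {c Z : ℂ} (hc : ‖c‖ = 1) (hZ : ‖Z‖ < 1) : 1 - c * refl Z ≠ 0 := by
  intro h
  have h1 : ‖c * refl Z‖ = 1 := by rw [← sub_eq_zero.1 h]; simp
  rw [norm_mul, hc, one_mul] at h1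
  exact absurd (norm_refl_lt_one hZ) (by rw [h1]; exact lt_irrefl 1)

/-- Since c² = -e^{i(σ₊ - σ₋)}, the determinant of the system is 1 - c²y² = (1 - cy)(1 + cy), and
`originUpper`, `originLower` are the partial fraction expansions of the solution. -/
theorem origin_system {Z : ℂ} (h1 : 1 - phase σp σm * refl Z ≠ 0)
    (h2 : 1 + phase σp σm * refl Z ≠ 0) :
    originUpper σp σm α β Z =
      α - Complex.exp (Complex.I * σp) * refl Z * originLower σp σm α β Z ∧
    originLower σp σm α β Z =
      β + Complex.exp (-(Complex.I * σm)) * refl Z * originUpper σp σm α β Z := by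
  have hc := phase_ne_zero σp σm
  have hc2 := phase_sq σp σm
  have he : Complex.exp (Complex.I * σp) * Complex.exp (-(Complex.I * σp)) = 1 := by
    rw [← Complex.exp_add]; simp
  unfold originUpper originLower resolv
  set c := phase σp σm
  set e := Complex.exp (Complex.I * σp)
  set e' := Complex.exp (-(Complex.I * σp))
  set f := Complex.exp (-(Complex.I * σm))
  have h2' : 1 - -c * refl Z ≠ 0 := by simpa using h2
  have h3 : f = -c ^ 2 * e' := by linear_combination e' * hc2 - f * he
  rw [h3]
  have hE : e ≠ 0 := Complex.exp_ne_zero _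
  have h4 : e' = e⁻¹ := by field_simp; linear_combination he
  rw [h4]
  rw [show 1 - -c * refl Z = 1 + c * refl Z by ring]
  constructor
  · field_simp
    ring
  · field_simp
    ring

theorem origin_unique {u d u' d' Z e f : ℂ} (hne : 1 + e * f * refl Z ^ 2 ≠ 0)
    (h1 : u = α - e * refl Z * d) (h2 : d = β + f * refl Z * u)
    (h1' : u' = α - e * refl Z * d') (h2' : d' = β + f * refl Z * u') : u = u' ∧ d = d' := by
  have h3 : (1 + e * f * refl Z ^ 2) * (u - u') = 0 := by
    linear_combination h1 - h1' - e * refl Z * (h2 - h2')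
  have h4 : u = u' := by
    rcases mul_eq_zero.1 h3 with h | h
    · exact absurd h hne
    · exact sub_eq_zero.1 h
  exact ⟨h4, by rw [h2, h2', h4]⟩

theorem gen_origin (h : ‖α‖ ^ 2 + ‖β‖ ^ 2 = 1) {z : ℂ} (hz : ‖z‖ < 1) (h0 : z ≠ 0) :
    gen σp σm α β 0 0 z = originUpper σp σm α β (z ^ 2) ∧
    gen σp σm α β 0 1 z = originLower σp σm α β (z ^ 2) := by
  have hZ : ‖z ^ 2‖ < 1 := by rw [norm_pow]; exact pow_lt_one₀ (norm_nonneg _) hz (by norm_num)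
  have hc := norm_phase σp σm
  have n1 := one_sub_mul_refl_ne_zero hc hZ
  have n2 : 1 + phase σp σm * refl (z ^ 2) ≠ 0 := by
    have := one_sub_mul_refl_ne_zero (c := -phase σp σm) (by simpa using hc) hZ
    simpa using this
  obtain ⟨h1, h2⟩ := origin_system σp σm α β n1 n2
  refine origin_unique α β ?_ (gen_origin_upper σp σm α β h hz h0)
    (gen_origin_lower σp σm α β h hz h0) h1 h2
  have := mul_ne_zero n1 n2
  intro h3
  apply this
  linear_combination h3 - refl (z ^ 2) ^ 2 * phase_sq σp σm

end

/-! ### Abel sums of tail probabilities. -/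

theorem continuousAt_resolv {c Z : ℂ} (hZ : ‖Z‖ ≤ 1) (h : 1 + Z ^ 2 ≠ 0)
    (hne : 1 - c * refl Z ≠ 0) : ContinuousAt (resolv c) Z := by
  unfold resolv
  exact (continuousAt_const.sub (continuousAt_const.mul (continuousAt_refl hZ h))).inv₀ hne

theorem continuousAt_originLower (σp σm : ℝ) (α β : ℂ) {Z : ℂ} (hZ : ‖Z‖ ≤ 1) (h : 1 + Z ^ 2 ≠ 0)
    (h1 : 1 - phase σp σm * refl Z ≠ 0) (h2 : 1 - -phase σp σm * refl Z ≠ 0) :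
    ContinuousAt (originLower σp σm α β) Z := by
  unfold originLower
  exact continuousAt_const.mul ((continuousAt_const.mul (continuousAt_resolv hZ h h1)).add
    (continuousAt_const.mul (continuousAt_resolv hZ h h2)))

/-- The density on the circle of the flux to the right of `n`. -/
noncomputable def fluxDensity (σp σm : ℝ) (α β : ℂ) (n : ℕ) (Z : ℂ) : ℝ :=
  ‖multSq Z‖ ^ n * ((‖Z‖ - ‖refl Z‖ ^ 2) * ‖originLower σp σm α β Z‖ ^ 2)

theorem continuousAt_fluxDensity (σp σm : ℝ) (α β : ℂ) (n : ℕ) {Z : ℂ} (hZ : ‖Z‖ ≤ 1)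
    (h0 : Z ≠ 0) (h : 1 + Z ^ 2 ≠ 0)
    (h1 : 1 - phase σp σm * refl Z ≠ 0) (h2 : 1 - -phase σp σm * refl Z ≠ 0) :
    ContinuousAt (fluxDensity σp σm α β n) Z := by
  unfold fluxDensity
  exact ((continuousAt_multSq hZ h h0).norm.pow n).mul ((continuousAt_id.norm.sub
    ((continuousAt_refl hZ h).norm.pow 2)).mul ((continuousAt_originLower σp σm α β hZ h h1 h2).norm.pow 2))

theorem continuous_comp_pt {E : Type*} [TopologicalSpace E] {f : ℂ → E} {ϱ : ℝ} (h0 : 0 < ϱ) (h1 : ϱ < 1)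
    (hf : ∀ Z : ℂ, Z ≠ 0 → ‖Z‖ < 1 → ContinuousAt f Z) : Continuous fun θ => f (pt ϱ θ) := by
  rw [continuous_iff_continuousAt]
  intro θ
  have hn := norm_pt h0.le θ
  exact ContinuousAt.comp (f := pt ϱ) (g := f)
    (hf _ (norm_ne_zero_iff.1 (by rw [hn]; exact h0.ne')) (by rw [hn]; exact h1))
    (continuous_pt ϱ).continuousAt

theorem continuous_fluxDensity_pt (σp σm : ℝ) (α β : ℂ) (n : ℕ) {ϱ : ℝ} (h0 : 0 < ϱ) (h1 : ϱ < 1) :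
    Continuous fun θ => fluxDensity σp σm α β n (pt ϱ θ) :=
  continuous_comp_pt h0 h1 fun Z hZ0 hZ => continuousAt_fluxDensity σp σm α β n hZ.le hZ0
    (one_add_sq_ne_zero hZ) (one_sub_mul_refl_ne_zero (norm_phase _ _) hZ)
    (one_sub_mul_refl_ne_zero (by rw [norm_neg, norm_phase]) hZ)

/-- The Abel sum of the tail probabilities as a circle mean. -/
theorem abel_tail (σp σm : ℝ) (α β : ℂ) (h : ‖α‖ ^ 2 + ‖β‖ ^ 2 = 1) (n : ℕ) (hn : 1 ≤ n) {ϱ : ℝ}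
    (h0 : 0 < ϱ) (h1 : ϱ < 1) : (1 - ϱ) * ∑' t, ϱ ^ t * tail σp σm α β n t =
      circleMean fun θ => fluxDensity σp σm α β n (pt ϱ θ) := by
  -- On the circle of radius √ϱ, Parseval weights squared norms by ϱ^t.
  set r := Real.sqrt ϱ with hr
  have hr0 : 0 < r := Real.sqrt_pos.2 h0
  have hr2 : r ^ 2 = ϱ := Real.sq_sqrt h0.le
  have hr1 : r < 1 := by nlinarith
  have p1 := hasSum_norm_sq_mul_pow (fun t => norm_state_le_one σp σm α β h t (n + 1) 1) hr0.le hr1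
  have p2 := hasSum_norm_sq_mul_pow (fun t => norm_state_le_one σp σm α β h t n 0) hr0.le hr1
  have p3 := p1.sub p2
  rw [hr2] at p3
  have hs : Summable fun t => ϱ ^ t * tail σp σm α β n t := by
    refine Summable.of_nonneg_of_le (fun t => mul_nonneg (by positivity) (tail_nonneg _ _ _ _ _ _))
      (fun t => ?_) (summable_geometric_of_lt_one h0.le h1)
    exact mul_le_of_le_one_right (by positivity) (tail_le_one _ _ _ _ h _ _)
  have hs0 : tail σp σm α β n 0 = 0 := by
    unfold tail
    rw [← tsum_zero (α := ℝ) (β := ℕ)]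
    refine tsum_congr fun k => ?_
    apply prob_eq_zero_of_lt
    rw [abs_of_nonneg (by omega)]; push_cast; omega
  -- Summation by parts against the flux identity. Because 1 ≤ n, the tail and both flux components
  -- vanish at time 0.
  have e1 : ∑' t, ϱ ^ t * tail σp σm α β n t = ϱ * ∑' t, ϱ ^ t * tail σp σm α β n t +
      ∑' t, (‖state σp σm α β t (n + 1) 1‖ ^ 2 * ϱ ^ t - ‖state σp σm α β t n 0‖ ^ 2 * ϱ ^ t) := by
    have z1 : state σp σm α β 0 (n + 1) 1 = 0 := by rw [state_zero, if_neg (by omega)]; rfl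
    have z2 : state σp σm α β 0 n 0 = 0 := by rw [state_zero, if_neg (by omega)]; rfl
    have hp' := (summable_nat_add_iff 1).2 p3.summable
    have hf : ∀ t, ϱ ^ (t + 1) * tail σp σm α β n (t + 1) = ϱ * (ϱ ^ t * tail σp σm α β n t) +
        (‖state σp σm α β (t + 1) (n + 1) 1‖ ^ 2 * ϱ ^ (t + 1) -
          ‖state σp σm α β (t + 1) n 0‖ ^ 2 * ϱ ^ (t + 1)) := fun t => by
      rw [tail_succ]; ring
    have k1 := hs.tsum_eq_zero_add
    have k2 := p3.summable.tsum_eq_zero_add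
    simp_rw [hf] at k1
    rw [(hs.mul_left ϱ).tsum_add hp', tsum_mul_left, hs0] at k1
    rw [z1, z2] at k2
    rw [k2]
    simpa using k1
  rw [show (1 - ϱ) * ∑' t, ϱ ^ t * tail σp σm α β n t = ∑' t, ϱ ^ t * tail σp σm α β n t -
    ϱ * ∑' t, ϱ ^ t * tail σp σm α β n t by ring]
  nth_rewrite 1 [e1]
  rw [add_sub_cancel_left, p3.tsum_eq, ← circleMean_comp_two_mul
    (continuous_fluxDensity_pt σp σm α β n h0 h1)]
  unfold circleMean
  rw [← smul_sub, ← intervalIntegral.integral_sub]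
  · congr 1
    refine intervalIntegral.integral_congr fun θ _ => ?_
    have hz : ‖pt r θ‖ < 1 := by rw [norm_pt hr0.le]; exact hr1
    have hz0 : pt r θ ≠ 0 := norm_ne_zero_iff.1 (by rw [norm_pt hr0.le]; exact hr0.ne')
    have hZ : pt r θ ^ 2 = pt ϱ (2 * θ) := by rw [pt_sq, hr2]
    change ‖gen σp σm α β (n + 1) 1 (pt r θ)‖ ^ 2 - ‖gen σp σm α β n 0 (pt r θ)‖ ^ 2 = _
    obtain ⟨k, rfl⟩ : ∃ k, n = k + 1 := ⟨n - 1, by omega⟩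
    -- With d the lower component at the origin, e = e^{iσ₊} and λ = `mult z`, the lower component
    -- at n + 1 is -λⁿ z d and the upper one at n is -λⁿ e y d. Their squared norms differ by |λ²|ⁿ
    -- (|Z| - |y|²) |d|².
    have g1 := gen_one_eq_pow σp σm α β h hz hz0 (k + 1)
    have g2 := gen_zero_eq_pow σp σm α β h hz hz0 k
    have g3 := gen_origin σp σm α β h hz hz0
    have g4 := gen_origin_upper σp σm α β h hz hz0
    rw [g1, Nat.cast_add, Nat.cast_one, g2, g4, g3.2]
    simp only [fluxDensity, norm_mul, norm_neg, norm_pow, mul_pow, ← hZ, sub_sub_cancel_left,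
      norm_exp_I_mul_ofReal', one_mul]
    rw [← pow_mul, mul_comm (k + 1) 2, pow_mul, norm_mult_sq]
    ring
  · exact ((continuous_tsum_pt (fun t => norm_state_le_one σp σm α β h t (n + 1) 1) hr0.le hr1).norm.pow
      2).intervalIntegrable _ _
  · exact ((continuous_tsum_pt (fun t => norm_state_le_one σp σm α β h t n 0) hr0.le hr1).norm.pow
      2).intervalIntegrable _ _

/-! ### Poles and remainders of the scalar resolvents. -/

/-- The only possible singularity of `resolv c` on the closed unit disc. -/
noncomputable def poleAt (c : ℂ) : ℂ :=
  ((Real.sqrt 2 : ℝ) * c - 1) / (c * (c - (Real.sqrt 2 : ℝ)))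

/-- The residue of `resolv c` at its pole, normalised so that the principal part is
`resid c / (1 - Z / poleAt c)`. -/
noncomputable def resid (c : ℂ) : ℂ := (1 - c * reflConj (poleAt c)) / (1 - (Real.sqrt 2 : ℝ) * c)

/-- `resolv c` minus its principal part. -/
noncomputable def remainder (c Z : ℂ) : ℂ := resolv c Z - resid c / (1 - Z / poleAt c)

theorem sqrtTwo_bounds : (1.4 : ℝ) < Real.sqrt 2 ∧ Real.sqrt 2 < 1.5 := by
  constructor
  · rw [Real.lt_sqrt (by norm_num)]; norm_num
  · rw [Real.sqrt_lt' (by norm_num)]; norm_num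

theorem real_sqrtTwo_sq : (Real.sqrt 2) ^ 2 = 2 := Real.sq_sqrt (by norm_num)

section
variable {c : ℂ} (hc : ‖c‖ = 1)
include hc

theorem mul_conj_of_norm_one : c * conj c = 1 := by
  rw [Complex.mul_conj, Complex.normSq_eq_norm_sq, hc]; simp

theorem ne_zero_of_norm_one : c ≠ 0 := norm_ne_zero_iff.1 (by rw [hc]; exact one_ne_zero)

theorem inv_eq_conj_of_norm_one : c⁻¹ = conj c := by
  have h := mul_conj_of_norm_one hc
  have h0 := ne_zero_of_norm_one hc
  field_simp
  exact h.symm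

theorem add_conj_eq_re : c + conj c = ((2 * c.re : ℝ) : ℂ) := Complex.add_conj c

theorem norm_one_sub_sqrtTwo_mul_ge : Real.sqrt 2 - 1 ≤ ‖1 - (Real.sqrt 2 : ℝ) * c‖ := by
  have h := norm_sub_norm_le ((Real.sqrt 2 : ℝ) * c) 1
  rw [norm_sub_rev, norm_mul, hc, Complex.norm_real, Real.norm_eq_abs,
    abs_of_nonneg (Real.sqrt_nonneg 2)] at h
  simpa using h

theorem one_sub_sqrtTwo_mul_ne_zero : 1 - (Real.sqrt 2 : ℝ) * c ≠ 0 := by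
  rw [← norm_pos_iff]
  linarith [norm_one_sub_sqrtTwo_mul_ge hc, sqrtTwo_bounds.1]

theorem norm_sub_sqrtTwo : ‖c - (Real.sqrt 2 : ℝ)‖ = ‖1 - (Real.sqrt 2 : ℝ) * c‖ := by
  have h : 1 - (Real.sqrt 2 : ℝ) * c = c * conj (c - (Real.sqrt 2 : ℝ)) := by
    rw [map_sub, Complex.conj_ofReal]
    linear_combination -mul_conj_of_norm_one hc
  rw [h, norm_mul, hc, Complex.norm_conj, one_mul]

theorem sub_sqrtTwo_ne_zero : c - (Real.sqrt 2 : ℝ) ≠ 0 := by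
  rw [← norm_ne_zero_iff, norm_sub_sqrtTwo hc, norm_ne_zero_iff]
  exact one_sub_sqrtTwo_mul_ne_zero hc

theorem norm_poleAt : ‖poleAt c‖ = 1 := by
  unfold poleAt
  rw [norm_div, norm_mul, hc, one_mul, norm_sub_sqrtTwo hc, norm_sub_rev, div_self]
  rw [norm_ne_zero_iff]
  exact one_sub_sqrtTwo_mul_ne_zero hc

theorem poleAt_ne_zero : poleAt c ≠ 0 := ne_zero_of_norm_one (norm_poleAt hc)

theorem mul_sub_sqrtTwo_mul_poleAt :
    poleAt c * (c * (c - (Real.sqrt 2 : ℝ))) = (Real.sqrt 2 : ℝ) * c - 1 := by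
  unfold poleAt
  exact div_mul_cancel₀ _ (mul_ne_zero (ne_zero_of_norm_one hc) (sub_sqrtTwo_ne_zero hc))

/-- Multiplication by the conjugate factor removes the square root and leaves a linear function of
Z. Hence `resolv c` can be singular only at one point, of modulus one because |c - √2| = |1 - √2 c|.
-/
theorem one_sub_refl_mul_one_sub_reflConj (Z : ℂ) : (1 - c * refl Z) * (1 - c * reflConj Z) =
    (1 - (Real.sqrt 2 : ℝ) * c) * (1 - Z / poleAt c) := by
  have h1 := refl_mul_reflConj Z
  have h2 := refl_add_reflConj Z
  have h3 := mul_sub_sqrtTwo_mul_poleAt hc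
  have h4 := poleAt_ne_zero hc
  have h5 : (1 - (Real.sqrt 2 : ℝ) * c) * (1 - Z / poleAt c) =
      1 - (Real.sqrt 2 : ℝ) * c + Z * (c * (c - (Real.sqrt 2 : ℝ))) := by
    field_simp
    linear_combination (-Z) * h3
  rw [h5]
  linear_combination c ^ 2 * h1 - c * h2

theorem one_sub_div_ne_zero {W Z : ℂ} (hW : W ≠ 0) (h : Z ≠ W) : 1 - Z / W ≠ 0 := by
  intro h0
  apply h
  field_simp at h0
  linear_combination -h0

theorem one_sub_refl_ne_zero_of_ne {Z : ℂ} (h : Z ≠ poleAt c) : 1 - c * refl Z ≠ 0 := by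
  have h1 := one_sub_refl_mul_one_sub_reflConj hc Z
  have h2 := mul_ne_zero (one_sub_sqrtTwo_mul_ne_zero hc)
    (one_sub_div_ne_zero hc (poleAt_ne_zero hc) h)
  rw [← h1] at h2
  exact left_ne_zero_of_mul h2

theorem norm_one_sub_div_poleAt (Z : ℂ) : ‖1 - Z / poleAt c‖ = ‖poleAt c - Z‖ := by
  have h := poleAt_ne_zero hc
  have h1 : poleAt c - Z = poleAt c * (1 - Z / poleAt c) := by field_simp
  rw [h1, norm_mul, norm_poleAt hc, one_mul]

theorem remainder_eq {Z : ℂ} (h : Z ≠ poleAt c) : remainder c Z =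
    c * (reflConj (poleAt c) - reflConj Z) /
      ((1 - (Real.sqrt 2 : ℝ) * c) * (1 - Z / poleAt c)) := by
  have h1 := one_sub_refl_mul_one_sub_reflConj hc Z
  have h2 := one_sub_refl_ne_zero_of_ne hc h
  have h3 := one_sub_sqrtTwo_mul_ne_zero hc
  have h4 := one_sub_div_ne_zero hc (poleAt_ne_zero hc) h
  unfold remainder resolv resid
  have h5 : (1 - c * refl Z)⁻¹ = (1 - c * reflConj Z) /
      ((1 - (Real.sqrt 2 : ℝ) * c) * (1 - Z / poleAt c)) := by
    rw [← h1, inv_eq_one_div, div_eq_div_iff h2 (by rw [h1]; exact mul_ne_zero h3 h4)]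
    ring
  rw [h5, div_div, ← sub_div]
  congr 1; ring

/-- The numerator of the remainder is a difference of values of `reflConj`, so the weighted
Lipschitz bound cancels the pole at the price of 1/|s|. The leading 2 is admissible because √2(√2 -
1) > 1/2. -/
theorem norm_remainder_le {Z : ℂ} (hZ : ‖Z‖ ≤ 1) (h : Z ≠ poleAt c) (hb : 1 + Z ^ 2 ≠ 0) :
    ‖remainder c Z‖ ≤ 2 * (1 + 2 / ‖branchRoot Z‖) := by
  rw [remainder_eq hc h, norm_div, norm_mul, norm_mul, hc, one_mul, norm_one_sub_div_poleAt hc]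
  have hs : 0 < ‖branchRoot Z‖ := norm_pos_iff.2 (branchRoot_ne_zero hb)
  have hd : 0 < ‖poleAt c - Z‖ := norm_pos_iff.2 (sub_ne_zero.2 (Ne.symm h))
  have hk := norm_one_sub_sqrtTwo_mul_ge hc
  have hq := sqrtTwo_bounds
  have h1 : ‖branchRoot (poleAt c) - branchRoot Z‖ ≤ 2 * ‖poleAt c - Z‖ / ‖branchRoot Z‖ := by
    rw [le_div_iff₀ hs]
    exact norm_branchRoot_sub_mul_le hZ (norm_poleAt hc).le
  have h2 : ‖reflConj (poleAt c) - reflConj Z‖ ≤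
      (‖poleAt c - Z‖ * (1 + 2 / ‖branchRoot Z‖)) / Real.sqrt 2 := by
    have e1 : reflConj (poleAt c) - reflConj Z =
        ((poleAt c - Z) + (branchRoot (poleAt c) - branchRoot Z)) / (Real.sqrt 2 : ℝ) := by
      unfold reflConj; ring
    rw [e1, norm_div, Complex.norm_real, Real.norm_eq_abs, abs_of_nonneg (Real.sqrt_nonneg 2)]
    gcongr
    refine (norm_add_le _ _).trans ?_
    calc _ ≤ ‖poleAt c - Z‖ + 2 * ‖poleAt c - Z‖ / ‖branchRoot Z‖ := by gcongr
      _ = _ := by ring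
  have hk0 : 0 < ‖1 - (Real.sqrt 2 : ℝ) * c‖ := by linarith
  rw [div_le_iff₀ (mul_pos hk0 hd)]
  refine h2.trans ?_
  rw [div_le_iff₀ (by linarith)]
  have h3 : 1 ≤ 2 * ‖1 - (Real.sqrt 2 : ℝ) * c‖ * Real.sqrt 2 := by
    nlinarith [real_sqrtTwo_sq]
  have h4 : 0 ≤ ‖poleAt c - Z‖ * (1 + 2 / ‖branchRoot Z‖) := by positivity
  nlinarith

theorem normSq_sub_sqrtTwo : (c - (Real.sqrt 2 : ℝ)) * (conj c - (Real.sqrt 2 : ℝ)) =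
    ((3 - 2 * (Real.sqrt 2 * c.re) : ℝ) : ℂ) := by
  have h1 := mul_conj_of_norm_one hc
  have h2 := add_conj_eq_re hc
  have h3 := sqrtTwo_sq
  push_cast at h2 ⊢
  linear_combination h1 - (Real.sqrt 2 : ℝ) * h2 + h3

theorem three_sub_pos : 0 < 3 - 2 * (Real.sqrt 2 * c.re) := by
  have h := (Complex.abs_re_le_norm c).trans hc.le
  have := (abs_le.1 h)
  nlinarith [sqrtTwo_bounds, real_sqrtTwo_sq]

theorem norm_one_sub_sqrtTwo_mul_sq :
    ‖1 - (Real.sqrt 2 : ℝ) * c‖ ^ 2 = 3 - 2 * (Real.sqrt 2 * c.re) := by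
  have h := normSq_sub_sqrtTwo hc
  rw [← norm_sub_sqrtTwo hc]
  have h1 : conj c - (Real.sqrt 2 : ℝ) = conj (c - (Real.sqrt 2 : ℝ)) := by simp
  rw [h1, Complex.mul_conj, Complex.normSq_eq_norm_sq] at h
  exact_mod_cast h

theorem mul_poleAt_mul : c * poleAt c * ((3 - 2 * (Real.sqrt 2 * c.re) : ℝ) : ℂ) =
    2 * (Real.sqrt 2 : ℝ) - 2 * c - conj c := by
  rw [← normSq_sub_sqrtTwo hc]
  linear_combination (conj c - (Real.sqrt 2 : ℝ)) * mul_sub_sqrtTwo_mul_poleAt hc +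
    (Real.sqrt 2 : ℝ) * mul_conj_of_norm_one hc - c * sqrtTwo_sq

theorem re_mul_poleAt_sub : (c * poleAt c - conj c).re * (3 - 2 * (Real.sqrt 2 * c.re)) =
    Real.sqrt 2 * (1 - Real.sqrt 2 * c.re) * (2 - Real.sqrt 2 * c.re) := by
  have h := congrArg Complex.re (mul_poleAt_mul hc)
  rw [Complex.re_mul_ofReal] at h
  rw [Complex.sub_re, sub_mul, h]
  simp
  linear_combination (c.re * 3 - Real.sqrt 2 * c.re ^ 2) * real_sqrtTwo_sq

/-- At W = `poleAt c` one of the factors 1 - cy, 1 - cy' vanishes, y' being the conjugate branch.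
The principal branch decides which: √2 s = y' - y has nonnegative real part, and it equals ±(cW -
c̄), whose real part has the sign of 1 - √2 Re c by `re_mul_poleAt_sub`. If the conjugate factor
vanishes, the residue is zero. -/
theorem resid_cases : (c * refl (poleAt c) = 1 ∧ 0 ≤ 1 - Real.sqrt 2 * c.re ∧
      resid c = ((2 * (1 - Real.sqrt 2 * c.re) / (3 - 2 * (Real.sqrt 2 * c.re)) : ℝ) : ℂ)) ∨
    (1 - Real.sqrt 2 * c.re ≤ 0 ∧ resid c = 0) := by
  have h1 := one_sub_refl_mul_one_sub_reflConj hc (poleAt c)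
  have hp := poleAt_ne_zero hc
  have h3 := three_sub_pos hc
  have hre := re_mul_poleAt_sub hc
  have hcc := mul_conj_of_norm_one hc
  have hs0 := branchRoot_re_nonneg (poleAt c)
  have hc0 := ne_zero_of_norm_one hc
  have hx : 0 < 2 - Real.sqrt 2 * c.re := by
    have := (abs_le.1 ((Complex.abs_re_le_norm c).trans hc.le))
    nlinarith [sqrtTwo_bounds]
  have hdiff : (Real.sqrt 2 : ℝ) * branchRoot (poleAt c) =
      reflConj (poleAt c) - refl (poleAt c) := by
    have h := sqrtTwo_ne_zero
    unfold refl reflConj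
    field_simp
    linear_combination branchRoot (poleAt c) * sqrtTwo_sq
  have hprod := refl_mul_reflConj (poleAt c)
  rw [div_self hp, sub_self, mul_zero, mul_eq_zero] at h1
  have hreS := congrArg Complex.re hdiff
  rw [Complex.re_ofReal_mul] at hreS
  have hS : 0 ≤ Real.sqrt 2 * (branchRoot (poleAt c)).re := by positivity
  have hq := sqrtTwo_bounds.1
  rcases h1 with h1 | h1
  · left
    have h1' : c * refl (poleAt c) = 1 := by linear_combination -h1
    have hr : refl (poleAt c) = conj c := by
      linear_combination (conj c) * h1' - refl (poleAt c) * hcc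
    -- The product of the branches is W, so knowing one root gives the other without the square
    -- root.
    have hr' : reflConj (poleAt c) = c * poleAt c := by
      linear_combination c * hprod - reflConj (poleAt c) * h1'
    rw [hr, hr'] at hreS
    have hge : 0 ≤ 1 - Real.sqrt 2 * c.re := by
      by_contra hcon
      push Not at hcon
      rw [← hreS] at hre
      nlinarith [mul_pos (mul_pos (show 0 < Real.sqrt 2 by linarith) (neg_pos.2 hcon)) hx,
        mul_nonneg hS h3.le]
    refine ⟨h1', hge, ?_⟩
    unfold resid
    rw [hr', div_eq_iff (one_sub_sqrtTwo_mul_ne_zero hc)]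
    have h3c : ((3 - 2 * (Real.sqrt 2 * c.re) : ℝ) : ℂ) ≠ 0 := by exact_mod_cast h3.ne'
    have h5 := mul_poleAt_mul hc
    have h6 := add_conj_eq_re hc
    rw [Complex.ofReal_div]
    rw [div_mul_eq_mul_div, eq_div_iff h3c]
    push_cast at h5 h6 ⊢
    have hq2 := sqrtTwo_sq
    have e : (1 - c * (c * poleAt c)) * (3 - 2 * ((Real.sqrt 2 : ℝ) * (c.re : ℂ))) =
      3 - 2 * ((Real.sqrt 2 : ℝ) * (c.re : ℂ)) - c * (2 * (Real.sqrt 2 : ℝ) - 2 * c - conj c) := by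
      linear_combination (-c) * h5
    rw [e]
    have h7 : 2 * (c.re : ℂ) = c + conj c := h6.symm
    have h8 : (c.re : ℂ) = (c + conj c) / 2 := by linear_combination h7 / 2
    rw [h8]
    linear_combination (-c * (c + conj c) ) * hq2 - hcc
  · right
    have hr' : reflConj (poleAt c) = conj c := by
      linear_combination (-conj c) * h1 - reflConj (poleAt c) * hcc
    have hr : refl (poleAt c) = c * poleAt c := by
      linear_combination c * hprod + refl (poleAt c) * h1
    rw [hr, hr'] at hreS
    constructor
    · by_contra hcon
      push Not at hcon
      have h9 : (conj c - c * poleAt c).re = -(c * poleAt c - conj c).re := by simp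
      rw [h9] at hreS
      nlinarith [mul_pos (mul_pos (show 0 < Real.sqrt 2 by linarith) hcon) hx,
        mul_nonneg hS h3.le]
    · unfold resid
      rw [h1, zero_div]

theorem resid_eq_zero_or : resid c = 0 ∨ (c * refl (poleAt c) = 1 ∧ 0 < 1 - Real.sqrt 2 * c.re) := by
  rcases resid_cases hc with h | h
  · rcases h.2.1.eq_or_lt with h0 | h0
    · left; rw [h.2.2, ← h0]; simp
    · right; exact ⟨h.1, h0⟩
  · left; exact h.2

/-- At a genuine pole the transfer multiplier is a strict contraction. -/
theorem norm_multSq_poleAt (h : c * refl (poleAt c) = 1) :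
    ‖multSq (poleAt c)‖ = (3 - 2 * (Real.sqrt 2 * c.re))⁻¹ := by
  have h1 : 1 - poleAt c - branchRoot (poleAt c) =
      (Real.sqrt 2 : ℝ) * refl (poleAt c) - 2 * poleAt c := by
    have h := sqrtTwo_ne_zero
    unfold refl
    field_simp
    ring
  have h2 : (c - (Real.sqrt 2 : ℝ)) * (1 - poleAt c - branchRoot (poleAt c)) =
      -(Real.sqrt 2 : ℝ) := by
    have hc0 := ne_zero_of_norm_one hc
    apply mul_left_cancel₀ hc0
    rw [h1]
    linear_combination (Real.sqrt 2 : ℝ) * (c - (Real.sqrt 2 : ℝ)) * h -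
      2 * mul_sub_sqrtTwo_mul_poleAt hc - sqrtTwo_sq
  have h3 : ‖1 - poleAt c - branchRoot (poleAt c)‖ ^ 2 * (3 - 2 * (Real.sqrt 2 * c.re)) = 2 := by
    rw [← norm_one_sub_sqrtTwo_mul_sq hc, ← norm_sub_sqrtTwo hc, ← mul_pow, ← norm_mul, mul_comm,
      h2, norm_neg, Complex.norm_real, Real.norm_eq_abs, sq_abs, real_sqrtTwo_sq]
  unfold multSq
  rw [norm_div, norm_pow, norm_mul, norm_poleAt hc, Complex.norm_ofNat, mul_one]
  rw [div_eq_iff two_ne_zero, inv_mul_eq_div, eq_div_iff (three_sub_pos hc).ne']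
  exact h3

theorem norm_multSq_poleAt_lt_one (h : c * refl (poleAt c) = 1) (h0 : 0 < 1 - Real.sqrt 2 * c.re) :
    ‖multSq (poleAt c)‖ < 1 := by
  rw [norm_multSq_poleAt hc h]
  exact inv_lt_one_of_one_lt₀ (by linarith)

/-- At a branch point the two multipliers coincide; having product -1 they would have modulus one,
against the strict contraction at a genuine pole. -/
theorem one_add_poleAt_sq_ne_zero (h : c * refl (poleAt c) = 1) (h0 : 0 < 1 - Real.sqrt 2 * c.re) :
    1 + poleAt c ^ 2 ≠ 0 := by
  intro hz
  have hb : branchRoot (poleAt c) = 0 := by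
    have := branchRoot_sq (poleAt c)
    rw [hz] at this
    exact pow_eq_zero_iff (two_ne_zero) |>.1 this
  have h1 := norm_multSq_poleAt_lt_one hc h h0
  have h2 := norm_sq_mul_sq_eq (poleAt c)
  rw [hb, sub_zero, add_zero, norm_poleAt hc] at h2
  unfold multSq at h1
  rw [hb, sub_zero, norm_div, norm_pow, norm_mul, norm_poleAt hc, Complex.norm_ofNat] at h1
  rw [div_lt_one (by norm_num)] at h1
  nlinarith

end

/-- The first bound is uniform in the radius and supplies dominating functions; the second controls
(1 - ϱ)/|s|² near the branch points ±i. -/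
theorem norm_branchRoot_pt_sq_ge {ϱ : ℝ} (h0 : 0 ≤ ϱ) (θ : ℝ) :
    |Real.cos θ| ≤ ‖branchRoot (pt ϱ θ)‖ ^ 2 ∧ 1 - ϱ ^ 2 ≤ ‖branchRoot (pt ϱ θ)‖ ^ 2 := by
  rw [← norm_pow, branchRoot_sq]
  constructor
  · have h1 : ‖1 + pt ϱ θ ^ 2‖ ^ 2 = (1 - ϱ ^ 2) ^ 2 + 4 * ϱ ^ 2 * Real.cos θ ^ 2 := by
      rw [pt_sq, Complex.sq_norm, Complex.normSq_apply]
      have e1 : (1 + pt (ϱ ^ 2) (2 * θ)).re = 1 + ϱ ^ 2 * Real.cos (2 * θ) := by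
        rw [pt, Complex.add_re, Complex.re_ofReal_mul, Complex.exp_ofReal_mul_I_re]; simp
      have e2 : (1 + pt (ϱ ^ 2) (2 * θ)).im = ϱ ^ 2 * Real.sin (2 * θ) := by
        rw [pt, Complex.add_im, Complex.im_ofReal_mul, Complex.exp_ofReal_mul_I_im]; simp
      rw [e1, e2, Real.cos_two_mul, Real.sin_two_mul]
      linear_combination (4 * ϱ ^ 4 * Real.cos θ ^ 2) * Real.sin_sq_add_cos_sq θ
    rw [← abs_norm (1 + pt ϱ θ ^ 2), ← sq_le_sq, h1]
    have hc : Real.cos θ ^ 2 ≤ 1 := Real.cos_sq_le_one θ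
    have hc0 : 0 ≤ Real.cos θ ^ 2 := sq_nonneg _
    nlinarith [sq_nonneg ϱ, mul_nonneg (sq_nonneg ϱ) hc0, sq_nonneg (ϱ ^ 2),
      mul_nonneg (sq_nonneg (1 - ϱ ^ 2)) hc0, mul_nonneg (sq_nonneg (ϱ ^ 2 - 1)) (sub_nonneg.2 hc)]
  · have := norm_sub_norm_le (1 : ℂ) (-(pt ϱ θ ^ 2))
    rw [sub_neg_eq_add, norm_neg, norm_pow, norm_pt h0, norm_one] at this
    exact this

/-! ### Sequences vanishing in quadratic Cesàro mean. -/

/-- The sequence `f` vanishes in quadratic Cesàro mean. -/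
def CesNull (f : ℕ → ℂ) : Prop :=
  Tendsto (fun T : ℕ => (∑ t ∈ Finset.range T, ‖f t‖ ^ 2) / (T : ℝ)) atTop (𝓝 0)

theorem cesMean_nonneg (f : ℕ → ℂ) (T : ℕ) : 0 ≤ (∑ t ∈ Finset.range T, ‖f t‖ ^ 2) / (T : ℝ) := by
  positivity

theorem CesNull.const_mul {f : ℕ → ℂ} (hf : CesNull f) (c : ℂ) : CesNull fun t => c * f t := by
  have h := Tendsto.const_mul (‖c‖ ^ 2) hf
  rw [mul_zero] at h
  refine h.congr fun T => ?_
  simp_rw [norm_mul, mul_pow]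
  rw [← Finset.mul_sum, mul_div_assoc]

theorem CesNull.add {f g : ℕ → ℂ} (hf : CesNull f) (hg : CesNull g) : CesNull fun t => f t + g t := by
  have h := (Tendsto.const_mul 2 hf).add (Tendsto.const_mul 2 hg)
  rw [mul_zero, add_zero] at h
  refine squeeze_zero (cesMean_nonneg _) (fun T => ?_) h
  rw [← mul_div_assoc, ← mul_div_assoc, ← add_div, Finset.mul_sum, Finset.mul_sum,
    ← Finset.sum_add_distrib]
  gcongr with t
  have := norm_add_le (f t) (g t)
  nlinarith [norm_nonneg (f t + g t), sq_nonneg (‖f t‖ - ‖g t‖), norm_nonneg (f t), norm_nonneg (g t)]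

theorem CesNull.sub {f g : ℕ → ℂ} (hf : CesNull f) (hg : CesNull g) : CesNull fun t => f t - g t := by
  have := hf.add (hg.const_mul (-1))
  simpa [sub_eq_add_neg] using this

theorem CesNull.shift {f : ℕ → ℂ} (hf : CesNull f) : CesNull fun t => f (t + 1) := by
  have h := (Tendsto.const_mul 2 (hf.comp (tendsto_add_atTop_nat 1)))
  rw [mul_zero] at h
  refine squeeze_zero' (Eventually.of_forall (cesMean_nonneg _)) ?_ h
  filter_upwards [eventually_ge_atTop 1] with T hT
  have h1 : ∑ t ∈ Finset.range T, ‖f (t + 1)‖ ^ 2 ≤ ∑ t ∈ Finset.range (T + 1), ‖f t‖ ^ 2 := by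
    rw [Finset.sum_range_succ']
    linarith [sq_nonneg ‖f 0‖]
  have hT' : (1 : ℝ) ≤ T := by exact_mod_cast hT
  simp only [Function.comp_apply]
  rw [← mul_div_assoc, div_le_div_iff₀ (by linarith) (by positivity)]
  have h2 : 0 ≤ ∑ t ∈ Finset.range T, ‖f (t + 1)‖ ^ 2 := by positivity
  push_cast
  nlinarith

theorem CesNull.of_shift {f : ℕ → ℂ} (hf : CesNull fun t => f (t + 1)) : CesNull f := by
  have h := (tendsto_const_nhds (x := ‖f 0‖ ^ 2)).div_atTop (tendsto_natCast_atTop_atTop (R := ℝ))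
  have h1 := h.add hf
  rw [add_zero] at h1
  refine squeeze_zero (cesMean_nonneg _) (fun T => ?_) h1
  rw [← add_div]
  gcongr
  calc _ ≤ ∑ t ∈ Finset.range (T + 1), ‖f t‖ ^ 2 :=
        Finset.sum_le_sum_of_subset_of_nonneg (Finset.range_mono (by omega)) fun _ _ _ => by positivity
    _ = _ := by rw [Finset.sum_range_succ', add_comm]

/-- The radius `exp (-η / n)`. -/
noncomputable def radius (η : ℝ) (n : ℕ) : ℝ := Real.exp (-(η / n))

theorem radius_pos (η : ℝ) (n : ℕ) : 0 < radius η n := Real.exp_pos _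

theorem radius_lt_one {η : ℝ} (h : 0 < η) {n : ℕ} (hn : 1 ≤ n) : radius η n < 1 := by
  have : (0 : ℝ) < n := by exact_mod_cast hn
  rw [radius, Real.exp_lt_one_iff, neg_lt_zero]
  positivity

theorem tendsto_radius (η : ℝ) : Tendsto (radius η) atTop (𝓝 1) := by
  have h := (tendsto_const_nhds (x := η)).div_atTop (tendsto_natCast_atTop_atTop (R := ℝ))
  have := (Real.continuous_exp.tendsto _).comp h.neg
  rw [neg_zero, Real.exp_zero] at this
  exact this

theorem one_sub_radius_ge {η : ℝ} (h : 0 < η) {n : ℕ} (hn : 1 ≤ n) :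
    η / n * Real.exp (-η) ≤ 1 - radius η n := by
  have hn' : (1 : ℝ) ≤ n := by exact_mod_cast hn
  set x := η / n with hx
  have hx0 : 0 ≤ x := by positivity
  have hxη : x ≤ η := div_le_self h.le hn'
  have h1 : 1 + x ≤ Real.exp x := by linarith [Real.add_one_le_exp x]
  have h2 : Real.exp (-x) * Real.exp x = 1 := by rw [← Real.exp_add]; simp
  have h3 : Real.exp (-η) ≤ Real.exp (-x) := Real.exp_le_exp.2 (by linarith)
  have h4 := Real.exp_pos (-x)
  unfold radius
  rw [← hx]
  nlinarith

/-- At radius e^{-1/T} every weight with t < T is at least e⁻¹, and 1 minus the radius is at least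
e⁻¹/T. For nonnegative terms the Cesàro mean is thus at most e² times the Abel mean. -/
theorem cesNull_of_abel {f : ℕ → ℂ} {K : ℝ} (hb : ∀ t, ‖f t‖ ≤ K)
    (h : Tendsto (fun n => (1 - radius 1 n) * ∑' t, ‖f t‖ ^ 2 * radius 1 n ^ t) atTop (𝓝 0)) :
    CesNull f := by
  have h' := h.const_mul (Real.exp 2)
  rw [mul_zero] at h'
  refine squeeze_zero' (Eventually.of_forall (cesMean_nonneg _)) ?_ h'
  filter_upwards [eventually_ge_atTop 1] with T hT
  have hT' : (1 : ℝ) ≤ T := by exact_mod_cast hT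
  have hr := radius_pos 1 T
  have hs : Summable fun t => ‖f t‖ ^ 2 * radius 1 T ^ t := by
    refine Summable.of_nonneg_of_le (fun t => by positivity) (fun t => ?_)
      ((summable_geometric_of_lt_one hr.le (radius_lt_one one_pos hT)).mul_left (K ^ 2))
    gcongr
    exact hb t
  have h1 : (∑ t ∈ Finset.range T, ‖f t‖ ^ 2) * Real.exp (-1) ≤ ∑' t, ‖f t‖ ^ 2 * radius 1 T ^ t := by
    rw [Finset.sum_mul]
    refine le_trans (Finset.sum_le_sum fun t ht => ?_) (hs.sum_le_tsum _ fun t _ => by positivity)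
    gcongr
    rw [radius, ← Real.exp_nat_mul]
    apply Real.exp_le_exp.2
    have : (t : ℝ) ≤ T := by exact_mod_cast (Finset.mem_range.1 ht).le
    rw [mul_neg, neg_le_neg_iff, mul_one_div]
    exact div_le_one_of_le₀ this (by linarith)
  have h2 := one_sub_radius_ge one_pos hT
  have h3 : 0 ≤ ∑ t ∈ Finset.range T, ‖f t‖ ^ 2 := by positivity
  have h4 : Real.exp 2 * (Real.exp (-1) * Real.exp (-1)) = 1 := by
    rw [← Real.exp_add, ← Real.exp_add]; norm_num
  calc (∑ t ∈ Finset.range T, ‖f t‖ ^ 2) / T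
      = Real.exp 2 * ((1 / T * Real.exp (-1)) * ((∑ t ∈ Finset.range T, ‖f t‖ ^ 2) * Real.exp (-1))) := by
        rw [show Real.exp 2 * ((1 / T * Real.exp (-1)) * ((∑ t ∈ Finset.range T, ‖f t‖ ^ 2) * Real.exp (-1)))
          = (Real.exp 2 * (Real.exp (-1) * Real.exp (-1))) * ((∑ t ∈ Finset.range T, ‖f t‖ ^ 2) / T) by ring,
          h4, one_mul]
    _ ≤ _ := by
        gcongr
        exact (by positivity : (0 : ℝ) ≤ 1 / T * Real.exp (-1)).trans h2

theorem ae_cos_ne_zero : ∀ᵐ θ : ℝ, Real.cos θ ≠ 0 := by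
  have : {θ : ℝ | Real.cos θ = 0}.Countable := by
    have h : {θ : ℝ | Real.cos θ = 0} ⊆ Set.range fun k : ℤ => (2 * k + 1) * Real.pi / 2 := by
      intro θ hθ
      obtain ⟨k, hk⟩ := Real.cos_eq_zero_iff.1 hθ
      exact ⟨k, hk.symm⟩
    exact (Set.countable_range _).mono h
  have h := this.ae_notMem volume
  filter_upwards [h] with θ hθ h0 using hθ h0

/-- The square of the allowed growth need not stay integrable at radius one, hence the factor 1 - r.
The bound |s|² ≥ 1 - r makes the integrand bounded, and |s|² ≥ |cos θ| makes it tend to zero almost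
everywhere, so dominated convergence applies. -/
theorem tendsto_one_sub_mul_circleMean {G : ℂ → ℂ} {K : ℝ}
    (hc : ∀ Z : ℂ, Z ≠ 0 → ‖Z‖ < 1 → ContinuousAt G Z)
    (hG : ∀ Z : ℂ, ‖Z‖ < 1 → ‖G Z‖ ≤ K * (1 + 2 / ‖branchRoot Z‖)) :
    Tendsto (fun n => (1 - radius 1 n) * circleMean fun θ => ‖G (pt (radius 1 n) θ)‖ ^ 2)
      atTop (𝓝 0) := by
  have hK : ∀ n : ℕ, 1 ≤ n → ∀ θ : ℝ, ‖(1 - radius 1 n) * ‖G (pt (radius 1 n) θ)‖ ^ 2‖ ≤ 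
      K ^ 2 * ((1 - radius 1 n) * (2 + 8 / ‖branchRoot (pt (radius 1 n) θ)‖ ^ 2)) := by
    intro n hn θ
    have h0 := radius_pos 1 n
    have h1 := radius_lt_one one_pos hn
    have h2 := hG (pt (radius 1 n) θ) (by rw [norm_pt h0.le]; exact h1)
    rw [norm_mul, norm_pow, norm_norm, Real.norm_eq_abs, abs_of_pos (by linarith)]
    set B := ‖branchRoot (pt (radius 1 n) θ)‖
    have h3 : ‖G (pt (radius 1 n) θ)‖ ^ 2 ≤ (K * (1 + 2 / B)) ^ 2 := by gcongr
    have h4 : (K * (1 + 2 / B)) ^ 2 ≤ K ^ 2 * (2 + 8 / B ^ 2) := by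
      rw [mul_pow]
      gcongr
      have : 8 / B ^ 2 = 2 * (2 / B) ^ 2 := by rw [div_pow]; ring
      rw [this]
      nlinarith [sq_nonneg (1 - 2 / B)]
    calc _ ≤ (1 - radius 1 n) * (K ^ 2 * (2 + 8 / B ^ 2)) := by
          have : 0 ≤ 1 - radius 1 n := by linarith
          gcongr
          exact h3.trans h4
      _ = _ := by ring
  have key : Tendsto (fun n => ∫ θ in (-Real.pi)..Real.pi,
      (1 - radius 1 n) * ‖G (pt (radius 1 n) θ)‖ ^ 2) atTop (𝓝 (∫ θ in (-Real.pi)..Real.pi, (0 : ℝ))) := by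
    refine intervalIntegral.tendsto_integral_filter_of_dominated_convergence
      -- 10 = 2 + 8, from (1 - r) · 2 ≤ 2 and (1 - r) · 8/|s|² ≤ 8.
      (fun _ => K ^ 2 * 10) ?_ ?_ ?_ ?_
    · filter_upwards [eventually_ge_atTop 1] with n hn
      exact (continuous_const.mul ((continuous_comp_pt (radius_pos 1 n)
        (radius_lt_one one_pos hn) hc).norm.pow 2)).aestronglyMeasurable
    · filter_upwards [eventually_ge_atTop 1] with n hn
      refine Eventually.of_forall fun θ _ => (hK n hn θ).trans ?_
      have h0 := radius_pos 1 n
      have h1 := radius_lt_one one_pos hn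
      have h2 := (norm_branchRoot_pt_sq_ge h0.le θ).2
      have h3 : (1 - radius 1 n) ≤ ‖branchRoot (pt (radius 1 n) θ)‖ ^ 2 := by nlinarith
      have h4 : 0 < ‖branchRoot (pt (radius 1 n) θ)‖ ^ 2 := by linarith
      gcongr
      rw [mul_add, ← mul_div_assoc]
      have h5 : (1 - radius 1 n) * 8 / ‖branchRoot (pt (radius 1 n) θ)‖ ^ 2 ≤ 8 := by
        rw [div_le_iff₀ h4]; linarith
      linarith
    · exact intervalIntegrable_const
    · filter_upwards [ae_cos_ne_zero] with θ hθ _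
      have hlim : Tendsto (fun n => K ^ 2 * ((1 - radius 1 n) * (2 + 8 / |Real.cos θ|))) atTop (𝓝 0) := by
        have := (((tendsto_const_nhds (x := (1 : ℝ))).sub (tendsto_radius 1)).mul_const
          (2 + 8 / |Real.cos θ|)).const_mul (K ^ 2)
        simpa using this
      refine squeeze_zero_norm' ?_ hlim
      filter_upwards [eventually_ge_atTop 1] with n hn
      refine (hK n hn θ).trans ?_
      have h1 := radius_lt_one one_pos hn
      have : 0 ≤ 1 - radius 1 n := by linarith
      have hp : 0 < |Real.cos θ| := abs_pos.2 hθ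
      gcongr
      exact (norm_branchRoot_pt_sq_ge (radius_pos 1 n).le θ).1
  have h2 := key.const_mul (2 * Real.pi)⁻¹
  simp only [intervalIntegral.integral_zero, mul_zero] at h2
  refine h2.congr fun n => ?_
  rw [intervalIntegral.integral_const_mul, circleMean, smul_eq_mul]
  ring

/-- A bounded sequence whose generating function is a function of `z ^ 2` of at most inverse
square-root growth vanishes in quadratic Cesàro mean. -/
theorem cesNull_of_gen {a : ℕ → ℂ} {K K' : ℝ} (ha : ∀ t, ‖a t‖ ≤ K) {G : ℂ → ℂ}
    (hc : ∀ Z : ℂ, Z ≠ 0 → ‖Z‖ < 1 → ContinuousAt G Z)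
    (hG : ∀ Z : ℂ, ‖Z‖ < 1 → ‖G Z‖ ≤ K' * (1 + 2 / ‖branchRoot Z‖))
    (hgen : ∀ z : ℂ, z ≠ 0 → ‖z‖ < 1 → ∑' t, a t * z ^ t = G (z ^ 2)) : CesNull a := by
  refine cesNull_of_abel ha ((tendsto_one_sub_mul_circleMean hc hG).congr' ?_)
  filter_upwards [eventually_ge_atTop 1] with n hn
  have h0 := radius_pos 1 n
  have h1 := radius_lt_one one_pos hn
  set r := Real.sqrt (radius 1 n)
  have hr0 : 0 < r := Real.sqrt_pos.2 h0
  have hr2 : r ^ 2 = radius 1 n := Real.sq_sqrt h0.le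
  have hr1 : r < 1 := by nlinarith
  have h := (hasSum_norm_sq_mul_pow ha hr0.le hr1).tsum_eq
  rw [hr2] at h
  rw [h, ← circleMean_comp_two_mul (f := fun Z => ‖G Z‖ ^ 2) ((continuous_comp_pt h0 h1 hc).norm.pow 2)]
  congr 1
  refine circleMean_congr fun θ => ?_
  have hn := norm_pt hr0.le θ
  rw [hgen _ (norm_ne_zero_iff.1 (by rw [hn]; exact hr0.ne')) (by rw [hn]; exact hr1), pt_sq, hr2]

/-! ### Cesàro means of quasi-periodic sequences. -/

theorem cesaro_pow {w : ℂ} (hw : ‖w‖ = 1) (hne : w ≠ 1) :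
    Tendsto (fun T : ℕ => (∑ t ∈ Finset.range T, w ^ t) / (T : ℂ)) atTop (𝓝 0) := by
  have h := (tendsto_const_nhds (x := 2 / ‖w - 1‖)).div_atTop (tendsto_natCast_atTop_atTop (R := ℝ))
  refine squeeze_zero_norm (fun T => ?_) h
  rw [norm_div, Complex.norm_natCast]
  gcongr
  rw [geom_sum_eq hne, norm_div]
  gcongr
  refine (norm_sub_le _ _).trans ?_
  rw [norm_pow, hw]; norm_num

/-- After expanding the square, an off-diagonal term is a bounded geometric sum in a unimodular
ratio different from one. Distinctness is asked only for nonzero amplitudes, since a missing bound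
state leaves an index with amplitude zero. -/
theorem cesaro_norm_sq_sum {ι : Type*} [Fintype ι] (A ζ : ι → ℂ) (hζ : ∀ j, ‖ζ j‖ = 1)
    (hne : ∀ j k, j ≠ k → A j ≠ 0 → A k ≠ 0 → ζ j ≠ ζ k) :
    Tendsto (fun T : ℕ => (∑ t ∈ Finset.range T, ‖∑ j, A j * ζ j ^ t‖ ^ 2) / (T : ℝ)) atTop
      (𝓝 (∑ j, ‖A j‖ ^ 2)) := by
  classical
  have h1 : ∀ j k, Tendsto (fun T : ℕ => A j * conj (A k) *
      ((∑ t ∈ Finset.range T, (ζ j * conj (ζ k)) ^ t) / (T : ℂ))) atTop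
      (𝓝 (if j = k then ((‖A j‖ ^ 2 : ℝ) : ℂ) else 0)) := by
    intro j k
    by_cases hjk : j = k
    · subst hjk
      rw [if_pos rfl, mul_conj_of_norm_one (hζ j), Complex.mul_conj, Complex.normSq_eq_norm_sq]
      refine tendsto_const_nhds.congr' ?_
      filter_upwards [eventually_ge_atTop 1] with T hT
      have : (T : ℂ) ≠ 0 := by exact_mod_cast (by omega : T ≠ 0)
      simp [this]
    · rw [if_neg hjk]
      by_cases hj : A j = 0
      · simp [hj]
      by_cases hk : A k = 0
      · simp [hk]
      have hw : ζ j * conj (ζ k) ≠ 1 := by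
        intro h
        apply hne j k hjk hj hk
        linear_combination ζ k * h - ζ j * mul_conj_of_norm_one (hζ k)
      have := (cesaro_pow (w := ζ j * conj (ζ k)) (by simp [hζ]) hw).const_mul (A j * conj (A k))
      rwa [mul_zero] at this
  have h2 := tendsto_finsetSum Finset.univ fun j _ => tendsto_finsetSum Finset.univ fun k _ => h1 j k
  simp only [Finset.sum_ite_eq, Finset.mem_univ, if_true] at h2
  rw [← Complex.ofReal_sum] at h2
  have h3 := (Complex.continuous_re.tendsto _).comp h2
  rw [Complex.ofReal_re] at h3
  refine h3.congr fun T => ?_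
  have h4 : ∀ t, ((‖∑ j, A j * ζ j ^ t‖ ^ 2 : ℝ) : ℂ) =
      ∑ j, ∑ k, A j * conj (A k) * (ζ j * conj (ζ k)) ^ t := by
    intro t
    rw [← Complex.normSq_eq_norm_sq, ← Complex.mul_conj, map_sum, Finset.sum_mul_sum]
    refine Finset.sum_congr rfl fun j _ => Finset.sum_congr rfl fun k _ => ?_
    rw [map_mul, map_pow, mul_pow]; ring
  have h5 : (((∑ t ∈ Finset.range T, ‖∑ j, A j * ζ j ^ t‖ ^ 2) / (T : ℝ) : ℝ) : ℂ) =
      ∑ j, ∑ k, A j * conj (A k) * ((∑ t ∈ Finset.range T, (ζ j * conj (ζ k)) ^ t) / (T : ℂ)) := by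
    rw [Complex.ofReal_div, Complex.ofReal_sum]
    simp_rw [h4]
    rw [Finset.sum_comm, Finset.sum_div]
    refine Finset.sum_congr rfl fun j _ => ?_
    rw [Finset.sum_comm, Finset.sum_div]
    refine Finset.sum_congr rfl fun k _ => ?_
    rw [← Finset.mul_sum]
    push_cast; ring
  simp only [Function.comp_apply]
  rw [← h5, Complex.ofReal_re]

/-- The main part is bounded, so the cross terms are controlled by the Cesàro mean of the norms of
the error, which tends to zero by Cauchy–Schwarz. -/
theorem cesaro_norm_sq_of_cesNull {ι : Type*} [Fintype ι] (A ζ : ι → ℂ) (hζ : ∀ j, ‖ζ j‖ = 1)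
    (hne : ∀ j k, j ≠ k → A j ≠ 0 → A k ≠ 0 → ζ j ≠ ζ k) {f : ℕ → ℂ}
    (hf : CesNull fun t => f t - ∑ j, A j * ζ j ^ t) :
    Tendsto (fun T : ℕ => (∑ t ∈ Finset.range T, ‖f t‖ ^ 2) / (T : ℝ)) atTop
      (𝓝 (∑ j, ‖A j‖ ^ 2)) := by
  set g : ℕ → ℂ := fun t => ∑ j, A j * ζ j ^ t with hg
  set M := ∑ j, ‖A j‖
  have hM : ∀ t, ‖g t‖ ≤ M := fun t => by
    refine (norm_sum_le _ _).trans (Finset.sum_le_sum fun j _ => ?_)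
    rw [norm_mul, norm_pow, hζ, one_pow, mul_one]
  have h1 := cesaro_norm_sq_sum A ζ hζ hne
  set N : ℕ → ℝ := fun T => (∑ t ∈ Finset.range T, ‖f t - g t‖ ^ 2) / (T : ℝ) with hN
  have hN0 : Tendsto N atTop (𝓝 0) := hf
  have hL : ∀ T : ℕ, (∑ t ∈ Finset.range T, ‖f t - g t‖) / (T : ℝ) ≤ Real.sqrt (N T) := by
    intro T
    rcases Nat.eq_zero_or_pos T with rfl | hT
    · simp
    have hT' : (0 : ℝ) < T := by exact_mod_cast hT
    apply Real.le_sqrt_of_sq_le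
    have h := sq_sum_le_card_mul_sum_sq (s := Finset.range T) (f := fun t => ‖f t - g t‖)
    rw [Finset.card_range] at h
    rw [div_pow, hN, div_le_div_iff₀ (by positivity) hT']
    nlinarith
  have h2 : Tendsto (fun T => N T + 2 * M * Real.sqrt (N T)) atTop (𝓝 0) := by
    have := hN0.add ((hN0.sqrt).const_mul (2 * M))
    simpa using this
  have h3 : Tendsto (fun T : ℕ => (∑ t ∈ Finset.range T, ‖f t‖ ^ 2) / (T : ℝ) -
      (∑ t ∈ Finset.range T, ‖g t‖ ^ 2) / (T : ℝ)) atTop (𝓝 0) := by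
    refine squeeze_zero_norm (fun T => ?_) h2
    have hM0 : 0 ≤ M := Finset.sum_nonneg fun _ _ => norm_nonneg _
    calc ‖(∑ t ∈ Finset.range T, ‖f t‖ ^ 2) / (T : ℝ) - (∑ t ∈ Finset.range T, ‖g t‖ ^ 2) / (T : ℝ)‖
        = |∑ t ∈ Finset.range T, (‖f t‖ ^ 2 - ‖g t‖ ^ 2)| / T := by
          rw [← sub_div, Finset.sum_sub_distrib, Real.norm_eq_abs, abs_div, Nat.abs_cast]
      _ ≤ (∑ t ∈ Finset.range T, (‖f t - g t‖ ^ 2 + 2 * M * ‖f t - g t‖)) / T := by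
          gcongr
          refine (Finset.abs_sum_le_sum_abs _ _).trans (Finset.sum_le_sum fun t _ => ?_)
          have e1 := abs_norm_sub_norm_le (f t) (g t)
          have e2 : ‖f t‖ ^ 2 - ‖g t‖ ^ 2 = (‖f t‖ - ‖g t‖) * (‖f t‖ + ‖g t‖) := by ring
          have e3 : ‖f t‖ + ‖g t‖ ≤ ‖f t - g t‖ + 2 * M := by
            have := norm_le_norm_sub_add (f t) (g t)
            linarith [hM t]
          rw [e2, abs_mul, abs_of_nonneg (by positivity : 0 ≤ ‖f t‖ + ‖g t‖)]
          calc _ ≤ ‖f t - g t‖ * (‖f t - g t‖ + 2 * M) := by gcongr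
            _ = _ := by ring
      _ = N T + 2 * M * ((∑ t ∈ Finset.range T, ‖f t - g t‖) / T) := by
          rw [Finset.sum_add_distrib, ← Finset.mul_sum, add_div, mul_div_assoc]
      _ ≤ _ := by
          gcongr
          exact hL T
  have := h3.add h1
  rw [zero_add] at this
  exact this.congr fun T => sub_add_cancel _ _

/-! ### Bound states: from the origin to every site. -/

section
variable (σp σm : ℝ) (α β : ℂ)

theorem sqrtTwo_mul_state_zero (t n : ℕ) : (Real.sqrt 2 : ℝ) * state σp σm α β (t + 1) n 0 =
    state σp σm α β t (n + 1) 0 + Complex.exp (Complex.I * σp) * state σp σm α β t (n + 1) 1 := by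
  rw [state_succ_zero, coin_of_pos σp σm (by omega)]
  have := sqrtTwo_ne_zero
  simp [phaseCoin]
  field_simp

theorem sqrtTwo_mul_state_one (t n : ℕ) : (Real.sqrt 2 : ℝ) * state σp σm α β (t + 1) (n + 1 + 1) 1 =
    Complex.exp (-(Complex.I * σp)) * state σp σm α β t (n + 1) 0 - state σp σm α β t (n + 1) 1 := by
  rw [state_succ_one, add_sub_cancel_right, coin_of_pos σp σm (by omega)]
  have := sqrtTwo_ne_zero
  simp [phaseCoin]
  field_simp
  ring

theorem state_one_one (t : ℕ) : state σp σm α β (t + 1) 1 1 = -state σp σm α β t 0 1 := by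
  rw [state_succ_one]
  simp [coin_zero]

/-- Quasi-periodic asymptotics at the origin propagate to the right half-line. -/
theorem cesNull_state {ι : Type*} [Fintype ι] {A B ζ l : ι → ℂ} (hζ : ∀ j, ζ j ≠ 0)
    (h1 : ∀ j, l j * A j = (Real.sqrt 2 : ℝ) * ζ j * A j +
      Complex.exp (Complex.I * σp) * (ζ j)⁻¹ * B j)
    (h2 : ∀ j, -((Real.sqrt 2 : ℝ) * B j * l j) = Complex.exp (-(Complex.I * σp)) * l j * A j +
      (ζ j)⁻¹ * B j)
    (hu : CesNull fun t => state σp σm α β t 0 0 - ∑ j, A j * ζ j ^ t)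
    (hd : CesNull fun t => state σp σm α β t 0 1 - ∑ j, B j * ζ j ^ t) (n : ℕ) :
    CesNull (fun t => state σp σm α β t n 0 - ∑ j, A j * l j ^ n * ζ j ^ t) ∧
    CesNull (fun t => state σp σm α β t (n + 1) 1 - ∑ j, -((ζ j)⁻¹ * B j * l j ^ n) * ζ j ^ t) := by
  induction n with
  | zero =>
    -- The lower component at site 1 is minus the one at the origin a step earlier; the delay is the
    -- factor ζ⁻¹.
    refine ⟨by simpa using hu, CesNull.of_shift ?_⟩
    have := hd.const_mul (-1)
    convert this using 2 with t
    rw [Nat.cast_zero, zero_add, state_one_one, mul_sub, Finset.mul_sum, neg_one_mul]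
    congr 1
    refine Finset.sum_congr rfl fun j _ => ?_
    have := hζ j
    rw [pow_succ]
    field_simp
  | succ n ih =>
    obtain ⟨hn1, hn2⟩ := ih
    have hu' : CesNull (fun t => state σp σm α β t (n + 1) 0 - ∑ j, A j * l j ^ (n + 1) * ζ j ^ t) := by
      have := (hn1.shift.const_mul (Real.sqrt 2 : ℝ)).sub (hn2.const_mul (Complex.exp (Complex.I * σp)))
      convert this using 2 with t
      have e1 := sqrtTwo_mul_state_zero σp σm α β t n
      have e2 : ∑ j, A j * l j ^ (n + 1) * ζ j ^ t =
          (Real.sqrt 2 : ℝ) * ∑ j, A j * l j ^ n * ζ j ^ (t + 1) - Complex.exp (Complex.I * σp) *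
            ∑ j, -((ζ j)⁻¹ * B j * l j ^ n) * ζ j ^ t := by
        rw [Finset.mul_sum, Finset.mul_sum, ← Finset.sum_sub_distrib]
        refine Finset.sum_congr rfl fun j _ => ?_
        linear_combination l j ^ n * ζ j ^ t * h1 j
      rw [e2]
      linear_combination -e1
    refine ⟨by exact_mod_cast hu', CesNull.of_shift ?_⟩
    have := ((hu'.const_mul (Complex.exp (-(Complex.I * σp)))).sub hn2).const_mul
      ((Real.sqrt 2 : ℝ) : ℂ)⁻¹
    convert this using 2 with t
    have e1 := sqrtTwo_mul_state_one σp σm α β t n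
    have hs := sqrtTwo_ne_zero
    have e2 : (Real.sqrt 2 : ℝ) * ∑ j, -((ζ j)⁻¹ * B j * l j ^ (n + 1)) * ζ j ^ (t + 1) =
        Complex.exp (-(Complex.I * σp)) * ∑ j, A j * l j ^ (n + 1) * ζ j ^ t -
          ∑ j, -((ζ j)⁻¹ * B j * l j ^ n) * ζ j ^ t := by
      rw [Finset.mul_sum, Finset.mul_sum, ← Finset.sum_sub_distrib]
      refine Finset.sum_congr rfl fun j _ => ?_
      have e3 : ζ j ^ (t + 1) * (ζ j)⁻¹ = ζ j ^ t := by
        rw [pow_succ, mul_assoc, mul_inv_cancel₀ (hζ j), mul_one]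
      linear_combination l j ^ n * ζ j ^ t * h2 j -
        (Real.sqrt 2 : ℝ) * B j * l j ^ (n + 1) * e3
    rw [eq_inv_mul_iff_mul_eq₀ hs, mul_sub, e2]
    push_cast
    linear_combination e1

theorem tendsto_average_prob {ι : Type*} [Fintype ι] {A B ζ l : ι → ℂ} (hζ : ∀ j, ‖ζ j‖ = 1)
    (hne : ∀ j k, j ≠ k → A j ≠ 0 → A k ≠ 0 → ζ j ≠ ζ k)
    (hBA : ∀ j, ‖B j‖ = ‖A j‖)
    (h1 : ∀ j, l j * A j = (Real.sqrt 2 : ℝ) * ζ j * A j +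
      Complex.exp (Complex.I * σp) * (ζ j)⁻¹ * B j)
    (h2 : ∀ j, -((Real.sqrt 2 : ℝ) * B j * l j) = Complex.exp (-(Complex.I * σp)) * l j * A j +
      (ζ j)⁻¹ * B j)
    (hu : CesNull fun t => state σp σm α β t 0 0 - ∑ j, A j * ζ j ^ t)
    (hd : CesNull fun t => state σp σm α β t 0 1 - ∑ j, B j * ζ j ^ t) (n : ℕ) :
    Tendsto (fun T : ℕ => (∑ t ∈ Finset.range T, prob σp σm α β t n) / (T : ℝ)) atTop
      (𝓝 (∑ j, ‖A j‖ ^ 2 * (if n = 0 then 2 else (‖l j‖ ^ 2) ^ n + (‖l j‖ ^ 2) ^ (n - 1)))) := by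
  have hζ0 : ∀ j, ζ j ≠ 0 := fun j => ne_zero_of_norm_one (hζ j)
  have hB0 : ∀ j, A j = 0 → B j = 0 := fun j h => by
    rw [← norm_eq_zero, hBA, h, norm_zero]
  have key : ∀ (f : ι → ℂ), (∀ j, A j = 0 → f j = 0) → ∀ j k, j ≠ k → f j ≠ 0 → f k ≠ 0 →
      ζ j ≠ ζ k := fun f hf j k hjk hj hk =>
    hne j k hjk (fun h => hj (hf j h)) (fun h => hk (hf k h))
  have hn := cesNull_state σp σm α β hζ0 h1 h2 hu hd
  have t0 := cesaro_norm_sq_of_cesNull (fun j => A j * l j ^ n) ζ hζ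
    (key _ fun j h => by simp [h]) (hn n).1
  have comb : ∀ g : ι → ℂ, Tendsto (fun T : ℕ => (∑ t ∈ Finset.range T, ‖state σp σm α β t n 1‖ ^ 2) / (T : ℝ))
      atTop (𝓝 (∑ j, ‖g j‖ ^ 2)) →
      Tendsto (fun T : ℕ => (∑ t ∈ Finset.range T, prob σp σm α β t n) / (T : ℝ)) atTop
        (𝓝 (∑ j, (‖A j * l j ^ n‖ ^ 2 + ‖g j‖ ^ 2))) := by
    intro g hg
    rw [Finset.sum_add_distrib]
    refine (t0.add hg).congr fun T => ?_
    rw [← add_div, ← Finset.sum_add_distrib]; rfl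
  rcases n with _ | n
  · have t1 := cesaro_norm_sq_of_cesNull B ζ hζ (key _ hB0) hd
    convert comb B (by exact_mod_cast t1) using 2
    refine Finset.sum_congr rfl fun j _ => ?_
    rw [hBA]; simp; ring
  · have t1 := cesaro_norm_sq_of_cesNull (fun j => -((ζ j)⁻¹ * B j * l j ^ n)) ζ hζ
      (key _ fun j h => by simp [hB0 j h]) (hn n).2
    convert comb _ (by exact_mod_cast t1) using 2
    refine Finset.sum_congr rfl fun j _ => ?_
    rw [if_neg (by omega), norm_neg, norm_mul, norm_mul, norm_mul, norm_inv, hζ, hBA, norm_pow, norm_pow]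
    simp only [Nat.add_one_sub_one]
    ring

/-- The sign attached to a boolean. -/
noncomputable def sgn (b : Bool) : ℂ := if b then 1 else -1

theorem sgn_sq (b : Bool) : sgn b ^ 2 = 1 := by cases b <;> simp [sgn]

theorem norm_sgn (b : Bool) : ‖sgn b‖ = 1 := by cases b <;> simp [sgn]

theorem norm_sgn_phase (b : Bool) : ‖sgn b * phase σp σm‖ = 1 := by
  rw [norm_mul, norm_sgn, norm_phase, one_mul]

/-- A pole at W in the variable z² is a pair of poles ±μ⁻¹ in z, as 1 - z²/W = (1 - μz)(1 + μz).
Each resolvent pole therefore carries two eigenvalues ±μ. -/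
theorem hasSum_mode {μ c : ℂ} (hμ : μ ^ 2 = (poleAt c)⁻¹) (hc : ‖c‖ = 1) {z : ℂ} (hz : ‖z‖ < 1) :
    HasSum (fun t : ℕ => (μ ^ t + (-μ) ^ t) * z ^ t) (2 / (1 - z ^ 2 / poleAt c)) := by
  have hn : ‖μ‖ = 1 := by
    have : ‖μ‖ ^ 2 = 1 := by rw [← norm_pow, hμ, norm_inv, norm_poleAt hc, inv_one]
    nlinarith [norm_nonneg μ]
  have h1 : ‖μ * z‖ < 1 := by rw [norm_mul, hn, one_mul]; exact hz
  have h2 : ‖-μ * z‖ < 1 := by rw [norm_mul, norm_neg, hn, one_mul]; exact hz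
  have h := (hasSum_geometric_of_norm_lt_one h1).add (hasSum_geometric_of_norm_lt_one h2)
  have n1 : 1 - μ * z ≠ 0 := fun h0 => by
    rw [← sub_eq_zero.1 h0] at h1; simp at h1
  have n2 : 1 + μ * z ≠ 0 := fun h0 => by
    have : -μ * z = 1 := by linear_combination -h0
    rw [this] at h2; simp at h2
  have e : (1 - μ * z)⁻¹ + (1 - -μ * z)⁻¹ = 2 / (1 - z ^ 2 / poleAt c) := by
    have e1 : 1 - z ^ 2 / poleAt c = (1 - μ * z) * (1 + μ * z) := by
      rw [div_eq_mul_inv, ← hμ]; ring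
    rw [e1, show 1 - -μ * z = 1 + μ * z by ring]
    field_simp
    ring
  rw [e] at h
  have h3 : (fun t : ℕ => (μ ^ t + (-μ) ^ t) * z ^ t) = fun t => (μ * z) ^ t + (-μ * z) ^ t := by
    ext t; rw [mul_pow, mul_pow]; ring
  rw [h3]
  exact h

/-- Subtracting the modes removes the principal parts, so the generating function of the difference
is a combination of remainders. The 4 is the 2 of the partial fractions times the 2 of the pair of
modes. -/
theorem cesNull_origin (h : ‖α‖ ^ 2 + ‖β‖ ^ 2 = 1) {i : Fin 2} {C : Bool → ℂ} {μ : Bool → ℂ}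
    (hμ : ∀ b, μ b ^ 2 = (poleAt (sgn b * phase σp σm))⁻¹)
    (hgen : ∀ z : ℂ, z ≠ 0 → ‖z‖ < 1 → gen σp σm α β 0 i z =
      ∑ b, 2⁻¹ * C b * resolv (sgn b * phase σp σm) (z ^ 2)) :
    CesNull fun t => state σp σm α β t 0 i -
      ∑ j : Bool × Bool, (C j.1 * resid (sgn j.1 * phase σp σm) / 4) * (sgn j.2 * μ j.1) ^ t := by
  have hc := norm_sgn_phase σp σm
  have hμn : ∀ b, ‖μ b‖ = 1 := fun b => by
    have : ‖μ b‖ ^ 2 = 1 := by rw [← norm_pow, hμ, norm_inv, norm_poleAt (hc b), inv_one]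
    nlinarith [norm_nonneg (μ b)]
  set c : Bool → ℂ := fun b => sgn b * phase σp σm with hcdef
  have hsum : ∀ t : ℕ, ∑ j : Bool × Bool, (C j.1 * resid (c j.1) / 4) * (sgn j.2 * μ j.1) ^ t =
      ∑ b, (C b * resid (c b) / 4) * (μ b ^ t + (-μ b) ^ t) := by
    intro t
    rw [Fintype.sum_prod_type]
    refine Finset.sum_congr rfl fun b _ => ?_
    rw [Fintype.sum_bool]
    simp only [sgn, if_true, Bool.false_eq_true, if_false]
    ring
  refine (congrArg CesNull (funext fun t => congrArg (state σp σm α β t 0 i - ·) (hsum t))).mpr ?_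
  refine cesNull_of_gen (K := 1 + ∑ b, ‖C b * resid (c b) / 4‖ * 2) (K' := ∑ b, ‖2⁻¹ * C b‖ * 2)
    (G := fun Z => ∑ b, 2⁻¹ * C b * remainder (c b) Z) ?_ ?_ ?_ ?_
  · intro t
    refine (norm_sub_le _ _).trans (add_le_add (norm_state_le_one σp σm α β h t 0 i) ?_)
    refine (norm_sum_le _ _).trans (Finset.sum_le_sum fun b _ => ?_)
    rw [norm_mul]
    gcongr
    refine (norm_add_le _ _).trans ?_
    rw [norm_pow, norm_pow, norm_neg, hμn]; norm_num
  · intro Z hZ0 hZ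
    refine tendsto_finsetSum _ fun b _ => ?_
    refine ContinuousAt.mul continuousAt_const ?_
    unfold remainder
    refine (continuousAt_resolv hZ.le (one_add_sq_ne_zero hZ) (one_sub_mul_refl_ne_zero (hc b) hZ)).sub
      (ContinuousAt.div (by fun_prop) (by fun_prop) ?_)
    apply one_sub_div_ne_zero (hc b) (poleAt_ne_zero (hc b))
    rintro rfl
    rw [norm_poleAt (hc b)] at hZ
    exact lt_irrefl _ hZ
  · intro Z hZ
    refine (norm_sum_le _ _).trans ?_
    rw [Finset.sum_mul]
    refine Finset.sum_le_sum fun b _ => ?_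
    rw [norm_mul, mul_assoc]
    gcongr
    refine norm_remainder_le (hc b) hZ.le ?_ (one_add_sq_ne_zero hZ)
    rintro rfl
    rw [norm_poleAt (hc b)] at hZ
    exact lt_irrefl _ hZ
  · intro z hz0 hz
    have s1 := (summable_mul_pow (fun t => norm_state_le_one σp σm α β h t 0 i) hz).hasSum
    have s2 := hasSum_sum (s := Finset.univ) fun b _ =>
      (hasSum_mode (hμ b) (hc b) hz).mul_left (C b * resid (c b) / 4)
    have s3 := s1.sub s2
    have e : ∀ t, (state σp σm α β t 0 i - ∑ b, (C b * resid (c b) / 4) * (μ b ^ t + (-μ b) ^ t)) * z ^ t =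
        state σp σm α β t 0 i * z ^ t -
          ∑ b, C b * resid (c b) / 4 * ((μ b ^ t + (-μ b) ^ t) * z ^ t) := by
      intro t
      rw [sub_mul, Finset.sum_mul]
      simp_rw [mul_assoc]
    simp_rw [e]
    rw [s3.tsum_eq]
    change gen σp σm α β 0 i z - _ = _
    rw [hgen z hz0 hz, ← Finset.sum_sub_distrib]
    refine Finset.sum_congr rfl fun b _ => ?_
    unfold remainder
    simp only [hcdef]
    ring

theorem exists_sq_eq (w : ℂ) : ∃ μ : ℂ, μ ^ 2 = w :=
  IsAlgClosed.exists_pow_nat_eq w (by norm_num)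

/-- Equal poles for c and -c force c² = 1, hence √2 |Re c| > 1, and then one of the two residues
vanishes. -/
theorem poleAt_ne_of_resid_ne_zero {c : ℂ} (hc : ‖c‖ = 1) (h1 : resid c ≠ 0) (h2 : resid (-c) ≠ 0) :
    poleAt c ≠ poleAt (-c) := by
  intro h
  have hc' : ‖-c‖ = 1 := by rwa [norm_neg]
  have a1 := ((resid_eq_zero_or hc).resolve_left h1).2
  have a2 := ((resid_eq_zero_or hc').resolve_left h2).2
  have m1 := mul_sub_sqrtTwo_mul_poleAt hc
  have m2 := mul_sub_sqrtTwo_mul_poleAt hc'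
  rw [← h] at m2
  have hp := poleAt_ne_zero hc
  have hq := sqrtTwo_ne_zero
  have hc0 := ne_zero_of_norm_one hc
  have e : c ^ 2 = 1 := by
    have e1 : poleAt c * c ^ 2 = -1 := by linear_combination (m1 + m2) / 2
    have e2 : (Real.sqrt 2 : ℝ) * c * (-poleAt c) = (Real.sqrt 2 : ℝ) * c := by
      linear_combination (m1 - m2) / 2
    have e3 : -poleAt c = 1 := by
      apply mul_left_cancel₀ (mul_ne_zero hq hc0); rw [e2, mul_one]
    linear_combination -e1 - c ^ 2 * e3
  have hre : c.re ^ 2 = 1 := by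
    rcases mul_eq_zero.1 (show (c - 1) * (c + 1) = 0 by linear_combination e) with h | h
    · rw [sub_eq_zero.1 h]; simp
    · rw [eq_neg_of_add_eq_zero_left h]; simp
  simp only [Complex.neg_re] at a2
  nlinarith [sqrtTwo_bounds, real_sqrtTwo_sq]

end

/-! ### The explicit time-averaged limit. -/

/-- The real sign attached to a boolean. -/
noncomputable def eps (b : Bool) : ℝ := if b then 1 else -1

theorem sgn_eq (b : Bool) : sgn b = (eps b : ℂ) := by cases b <;> simp [sgn, eps]

theorem eps_sq (b : Bool) : eps b ^ 2 = 1 := by cases b <;> simp [eps]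

theorem re_sgn_phase (σp σm : ℝ) (b : Bool) :
    (sgn b * phase σp σm).re = -(eps b * Real.sin ((σp - σm) / 2)) := by
  rw [sgn_eq, Complex.re_ofReal_mul, phase, mul_comm Complex.I (((σp - σm) / 2 : ℝ) : ℂ),
    Complex.exp_mul_I]
  simp [← Complex.ofReal_cos, ← Complex.ofReal_sin, -Complex.ofReal_div, -Complex.ofReal_sub]

/-- The quantity `ε √2 sin σ` governing the bound state of sign `ε`. -/
noncomputable def boundParam (σp σm : ℝ) (b : Bool) : ℝ := eps b * Real.sqrt 2 * Real.sin ((σp - σm) / 2)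

theorem boundParam_eq (σp σm : ℝ) (b : Bool) :
    boundParam σp σm b = -(Real.sqrt 2 * (sgn b * phase σp σm).re) := by
  rw [re_sgn_phase, boundParam]; ring

theorem three_add_boundParam_pos (σp σm : ℝ) (b : Bool) : 0 < 3 + 2 * boundParam σp σm b := by
  have := three_sub_pos (norm_sgn_phase σp σm b)
  rw [boundParam_eq]; linarith

open Classical in
theorem timeAveragedLimit_eq_sum (σp σm a b φ : ℝ) (x : ℤ) :
    timeAveragedLimit σp σm a b φ x =
      ∑ s, if -1 ≤ boundParam σp σm s then nu (eps s) σp σm a b φ x else 0 := by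
  have h2 : 0 < Real.sqrt 2 := by positivity
  have e1 : -(1 / Real.sqrt 2) ≤ Real.sin ((σp - σm) / 2) ↔ -1 ≤ boundParam σp σm true := by
    rw [boundParam, eps, if_pos rfl, one_mul, ← neg_div, div_le_iff₀ h2, mul_comm]
  have e2 : Real.sin ((σp - σm) / 2) ≤ 1 / Real.sqrt 2 ↔ -1 ≤ boundParam σp σm false := by
    rw [boundParam, eps, if_neg (by simp), le_div_iff₀ h2]
    constructor <;> intro h <;> linarith
  rw [Fintype.sum_bool, timeAveragedLimit]
  simp only [e1, e2]
  simp [eps]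

theorem nu_eps (s : Bool) (σp σm a b φ : ℝ) (x : ℤ) : nu (eps s) σp σm a b φ x =
    ((1 + boundParam σp σm s) / (3 + 2 * boundParam σp σm s)) ^ 2 *
      (1 + 2 * eps s * a * b * Real.sin (φ - (σp + σm) / 2)) *
      (if x = 0 then 1 else
        (2 + boundParam σp σm s) * (1 / (3 + 2 * boundParam σp σm s)) ^ x.natAbs) := by
  have e : 2 * eps s * Real.sqrt 2 * Real.sin ((σp - σm) / 2) = 2 * boundParam σp σm s := by
    rw [boundParam]; ring
  rw [nu, e]; rfl

theorem timeAveragedLimit_reflect (σp σm a b φ : ℝ) (n : ℤ) :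
    timeAveragedLimit (Real.pi - σm) (Real.pi - σp) b a (-φ) n =
      timeAveragedLimit σp σm a b φ (-n) := by
  have e1 : (Real.pi - σm - (Real.pi - σp)) / 2 = (σp - σm) / 2 := by ring
  have e2 : Real.sin (-φ - (Real.pi - σm + (Real.pi - σp)) / 2) = Real.sin (φ - (σp + σm) / 2) := by
    have : -φ - (Real.pi - σm + (Real.pi - σp)) / 2 = -(φ - (σp + σm) / 2) - Real.pi := by ring
    rw [this, Real.sin_sub_pi, Real.sin_neg, neg_neg]
  unfold timeAveragedLimit nu
  rw [e1, e2]
  simp only [neg_eq_zero, Int.natAbs_neg]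
  simp only [mul_comm b a, mul_assoc]

open Classical in
theorem norm_resid_sq (σp σm : ℝ) (b : Bool) : ‖resid (sgn b * phase σp σm)‖ ^ 2 =
    if -1 ≤ boundParam σp σm b then
      4 * ((1 + boundParam σp σm b) / (3 + 2 * boundParam σp σm b)) ^ 2 else 0 := by
  have hb := boundParam_eq σp σm b
  rcases resid_cases (norm_sgn_phase σp σm b) with h | h
  · rw [if_pos (by linarith [h.2.1]), h.2.2, Complex.norm_real, Real.norm_eq_abs, sq_abs, hb]
    ring
  · rw [h.2]
    split_ifs with h1
    -- At the threshold the bound state disappears continuously, so both alternatives give zero.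
    · have : boundParam σp σm b = -1 := by linarith [h.1]
      rw [this]; simp
    · simp

theorem norm_add_sq_of_exp (a b φ₁ φ₂ u : ℝ) (hab : a ^ 2 + b ^ 2 = 1) :
    ‖(a : ℂ) * Complex.exp (Complex.I * φ₁) -
      Complex.exp (Complex.I * u) * (b * Complex.exp (Complex.I * φ₂))‖ ^ 2 =
      1 - 2 * a * b * Real.cos (φ₁ - φ₂ - u) := by
  rw [← Complex.normSq_eq_norm_sq, Complex.normSq_sub]
  have e1 : ∀ v : ℝ, Complex.normSq (Complex.exp (Complex.I * v)) = 1 := fun v => by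
    rw [Complex.normSq_eq_norm_sq, norm_exp_I_mul_ofReal', one_pow]
  have e2 : ∀ v : ℝ, conj (Complex.exp (Complex.I * v)) = Complex.exp (-(Complex.I * v)) := fun v => by
    rw [← Complex.exp_conj]; simp
  have e3 : (a : ℂ) * Complex.exp (Complex.I * φ₁) *
      conj (Complex.exp (Complex.I * u) * (b * Complex.exp (Complex.I * φ₂))) =
      ((a * b : ℝ) : ℂ) * Complex.exp (((φ₁ - φ₂ - u : ℝ) : ℂ) * Complex.I) := by
    have : Complex.exp (((φ₁ - φ₂ - u : ℝ) : ℂ) * Complex.I) = Complex.exp (Complex.I * φ₁) *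
        (Complex.exp (-(Complex.I * u)) * Complex.exp (-(Complex.I * φ₂))) := by
      rw [← Complex.exp_add, ← Complex.exp_add]; congr 1; push_cast; ring
    rw [this, map_mul, map_mul, e2, e2, Complex.conj_ofReal]; push_cast; ring
  rw [e3, Complex.re_ofReal_mul, Complex.exp_ofReal_mul_I_re]
  simp only [map_mul, e1, Complex.normSq_ofReal]
  linear_combination hab

section
variable (σp σm a b φ₁ φ₂ : ℝ) (α β : ℂ) (hab : a ^ 2 + b ^ 2 = 1)
  (hα : α = a * Complex.exp (Complex.I * φ₁)) (hβ : β = b * Complex.exp (Complex.I * φ₂))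

include hab hα hβ

theorem norm_sq_add_norm_sq : ‖α‖ ^ 2 + ‖β‖ ^ 2 = 1 := by
  rw [hα, hβ, norm_mul, norm_mul, norm_exp_I_mul_ofReal', norm_exp_I_mul_ofReal',
    Complex.norm_real, Complex.norm_real, mul_one, mul_one, Real.norm_eq_abs, Real.norm_eq_abs,
    sq_abs, sq_abs, hab]

/-- Because c⁻¹ e^{iσ₊} = -i e^{iσ̃}, the coefficient has the form α - e^{iu} β with u = σ̃ ∓ π/2;
the quarter turn makes the interference term a sine. -/
theorem norm_modeCoeff_sq (s : Bool) :
    ‖α - sgn s * ((phase σp σm)⁻¹ * Complex.exp (Complex.I * σp) * β)‖ ^ 2 =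
      1 + 2 * eps s * a * b * Real.sin (φ₁ - φ₂ - (σp + σm) / 2) := by
  have e1 : (phase σp σm)⁻¹ * Complex.exp (Complex.I * σp) =
      -(Complex.I * Complex.exp (Complex.I * (((σp + σm) / 2 : ℝ) : ℂ))) := by
    rw [inv_mul_eq_iff_eq_mul₀ (phase_ne_zero σp σm), phase]
    have : Complex.exp (Complex.I * σp) = Complex.exp (Complex.I * (((σp - σm) / 2 : ℝ) : ℂ)) *
      Complex.exp (Complex.I * (((σp + σm) / 2 : ℝ) : ℂ)) := by
      rw [← Complex.exp_add]; congr 1; push_cast; ring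
    rw [this]
    linear_combination Complex.exp (Complex.I * (((σp - σm) / 2 : ℝ) : ℂ)) *
      Complex.exp (Complex.I * (((σp + σm) / 2 : ℝ) : ℂ)) * Complex.I_sq
  have e2 : ∃ u : ℝ, sgn s * -(Complex.I * Complex.exp (Complex.I * (((σp + σm) / 2 : ℝ) : ℂ))) =
      Complex.exp (Complex.I * u) ∧ Real.cos (φ₁ - φ₂ - u) =
        -(eps s * Real.sin (φ₁ - φ₂ - (σp + σm) / 2)) := by
    have hI : Complex.exp (Complex.I * ((Real.pi / 2 : ℝ) : ℂ)) = Complex.I := by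
      rw [mul_comm]; push_cast; exact Complex.exp_pi_div_two_mul_I
    cases s
    · refine ⟨(σp + σm) / 2 + Real.pi / 2, ?_, ?_⟩
      · rw [Complex.ofReal_add, mul_add, Complex.exp_add, hI]; simp [sgn]; ring
      · rw [← sub_sub, Real.cos_sub_pi_div_two]; simp [eps]
    · refine ⟨(σp + σm) / 2 - Real.pi / 2, ?_, ?_⟩
      · rw [Complex.ofReal_sub, mul_sub, Complex.exp_sub, hI]; simp [sgn]; ring
      · rw [sub_sub_eq_add_sub, add_sub_right_comm, Real.cos_add_pi_div_two]; simp [eps]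
  obtain ⟨u, hu1, hu2⟩ := e2
  rw [← mul_assoc, e1, hu1, hα, hβ, norm_add_sq_of_exp _ _ _ _ _ hab, hu2]
  ring

theorem tendsto_average_prob_nat (n : ℕ) :
    Tendsto (fun T : ℕ => (∑ t ∈ Finset.range T, prob σp σm α β t n) / (T : ℝ)) atTop
      (𝓝 (timeAveragedLimit σp σm a b (φ₁ - φ₂) n)) := by
  have hnorm := norm_sq_add_norm_sq a b φ₁ φ₂ α β hab hα hβ
  have hc := norm_sgn_phase σp σm
  choose μ hμ using fun s : Bool => exists_sq_eq (poleAt (sgn s * phase σp σm))⁻¹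
  have hμn : ∀ s, ‖μ s‖ = 1 := fun s => by
    have : ‖μ s‖ ^ 2 = 1 := by rw [← norm_pow, hμ, norm_inv, norm_poleAt (hc s), inv_one]
    nlinarith [norm_nonneg (μ s)]
  set E := Complex.exp (Complex.I * σp) with hE
  have hEE : Complex.exp (-(Complex.I * σp)) = E⁻¹ := by rw [Complex.exp_neg]
  have hE0 : E ≠ 0 := Complex.exp_ne_zero _
  have hEn : ‖E‖ = 1 := norm_exp_I_mul_ofReal' _
  let cu : Bool → ℂ := fun s => α - sgn s * ((phase σp σm)⁻¹ * E * β)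
  let cd : Bool → ℂ := fun s => β - sgn s * (phase σp σm * E⁻¹ * α)
  have hcd : ∀ s, cd s = -(sgn s * phase σp σm * E⁻¹ * cu s) := by
    intro s
    have h0 := phase_ne_zero σp σm
    have h1 := sgn_sq s
    simp only [cd, cu]
    field_simp
    linear_combination -β * E * h1
  have gu := cesNull_origin σp σm α β hnorm (i := 0) (C := cu) hμ (by
    intro z hz0 hz
    rw [(gen_origin σp σm α β hnorm hz hz0).1, Fintype.sum_bool]
    simp only [sgn, if_true, Bool.false_eq_true, if_false, cu, originUpper, neg_one_mul, one_mul]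
    ring)
  have gd := cesNull_origin σp σm α β hnorm (i := 1) (C := cd) hμ (by
    intro z hz0 hz
    rw [(gen_origin σp σm α β hnorm hz hz0).2, Fintype.sum_bool]
    simp only [sgn, if_true, Bool.false_eq_true, if_false, cd, originLower, neg_one_mul, one_mul, hEE]
    ring)
  have hζn : ∀ j : Bool × Bool, ‖sgn j.2 * μ j.1‖ = 1 := fun j => by
    rw [norm_mul, norm_sgn, hμn, one_mul]
  have hζsq : ∀ j : Bool × Bool, (sgn j.2 * μ j.1) ^ 2 = (poleAt (sgn j.1 * phase σp σm))⁻¹ :=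
    fun j => by rw [mul_pow, sgn_sq, one_mul, hμ]
  have hζl : ∀ j : Bool × Bool, (sgn j.2 * μ j.1) ^ 2 *
      ((Real.sqrt 2 : ℝ) * (sgn j.1 * phase σp σm) - 1) =
      sgn j.1 * phase σp σm * (sgn j.1 * phase σp σm - (Real.sqrt 2 : ℝ)) := fun j => by
    rw [hζsq, inv_mul_eq_iff_eq_mul₀ (poleAt_ne_zero (hc j.1)), mul_sub_sqrtTwo_mul_poleAt (hc j.1)]
  -- The spatial multiplier forced by the upper step equation l A = √2 ζ A + E ζ⁻¹ B with B = -c E⁻¹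
  -- A. The pole equation then gives l (1 - √2 c) = ζ⁻¹ c, hence |l|² = 1/(3 + 2q) with q =
  -- `boundParam`.
  let l : Bool × Bool → ℂ := fun j => (Real.sqrt 2 : ℝ) * (sgn j.2 * μ j.1) -
    sgn j.1 * phase σp σm * (sgn j.2 * μ j.1)⁻¹
  have hl : ∀ j, l j * (1 - (Real.sqrt 2 : ℝ) * (sgn j.1 * phase σp σm)) =
      (sgn j.2 * μ j.1)⁻¹ * (sgn j.1 * phase σp σm) := by
    intro j
    have h0 := ne_zero_of_norm_one (hζn j)
    have h1 := hζl j
    simp only [l]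
    have h2 := sqrtTwo_sq
    generalize sgn j.2 * μ j.1 = w at *
    generalize sgn j.1 * phase σp σm = c at *
    field_simp
    linear_combination -(Real.sqrt 2 : ℝ) * h1 + c * h2
  have hln : ∀ j, ‖l j‖ ^ 2 = 1 / (3 + 2 * boundParam σp σm j.1) := by
    intro j
    have h1 := congrArg (fun w => ‖w‖ ^ 2) (hl j)
    simp only [norm_mul (l j), norm_mul (_)⁻¹, norm_inv, hζn, hc] at h1
    have h2 := norm_one_sub_sqrtTwo_mul_sq (hc j.1)
    have h3 := three_add_boundParam_pos σp σm j.1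
    rw [mul_pow, h2] at h1
    rw [eq_div_iff h3.ne', boundParam_eq]
    linear_combination h1
  have main := tendsto_average_prob σp σm α β
    (A := fun j : Bool × Bool => cu j.1 * resid (sgn j.1 * phase σp σm) / 4)
    (B := fun j : Bool × Bool => cd j.1 * resid (sgn j.1 * phase σp σm) / 4)
    (ζ := fun j => sgn j.2 * μ j.1) (l := l) hζn ?_ ?_ ?_ ?_ gu gd n
  · convert main using 2
    rw [timeAveragedLimit_eq_sum, Fintype.sum_prod_type]
    refine Finset.sum_congr rfl fun s _ => ?_
    have hA : ‖cu s * resid (sgn s * phase σp σm) / 4‖ ^ 2 =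
        ‖cu s‖ ^ 2 * ‖resid (sgn s * phase σp σm)‖ ^ 2 / 16 := by
      rw [norm_div, norm_mul]; norm_num; ring
    simp only [hln, hA, Fintype.sum_bool]
    have hm := norm_modeCoeff_sq σp σm a b φ₁ φ₂ α β hab hα hβ s
    have hr := norm_resid_sq σp σm s
    have hq := three_add_boundParam_pos σp σm s
    rw [hr, hm, nu_eps]
    by_cases h1 : -1 ≤ boundParam σp σm s
    · rw [if_pos h1, if_pos h1]
      rcases n with _ | m
      · simp; ring
      · rw [if_neg (by omega), if_neg (by omega), Int.natAbs_natCast, Nat.add_sub_cancel, pow_succ]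
        have hL : 1 / (3 + 2 * boundParam σp σm s) * (3 + 2 * boundParam σp σm s) = 1 :=
          one_div_mul_cancel hq.ne'
        generalize 1 / (3 + 2 * boundParam σp σm s) = L at hL ⊢
        linear_combination ((1 + boundParam σp σm s) / (3 + 2 * boundParam σp σm s)) ^ 2 *
          (1 + 2 * eps s * a * b * Real.sin (φ₁ - φ₂ - (σp + σm) / 2)) * L ^ m / 2 * hL
    · rw [if_neg h1, if_neg h1]; ring
  -- Modes of one pole differ by their sign; modes of different poles differ because their squares
  -- are the inverses of distinct poles.
  · intro j k hjk hj hk h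
    have hj' : resid (sgn j.1 * phase σp σm) ≠ 0 := fun h0 => hj (by simp [h0])
    have hk' : resid (sgn k.1 * phase σp σm) ≠ 0 := fun h0 => hk (by simp [h0])
    have hsq : poleAt (sgn j.1 * phase σp σm) = poleAt (sgn k.1 * phase σp σm) := by
      rw [← inv_inj, ← hζsq, ← hζsq, h]
    obtain ⟨j1, j2⟩ := j
    obtain ⟨k1, k2⟩ := k
    by_cases h1 : j1 = k1
    · subst h1
      have : j2 ≠ k2 := fun h2 => hjk (by rw [h2])
      have h3 : sgn j2 = sgn k2 := mul_right_cancel₀ (ne_zero_of_norm_one (hμn j1)) h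
      revert this h3
      cases j2 <;> cases k2 <;> simp [sgn] <;> norm_num
    · have h2 : sgn k1 * phase σp σm = -(sgn j1 * phase σp σm) := by
        revert h1; cases j1 <;> cases k1 <;> simp [sgn]
      simp only [h2] at hk' hsq
      exact poleAt_ne_of_resid_ne_zero (hc j1) hj' hk' hsq
  · intro j
    simp only [norm_div, norm_mul, hcd, norm_neg, norm_inv, hEn, norm_sgn, norm_phase]
    norm_num
  · intro j
    simp only [hcd, l]
    field_simp
    ring
  · intro j
    simp only [hcd, hEE]
    have := hl j
    linear_combination (-(E⁻¹) * (cu j.1 * resid (sgn j.1 * phase σp σm) / 4)) * this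

theorem tendsto_average_prob_int (x : ℤ) :
    Tendsto (fun T : ℕ => (∑ t ∈ Finset.range T, prob σp σm α β t x) / (T : ℝ)) atTop
      (𝓝 (timeAveragedLimit σp σm a b (φ₁ - φ₂) x)) := by
  obtain ⟨n, rfl | rfl⟩ := x.eq_nat_or_neg
  · exact tendsto_average_prob_nat σp σm a b φ₁ φ₂ α β hab hα hβ n
  · have h := tendsto_average_prob_nat (Real.pi - σm) (Real.pi - σp) b a φ₂ φ₁ β α
      (by linarith) hβ hα n
    simp_rw [prob_reflect] at h
    rwa [← neg_sub φ₁ φ₂, timeAveragedLimit_reflect] at h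

end

/-! ### Total mass of the bound states. -/

theorem hasSum_geometric_int {f : ℤ → ℝ} {L K : ℝ} (h0 : 0 ≤ L) (h1 : L < 1) (hf0 : f 0 = 1)
    (hf : ∀ n : ℕ, f (n + 1) = K * L ^ (n + 1)) (hf' : ∀ n : ℕ, f (-(n + 1)) = K * L ^ (n + 1)) :
    HasSum f (1 + 2 * (K * (L / (1 - L)))) := by
  have g : HasSum (fun n : ℕ => K * L ^ (n + 1)) (K * L * (1 - L)⁻¹) := by
    have e : (fun n : ℕ => K * L ^ (n + 1)) = fun n : ℕ => K * L * L ^ n := by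
      ext n; rw [pow_succ]; ring
    rw [e]
    exact (hasSum_geometric_of_lt_one h0 h1).mul_left (K * L)
  have hneg : HasSum (fun n : ℕ => f (-(n + 1))) (K * L * (1 - L)⁻¹) := by
    rw [funext hf']; exact g
  have hnat : HasSum (fun n : ℕ => f n) (K * L * (1 - L)⁻¹ + 1) := by
    have h2 : HasSum (fun n : ℕ => f ((n + 1 : ℕ) : ℤ)) (K * L * (1 - L)⁻¹) := by
      push_cast; rw [funext hf]; exact g
    have := (hasSum_nat_add_iff (f := fun n : ℕ => f n) 1).1 h2
    simpa [hf0] using this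
  have e : 1 + 2 * (K * (L / (1 - L))) = K * L * (1 - L)⁻¹ + 1 + K * L * (1 - L)⁻¹ := by ring
  rw [e]
  exact HasSum.of_nat_of_neg_add_one hnat hneg

/-- The mass of the bound state of sign `ε`. -/
noncomputable def boundMass (σp σm : ℝ) (s : Bool) : ℝ :=
  if -1 ≤ boundParam σp σm s then
    (1 + boundParam σp σm s) / (3 + 2 * boundParam σp σm s) else 0

theorem boundMass_nonneg (σp σm : ℝ) (s : Bool) : 0 ≤ boundMass σp σm s := by
  unfold boundMass
  split_ifs with h
  · exact div_nonneg (by linarith) (three_add_boundParam_pos σp σm s).le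
  · exact le_rfl

/-- Any uniform bound strictly below 1/2 would do: the two interference weights add up to 2, so C ≤
9/10. -/
theorem boundMass_le (σp σm : ℝ) (s : Bool) : boundMass σp σm s ≤ 9 / 20 := by
  unfold boundMass
  split_ifs with h
  · rw [div_le_iff₀ (three_add_boundParam_pos σp σm s)]
    have h1 := (abs_le.1 ((Complex.abs_re_le_norm _).trans (norm_sgn_phase σp σm s).le)).1
    have := sqrtTwo_bounds
    have h2 := boundParam_eq σp σm s
    nlinarith
  · norm_num

open Classical in
theorem hasSum_timeAveragedLimit (σp σm a b φ : ℝ) :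
    HasSum (timeAveragedLimit σp σm a b φ)
      (∑ s, boundMass σp σm s * (1 + 2 * eps s * a * b * Real.sin (φ - (σp + σm) / 2))) := by
  have key : ∀ s, HasSum (fun x => if -1 ≤ boundParam σp σm s then nu (eps s) σp σm a b φ x else 0)
      (boundMass σp σm s * (1 + 2 * eps s * a * b * Real.sin (φ - (σp + σm) / 2))) := by
    intro s
    have h3 := three_add_boundParam_pos σp σm s
    unfold boundMass
    split_ifs with h
    · rcases h.eq_or_lt with h1 | h1
      · simp [nu_eps, ← h1, hasSum_zero]
      · simp_rw [nu_eps]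
        have h4 : 1 / (3 + 2 * boundParam σp σm s) < 1 := by
          rw [div_lt_one h3]; linarith
        have h7 := (hasSum_geometric_int (K := 2 + boundParam σp σm s)
          (f := fun x => if x = 0 then 1 else
            (2 + boundParam σp σm s) * (1 / (3 + 2 * boundParam σp σm s)) ^ x.natAbs)
          (by positivity) h4 (if_pos rfl)
          (fun n => by
            rw [if_neg (by omega)]; congr 2)
          (fun n => by
            rw [if_neg (by omega)]; congr 2)).mul_left
          (((1 + boundParam σp σm s) / (3 + 2 * boundParam σp σm s)) ^ 2 *
            (1 + 2 * eps s * a * b * Real.sin (φ - (σp + σm) / 2)))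
        refine (congrArg (HasSum _) ?_).mpr h7
        have h5 : 0 < 1 + boundParam σp σm s := by linarith
        have h6 : 1 - 1 / (3 + 2 * boundParam σp σm s) =
            2 * (1 + boundParam σp σm s) / (3 + 2 * boundParam σp σm s) := by
          field_simp; ring
        rw [h6]
        have h8 := h3.ne'
        have h9 := h5.ne'
        generalize boundParam σp σm s = q at *
        -- The two geometric tails with ratio 1/(3 + 2q) multiply the mass at the origin by (3 +
        -- 2q)/(1 + q), which cancels one of the squared factors.
        have e : ((1 + q) / (3 + 2 * q)) ^ 2 *
            (1 + 2 * ((2 + q) * (1 / (3 + 2 * q) / (2 * (1 + q) / (3 + 2 * q))))) =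
            (1 + q) / (3 + 2 * q) := by
          have e1 : 1 / (3 + 2 * q) / (2 * (1 + q) / (3 + 2 * q)) = 1 / (2 * (1 + q)) := by
            field_simp
          have e2 : 1 + 2 * ((2 + q) * (1 / (2 * (1 + q)))) = (3 + 2 * q) / (1 + q) := by
            field_simp; ring
          rw [e1, e2]
          field_simp
        linear_combination -(1 + 2 * eps s * a * b * Real.sin (φ - (σp + σm) / 2)) * e
    · rw [zero_mul]; exact hasSum_zero
  have := hasSum_sum (s := Finset.univ) fun s _ => key s
  refine this.congr_fun fun x => ?_
  rw [timeAveragedLimit_eq_sum]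

theorem localizedMass_eq (σp σm a b φ : ℝ) : localizedMass σp σm a b φ =
    ∑ s, boundMass σp σm s * (1 + 2 * eps s * a * b * Real.sin (φ - (σp + σm) / 2)) :=
  (hasSum_timeAveragedLimit σp σm a b φ).tsum_eq

theorem one_add_interference_nonneg {a b : ℝ} (hab : a ^ 2 + b ^ 2 = 1) (u : ℝ) (s : Bool) :
    0 ≤ 1 + 2 * eps s * a * b * Real.sin u := by
  have h1 := Real.sin_sq_add_cos_sq u
  have h2 := eps_sq s
  have e : 1 + 2 * eps s * a * b * Real.sin u =
      (a + eps s * Real.sin u * b) ^ 2 + (b * Real.cos u) ^ 2 := by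
    linear_combination -hab - b ^ 2 * Real.sin u ^ 2 * h2 - b ^ 2 * h1
  rw [e]; positivity

theorem localizedMass_nonneg {a b : ℝ} (hab : a ^ 2 + b ^ 2 = 1) (σp σm φ : ℝ) :
    0 ≤ localizedMass σp σm a b φ := by
  rw [localizedMass_eq]
  exact Finset.sum_nonneg fun s _ =>
    mul_nonneg (boundMass_nonneg _ _ _) (one_add_interference_nonneg hab _ _)

theorem localizedMass_lt_one {a b : ℝ} (hab : a ^ 2 + b ^ 2 = 1) (σp σm φ : ℝ) :
    localizedMass σp σm a b φ < 1 := by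
  have h : localizedMass σp σm a b φ ≤
      ∑ s, 9 / 20 * (1 + 2 * eps s * a * b * Real.sin (φ - (σp + σm) / 2)) := by
    rw [localizedMass_eq]
    exact Finset.sum_le_sum fun s _ =>
      mul_le_mul_of_nonneg_right (boundMass_le _ _ _) (one_add_interference_nonneg hab _ _)
  rw [Fintype.sum_bool] at h
  simp only [eps, if_true, Bool.false_eq_true, if_false] at h
  linarith

/-! ### Domination of the flux density. -/

theorem intervalIntegrable_inv_sqrt_abs_sin (a b : ℝ) :
    IntervalIntegrable (fun u => (Real.sqrt |Real.sin u|)⁻¹) volume a b := by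
  have hper : Function.Periodic (fun u => (Real.sqrt |Real.sin u|)⁻¹) Real.pi := fun u => by
    simp only [Real.sin_add_pi, abs_neg]
  have hm : Measurable fun u => (Real.sqrt |Real.sin u|)⁻¹ := by fun_prop
  have h1 : IntervalIntegrable (fun u => (Real.sqrt |Real.sin u|)⁻¹) volume 0 (Real.pi / 2) := by
    have hg : IntervalIntegrable (fun u : ℝ => (Real.sqrt (2 / Real.pi))⁻¹ * u ^ (-(1 / 2) : ℝ)) volume 0
        (Real.pi / 2) :=
      (intervalIntegral.intervalIntegrable_rpow' (by norm_num)).const_mul _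
    refine hg.mono_fun hm.aestronglyMeasurable ?_
    refine (ae_restrict_mem measurableSet_uIoc).mono fun u hu => ?_
    rw [Set.uIoc_of_le (by positivity)] at hu
    have hpi := Real.pi_pos
    -- Jordan's inequality reduces a quarter period to the integrability of u^{-1/2}; symmetry and
    -- periodicity give the rest.
    have h2 := Real.mul_abs_le_abs_sin (x := u) (by rw [abs_of_pos hu.1]; exact hu.2)
    rw [abs_of_pos hu.1] at h2
    have h3 : Real.sqrt (2 / Real.pi) * Real.sqrt u ≤ Real.sqrt |Real.sin u| := by
      rw [← Real.sqrt_mul (by positivity)]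
      exact Real.sqrt_le_sqrt h2
    have h4 : 0 < Real.sqrt (2 / Real.pi) * Real.sqrt u :=
      mul_pos (Real.sqrt_pos.2 (by positivity)) (Real.sqrt_pos.2 hu.1)
    have h5 : u ^ (-(1 / 2) : ℝ) = (Real.sqrt u)⁻¹ := by
      rw [Real.rpow_neg hu.1.le, Real.sqrt_eq_rpow]
    beta_reduce
    rw [h5, Real.norm_of_nonneg (by positivity), Real.norm_of_nonneg (by positivity), ← mul_inv]
    exact inv_anti₀ h4 h3
  have h2 : IntervalIntegrable (fun u => (Real.sqrt |Real.sin u|)⁻¹) volume (-(Real.pi / 2)) 0 := by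
    have := (IntervalIntegrable.iff_comp_neg).1 h1
    simpa [abs_neg] using this.symm
  have h3 := h2.trans h1
  refine hper.intervalIntegrable Real.pi_ne_zero (t := -(Real.pi / 2)) ?_ a b
  convert h3 using 1
  ring

theorem intervalIntegrable_inv_sqrt_abs_cos (a b : ℝ) :
    IntervalIntegrable (fun u => (Real.sqrt |Real.cos u|)⁻¹) volume a b := by
  have := (intervalIntegrable_inv_sqrt_abs_sin (a + Real.pi / 2) (b + Real.pi / 2)).comp_add_right
    (Real.pi / 2)
  simpa [Real.sin_add_pi_div_two] using this

theorem inv_norm_branchRoot_pt_le {ϱ : ℝ} (h0 : 0 ≤ ϱ) {θ : ℝ} (hθ : Real.cos θ ≠ 0) :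
    ‖branchRoot (pt ϱ θ)‖⁻¹ ≤ (Real.sqrt |Real.cos θ|)⁻¹ := by
  refine inv_anti₀ (Real.sqrt_pos.2 (abs_pos.2 hθ)) ?_
  rw [Real.sqrt_le_left (norm_nonneg _)]
  exact (norm_branchRoot_pt_sq_ge h0 θ).1

section
variable (σp σm : ℝ) (α β : ℂ)

/-- The coefficient of the bound state of sign `s` in the initial coin state. -/
noncomputable def modeCoeff (s : Bool) : ℂ :=
  α - sgn s * ((phase σp σm)⁻¹ * Complex.exp (Complex.I * σp) * β)

/-- The energy density on the circle. -/
noncomputable def energy (Z : ℂ) : ℝ :=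
  (1 - ‖refl Z‖ ^ 2) * (‖originUpper σp σm α β Z‖ ^ 2 + ‖originLower σp σm α β Z‖ ^ 2)

/-- The solution paired with the initial state is diagonal in the two modes ±c: each resolvent
appears with the nonnegative weight |`modeCoeff`|²/2. -/
theorem conj_mul_origin (Z : ℂ) :
    conj α * originUpper σp σm α β Z + conj β * originLower σp σm α β Z =
      ∑ s, ((‖modeCoeff σp σm α β s‖ ^ 2 / 2 : ℝ) : ℂ) * resolv (sgn s * phase σp σm) Z := by
  have hc0 := phase_ne_zero σp σm
  have e1 : conj (Complex.exp (Complex.I * σp)) = Complex.exp (-(Complex.I * σp)) := by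
    rw [← Complex.exp_conj]; simp
  have e2 : conj (phase σp σm)⁻¹ = phase σp σm := by
    rw [inv_eq_conj_of_norm_one (norm_phase σp σm), Complex.conj_conj]
  have e4 : Complex.exp (Complex.I * σp) * Complex.exp (-(Complex.I * σp)) = 1 := by
    rw [← Complex.exp_add]; simp
  have hk : ∀ s, ((‖modeCoeff σp σm α β s‖ ^ 2 / 2 : ℝ) : ℂ) = modeCoeff σp σm α β s *
      (conj α - sgn s * (phase σp σm * Complex.exp (-(Complex.I * σp)) * conj β)) / 2 := by
    intro s
    push_cast
    have : conj (sgn s) = sgn s := by rw [sgn_eq]; simp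
    rw [← Complex.mul_conj', modeCoeff, map_sub, map_mul, map_mul, map_mul, e1, e2, this]
  rw [Fintype.sum_bool, hk, hk]
  simp only [originUpper, originLower, modeCoeff, sgn, if_true,
    Bool.false_eq_true, if_false, neg_one_mul, one_mul]
  set c := phase σp σm
  set e := Complex.exp (Complex.I * σp)
  set f := Complex.exp (-(Complex.I * σp))
  have h5 : c⁻¹ * c = 1 := inv_mul_cancel₀ hc0
  linear_combination (-(β * conj β * (resolv c Z + resolv (-c) Z)) / 2) * h5 * (e * f) -
    (β * conj β * (resolv c Z + resolv (-c) Z)) / 2 * e4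

variable {σp σm α β} (h : ‖α‖ ^ 2 + ‖β‖ ^ 2 = 1)
include h

/-- An optical theorem. For x = w + v one has 2 Re(w̄x) - |w|² = |x|² - |v|²; applied to both origin
equations it makes a quadratic quantity linear in the resolvents. Linearity gives bounds by first
powers of 1/(1 ∓ cy) and allows integration by the mean value property. -/
theorem energy_eq {Z : ℂ} (h1 : 1 - phase σp σm * refl Z ≠ 0) (h2 : 1 + phase σp σm * refl Z ≠ 0) :
    energy σp σm α β Z =
      ∑ s, ‖modeCoeff σp σm α β s‖ ^ 2 * (resolv (sgn s * phase σp σm) Z).re - 1 := by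
  obtain ⟨hu, hd⟩ := origin_system σp σm α β h1 h2
  have hF := congrArg Complex.re (conj_mul_origin σp σm α β Z)
  set u := originUpper σp σm α β Z
  set d := originLower σp σm α β Z
  set y := refl Z
  have gen : ∀ x w v : ℂ, x = w + v → 2 * (conj w * x).re - ‖w‖ ^ 2 = ‖x‖ ^ 2 - ‖v‖ ^ 2 := by
    rintro x w v rfl
    rw [← Complex.normSq_eq_norm_sq, ← Complex.normSq_eq_norm_sq, ← Complex.normSq_eq_norm_sq]
    simp only [Complex.normSq_apply, Complex.mul_re, Complex.conj_re, Complex.conj_im, Complex.add_re,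
      Complex.add_im]
    ring
  have g1 := gen u α (-(Complex.exp (Complex.I * σp) * y * d)) (by rw [← sub_eq_add_neg]; exact hu)
  have g2 := gen d β (Complex.exp (-(Complex.I * σm)) * y * u) hd
  have e3 : ‖Complex.exp (-(Complex.I * σm))‖ = 1 := by
    have := norm_exp_I_mul_ofReal' (-σm)
    simpa using this
  rw [norm_neg, norm_mul, norm_mul, norm_exp_I_mul_ofReal', one_mul] at g1
  rw [norm_mul, norm_mul, e3, one_mul] at g2
  simp only [Complex.add_re, Complex.re_sum, Complex.re_ofReal_mul] at hF
  have e4 : ∑ s, ‖modeCoeff σp σm α β s‖ ^ 2 * (resolv (sgn s * phase σp σm) Z).re =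
      2 * ∑ s, ‖modeCoeff σp σm α β s‖ ^ 2 / 2 * (resolv (sgn s * phase σp σm) Z).re := by
    rw [Finset.mul_sum]; exact Finset.sum_congr rfl fun s _ => by ring
  rw [e4, ← hF]
  unfold energy
  linear_combination -g1 - g2 - h

theorem norm_modeCoeff_sq_le (s : Bool) : ‖modeCoeff σp σm α β s‖ ^ 2 ≤ 2 := by
  have h1 : ‖modeCoeff σp σm α β s‖ ≤ ‖α‖ + ‖β‖ := by
    refine (norm_sub_le _ _).trans ?_
    rw [norm_mul, norm_mul, norm_mul, norm_inv, norm_sgn, norm_phase, norm_exp_I_mul_ofReal']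
    simp
  have h2 := norm_nonneg (modeCoeff σp σm α β s)
  nlinarith [sq_nonneg (‖α‖ - ‖β‖), norm_nonneg α, norm_nonneg β]

theorem energy_le {Z : ℂ} (h1 : 1 - phase σp σm * refl Z ≠ 0) (h2 : 1 + phase σp σm * refl Z ≠ 0) :
    energy σp σm α β Z ≤ ∑ s, 2 * ‖resolv (sgn s * phase σp σm) Z‖ := by
  rw [energy_eq h h1 h2]
  refine (sub_le_self _ zero_le_one).trans (Finset.sum_le_sum fun s _ => ?_)
  have := norm_modeCoeff_sq_le (σp := σp) (σm := σm) h s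
  calc _ ≤ ‖modeCoeff σp σm α β s‖ ^ 2 * ‖resolv (sgn s * phase σp σm) Z‖ := by
        gcongr; exact Complex.re_le_norm _
    _ ≤ _ := by gcongr

theorem fluxDensity_le {Z : ℂ} (hZ : ‖Z‖ < 1) (n : ℕ) : fluxDensity σp σm α β n Z ≤
    ∑ s, 2 * (‖multSq Z‖ ^ n * ‖resolv (sgn s * phase σp σm) Z‖) := by
  have n1 := one_sub_mul_refl_ne_zero (norm_phase σp σm) hZ
  have n2 : 1 + phase σp σm * refl Z ≠ 0 := by
    have := one_sub_mul_refl_ne_zero (c := -phase σp σm) (by rw [norm_neg, norm_phase]) hZ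
    simpa using this
  have h1 := energy_le h n1 n2
  have h2 : (‖Z‖ - ‖refl Z‖ ^ 2) * ‖originLower σp σm α β Z‖ ^ 2 ≤ energy σp σm α β Z := by
    have h3 := norm_refl_lt_one hZ
    have h4 : 0 ≤ 1 - ‖refl Z‖ ^ 2 := by nlinarith [norm_nonneg (refl Z)]
    unfold energy
    nlinarith [sq_nonneg ‖originLower σp σm α β Z‖, sq_nonneg ‖originUpper σp σm α β Z‖,
      mul_nonneg h4 (sq_nonneg ‖originUpper σp σm α β Z‖)]
  calc fluxDensity σp σm α β n Z ≤ ‖multSq Z‖ ^ n * energy σp σm α β Z := by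
        unfold fluxDensity; gcongr
    _ ≤ ‖multSq Z‖ ^ n * ∑ s, 2 * ‖resolv (sgn s * phase σp σm) Z‖ := by gcongr
    _ = _ := by rw [Finset.mul_sum]; exact Finset.sum_congr rfl fun s _ => by ring

omit h in
theorem fluxDensity_nonneg {Z : ℂ} (hZ : ‖Z‖ < 1) (n : ℕ) : 0 ≤ fluxDensity σp σm α β n Z := by
  have := norm_refl_sq_le hZ
  unfold fluxDensity
  exact mul_nonneg (by positivity) (mul_nonneg (by linarith) (by positivity))

end

/-- Uniform domination of the resolvent against powers of the multiplier. -/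
theorem exists_pow_mul_resolv_le {c : ℂ} (hc : ‖c‖ = 1) {η : ℝ} (hη : 0 < η) :
    ∃ K, 0 ≤ K ∧ ∀ n : ℕ, 1 ≤ n → ∀ θ : ℝ, Real.cos θ ≠ 0 →
      ‖multSq (pt (radius η n) θ)‖ ^ n * ‖resolv c (pt (radius η n) θ)‖ ≤
        K + 4 * (Real.sqrt |Real.cos θ|)⁻¹ := by
  -- Near a genuine pole W the multiplier stays below some q < 1, while |Z - W| ≥ 1 - radius ≥ η
  -- e^{-η}/n; boundedness of n qⁿ absorbs the pole. At distance at least δ the principal part is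
  -- bounded outright.
  have hpole : ∃ K, 0 ≤ K ∧ ∀ n : ℕ, 1 ≤ n → ∀ θ : ℝ,
      ‖multSq (pt (radius η n) θ)‖ ^ n * ‖resid c / (1 - pt (radius η n) θ / poleAt c)‖ ≤ K := by
    rcases resid_eq_zero_or hc with h0 | ⟨h1, h2⟩
    · exact ⟨0, le_rfl, fun n _ θ => by rw [h0]; simp⟩
    have hW := norm_poleAt hc
    have hlt := norm_multSq_poleAt_lt_one hc h1 h2
    obtain ⟨q, hq1, hq2⟩ := exists_between hlt
    have hq0 : 0 ≤ q := (norm_nonneg _).trans hq1.le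
    have hcont := (continuousAt_multSq hW.le (one_add_poleAt_sq_ne_zero hc h1 h2) (poleAt_ne_zero hc)).norm
    obtain ⟨δ, hδ, hball⟩ := Metric.eventually_nhds_iff.1 (hcont.eventually_lt_const hq1)
    obtain ⟨M, hM⟩ := (tendsto_self_mul_const_pow_of_lt_one hq0 hq2).bddAbove_range
    have hM' : ∀ n : ℕ, (n : ℝ) * q ^ n ≤ M := fun n => hM ⟨n, rfl⟩
    have hM0 : 0 ≤ M := by simpa using hM' 0
    refine ⟨‖resid c‖ * (δ⁻¹ + M * (Real.exp η / η)), by positivity, fun n hn θ => ?_⟩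
    have hr0 := radius_pos η n
    have hr1 := radius_lt_one hη hn
    have hn0 : (0 : ℝ) < n := by exact_mod_cast hn
    have hZ : ‖pt (radius η n) θ‖ = radius η n := norm_pt hr0.le θ
    set Z := pt (radius η n) θ
    rw [norm_div, norm_one_sub_div_poleAt hc]
    have hL : ‖multSq Z‖ ^ n ≤ 1 := pow_le_one₀ (norm_nonneg _) (norm_multSq_lt_one (by rw [hZ]; exact hr1)).le
    rw [show ‖multSq Z‖ ^ n * (‖resid c‖ / ‖poleAt c - Z‖) =
      ‖resid c‖ * (‖multSq Z‖ ^ n * ‖poleAt c - Z‖⁻¹) by ring]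
    gcongr
    by_cases hd : dist Z (poleAt c) < δ
    · have h3 := (hball hd).le
      have h4 : 1 - radius η n ≤ ‖poleAt c - Z‖ := by
        have := norm_sub_norm_le (poleAt c) Z
        rwa [hW, hZ] at this
      have h5 := one_sub_radius_ge hη hn
      have h6 : 0 < η / n * Real.exp (-η) := by positivity
      calc ‖multSq Z‖ ^ n * ‖poleAt c - Z‖⁻¹ ≤ q ^ n * (η / n * Real.exp (-η))⁻¹ := by
            gcongr; exact h5.trans h4
        _ = n * q ^ n * (Real.exp η / η) := by rw [Real.exp_neg]; field_simp
        _ ≤ M * (Real.exp η / η) := by gcongr; exact hM' n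
        _ ≤ _ := le_add_of_nonneg_left (by positivity)
    · rw [not_lt, dist_comm, dist_eq_norm] at hd
      calc ‖multSq Z‖ ^ n * ‖poleAt c - Z‖⁻¹ ≤ 1 * δ⁻¹ := by gcongr
        _ ≤ _ := by rw [one_mul]; exact le_add_of_nonneg_right (by positivity)
  obtain ⟨K, hK0, hK⟩ := hpole
  refine ⟨2 + K, by positivity, fun n hn θ hθ => ?_⟩
  have hr0 := radius_pos η n
  have hr1 := radius_lt_one hη hn
  have h1 := hK n hn θ
  have hZ : ‖pt (radius η n) θ‖ < 1 := by rw [norm_pt hr0.le]; exact hr1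
  have hs := inv_norm_branchRoot_pt_le hr0.le hθ
  set Z := pt (radius η n) θ
  have h2 := norm_remainder_le hc hZ.le
    (fun h => by rw [h, norm_poleAt hc] at hZ; exact lt_irrefl _ hZ) (one_add_sq_ne_zero hZ)
  have hL : ‖multSq Z‖ ^ n ≤ 1 := pow_le_one₀ (norm_nonneg _) (norm_multSq_lt_one hZ).le
  have h3 : resolv c Z = remainder c Z + resid c / (1 - Z / poleAt c) := by
    unfold remainder; ring
  calc ‖multSq Z‖ ^ n * ‖resolv c Z‖
      ≤ ‖multSq Z‖ ^ n * (‖remainder c Z‖ + ‖resid c / (1 - Z / poleAt c)‖) := by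
        rw [h3]; gcongr; exact norm_add_le _ _
    _ = ‖multSq Z‖ ^ n * ‖remainder c Z‖ + ‖multSq Z‖ ^ n * ‖resid c / (1 - Z / poleAt c)‖ := by ring
    _ ≤ 1 * (2 * (1 + 2 * ‖branchRoot Z‖⁻¹)) + K := by
        refine add_le_add ?_ h1
        gcongr
        rwa [← div_eq_mul_inv]
    _ ≤ _ := by linarith

/-! ### Boundary values on the unit circle and Laplace asymptotics. -/

theorem re_eq_zero_of_sq {w : ℂ} {r : ℝ} (h : w ^ 2 = r) (hr : r ≤ 0) : w.re = 0 := by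
  have h1 := congrArg Complex.re h
  have h2 := congrArg Complex.im h
  rw [sq, Complex.mul_re, Complex.ofReal_re] at h1
  rw [sq, Complex.mul_im, Complex.ofReal_im] at h2
  have h3 : w.re * w.im = 0 := by linarith
  rcases mul_eq_zero.1 h3 with h4 | h4
  · exact h4
  · rw [h4] at h1
    have : w.re * w.re = 0 := le_antisymm (by linarith) (mul_self_nonneg _)
    exact mul_self_eq_zero.1 this

theorem re_ne_zero_of_sq {w : ℂ} {r : ℝ} (h : w ^ 2 = r) (hr : 0 < r) : w.re ≠ 0 := by
  intro h0
  have h1 := congrArg Complex.re h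
  rw [sq, Complex.mul_re, Complex.ofReal_re, h0] at h1
  nlinarith [mul_self_nonneg w.im]

theorem norm_sub_eq_norm_add {a b : ℂ} (h : (a * conj b).re = 0) : ‖a - b‖ = ‖a + b‖ := by
  have h1 := norm_sub_le_norm_add h.ge
  have h2 := norm_sub_le_norm_add (a := a) (b := -b) (by simp only [map_neg, mul_neg, Complex.neg_re]; linarith)
  rw [sub_neg_eq_add, ← sub_eq_add_neg] at h2
  exact le_antisymm h1 h2

section Circle
variable (θ : ℝ)

theorem norm_pt_one : ‖pt 1 θ‖ = 1 := norm_pt zero_le_one θ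

theorem pt_one_ne_zero : pt 1 θ ≠ 0 := ne_zero_of_norm_one (norm_pt_one θ)

theorem pt_one_mul_conj : pt 1 θ * conj (pt 1 θ) = 1 := mul_conj_of_norm_one (norm_pt_one θ)

theorem pt_one_re : (pt 1 θ).re = Real.cos θ := by
  rw [pt, Complex.ofReal_one, one_mul, Complex.exp_ofReal_mul_I_re]

theorem pt_one_add_conj : pt 1 θ + conj (pt 1 θ) = (2 * Real.cos θ : ℝ) := by
  rw [Complex.add_conj, pt_one_re]

theorem one_add_pt_sq : 1 + pt 1 θ ^ 2 = (2 * Real.cos θ : ℝ) * pt 1 θ := by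
  rw [← pt_one_add_conj]; linear_combination -pt_one_mul_conj θ

theorem conj_branchRoot_sq (Z : ℂ) : conj (branchRoot Z) ^ 2 = 1 + conj Z ^ 2 := by
  rw [← map_pow, branchRoot_sq]; simp

/-- On the circle this square is real, with sign opposite to cos θ away from Z = 1. So the product
is imaginary on the right arc, where both multipliers have modulus one, and real on the left arc,
where one strictly decays. -/
theorem one_sub_mul_conj_branchRoot_sq : ((1 - pt 1 θ) * conj (branchRoot (pt 1 θ))) ^ 2 =
    ((4 * Real.cos θ * (Real.cos θ - 1) : ℝ) : ℂ) := by
  have h1 := pt_one_mul_conj θ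
  have h2 := pt_one_add_conj θ
  rw [mul_pow, conj_branchRoot_sq]
  push_cast at *
  linear_combination (pt 1 θ * conj (pt 1 θ) - 2 * conj (pt 1 θ) - 1 ) * h1 +
    (pt 1 θ + conj (pt 1 θ) + 2 * Complex.cos θ - 2) * h2

theorem one_add_mul_conj_branchRoot_sq : ((1 + pt 1 θ) * conj (branchRoot (pt 1 θ))) ^ 2 =
    ((4 * Real.cos θ * (Real.cos θ + 1) : ℝ) : ℂ) := by
  have h1 := pt_one_mul_conj θ
  have h2 := pt_one_add_conj θ
  rw [mul_pow, conj_branchRoot_sq]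
  push_cast at *
  linear_combination (pt 1 θ * conj (pt 1 θ) + 2 * conj (pt 1 θ) - 1) * h1 +
    (pt 1 θ + conj (pt 1 θ) + 2 * Complex.cos θ + 2) * h2

variable {θ}

theorem one_add_pt_one_sq_ne_zero (hθ : Real.cos θ ≠ 0) : 1 + pt 1 θ ^ 2 ≠ 0 := by
  rw [one_add_pt_sq]
  exact mul_ne_zero (by exact_mod_cast mul_ne_zero two_ne_zero hθ) (pt_one_ne_zero θ)

theorem norm_multSq_pt_one : ‖multSq (pt 1 θ)‖ = ‖1 - pt 1 θ - branchRoot (pt 1 θ)‖ ^ 2 / 2 := by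
  rw [multSq, norm_div, norm_mul, norm_pt_one, norm_pow]; simp

theorem norm_multSq_eq_one (hθ : 0 < Real.cos θ) : ‖multSq (pt 1 θ)‖ = 1 := by
  have h := norm_sub_eq_norm_add (re_eq_zero_of_sq (one_sub_mul_conj_branchRoot_sq θ)
    (by nlinarith [Real.cos_le_one θ]))
  have h1 := norm_sq_mul_sq_eq (pt 1 θ)
  rw [← h, norm_pt_one] at h1
  rw [norm_multSq_pt_one, sq, h1]; norm_num

theorem norm_multSq_pt_lt_one (hθ : Real.cos θ < 0) : ‖multSq (pt 1 θ)‖ < 1 := by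
  have h0 := one_add_pt_one_sq_ne_zero hθ.ne
  have h2 := re_one_sub_mul_conj_branchRoot_nonneg (norm_pt_one θ).le h0
  have h3 := re_ne_zero_of_sq (one_sub_mul_conj_branchRoot_sq θ) (by nlinarith)
  have h := norm_sub_lt_norm_add (lt_of_le_of_ne h2 h3.symm)
  have h1 := norm_sq_mul_sq_eq (pt 1 θ)
  rw [norm_pt_one] at h1
  rw [norm_multSq_pt_one, div_lt_one two_pos]
  nlinarith [norm_nonneg (1 - pt 1 θ - branchRoot (pt 1 θ))]

/-- Total reflection on the left arc: no flux is transmitted there and the energy density vanishes.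
-/
theorem norm_refl_pt_eq_one (hθ : Real.cos θ < 0) : ‖refl (pt 1 θ)‖ = 1 := by
  have h := norm_sub_eq_norm_add (re_eq_zero_of_sq (one_add_mul_conj_branchRoot_sq θ)
    (by nlinarith [Real.neg_one_le_cos θ]))
  have h1 := congrArg norm (refl_mul_reflConj (pt 1 θ))
  have h2 : ‖refl (pt 1 θ)‖ = ‖reflConj (pt 1 θ)‖ := by
    unfold refl reflConj
    rw [norm_div, norm_div, h]
  rw [norm_mul, ← h2, norm_pt_one] at h1
  nlinarith [norm_nonneg (refl (pt 1 θ))]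

end Circle

theorem tendsto_pt_radius (η θ : ℝ) : Tendsto (fun n => pt (radius η n) θ) atTop (𝓝 (pt 1 θ)) := by
  unfold pt
  exact ((Complex.continuous_ofReal.tendsto _).comp (tendsto_radius η)).mul_const _

/-- On the right arc the multiplier has modulus one, so its value at radius e^{-η/n}, divided by the
boundary value, is 1 + δₙ with n δₙ → -η (1 + Z)/s, read off from the logarithmic derivative. -/
theorem tendsto_norm_multSq_pow {η θ : ℝ} (hη : 0 < η) (hθ : 0 < Real.cos θ) :
    Tendsto (fun n : ℕ => ‖multSq (pt (radius η n) θ)‖ ^ n) atTop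
      (𝓝 (Real.exp (-(η * ((1 + pt 1 θ) / branchRoot (pt 1 θ)).re)))) := by
  set Z := pt 1 θ with hZ
  have hZ1 := norm_pt_one θ
  have hb := one_add_pt_one_sq_ne_zero hθ.ne'
  have hd := hasDerivAt_multSq hZ1.le hb (pt_one_ne_zero θ)
  have hL : multSq Z ≠ 0 := by rw [← norm_pos_iff, norm_multSq_eq_one hθ]; exact one_pos
  have hg : HasDerivAt (fun x : ℝ => multSq (pt (Real.exp (-x)) θ))
      (multSq Z * (1 + Z) / (branchRoot Z * Z) * -Z) 0 := by
    have h1 : HasDerivAt (fun x : ℝ => pt (Real.exp (-x)) θ) (-Z) 0 := by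
      have h2 : HasDerivAt (fun x : ℝ => ((Real.exp (-x) : ℝ) : ℂ)) ((-1 : ℝ) : ℂ) 0 := by
        have h3 : HasDerivAt (fun x : ℝ => Real.exp (-x)) (-1) 0 := by
          have := (hasDerivAt_neg (0 : ℝ)).exp
          simpa using this
        exact h3.ofReal_comp
      have h3 := h2.mul_const (Complex.exp (θ * Complex.I))
      have e : -Z = ((-1 : ℝ) : ℂ) * Complex.exp (θ * Complex.I) := by
        rw [hZ, pt]; push_cast; ring
      rw [e]
      exact h3
    have h0 : pt (Real.exp (-0)) θ = Z := by rw [neg_zero, Real.exp_zero]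
    have hd' : HasDerivAt multSq (multSq Z * (1 + Z) / (branchRoot Z * Z)) (pt (Real.exp (-0)) θ) := by
      rw [h0]; exact hd
    exact hd'.comp (0 : ℝ) h1
  have hslope := (hasDerivAt_iff_tendsto_slope_zero.1 hg)
  have hseq : Tendsto (fun n : ℕ => η / (n : ℝ)) atTop (𝓝[≠] 0) := by
    rw [tendsto_nhdsWithin_iff]
    refine ⟨(tendsto_const_nhds (x := η)).div_atTop tendsto_natCast_atTop_atTop, ?_⟩
    filter_upwards [eventually_ge_atTop 1] with n hn
    have : (0 : ℝ) < n := by exact_mod_cast hn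
    exact (div_pos hη this).ne'
  have h1 := (hslope.comp hseq).const_mul ((η : ℂ) / multSq Z)
  have h2 : Tendsto (fun n : ℕ => (n : ℂ) * (multSq (pt (radius η n) θ) / multSq Z - 1)) atTop
      (𝓝 (-(η * ((1 + Z) / branchRoot Z)))) := by
    have hb0 := branchRoot_ne_zero hb
    have hZ0 := pt_one_ne_zero θ
    have e : (η : ℂ) / multSq Z * (multSq Z * (1 + Z) / (branchRoot Z * Z) * -Z) =
        -(η * ((1 + Z) / branchRoot Z)) := by
      rw [← hZ] at hZ0
      field_simp
    rw [e] at h1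
    refine h1.congr' ?_
    filter_upwards [eventually_ge_atTop 1] with n hn
    have hn0 : (n : ℂ) ≠ 0 := by exact_mod_cast (by omega : n ≠ 0)
    have hη0 : (η : ℂ) ≠ 0 := by exact_mod_cast hη.ne'
    simp only [Function.comp, zero_add, neg_zero, Real.exp_zero, Complex.real_smul]
    rw [← hZ]
    unfold radius
    push_cast
    field_simp
  have h3 := (Complex.tendsto_one_add_pow_exp_of_tendsto h2).norm
  rw [Complex.norm_exp, Complex.neg_re, Complex.re_ofReal_mul] at h3
  refine h3.congr fun n => ?_
  rw [add_sub_cancel, norm_pow, norm_div, norm_multSq_eq_one hθ, div_one]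

/-- The flux density on the unit circle, without the multiplier. -/
noncomputable def bandDensity (σp σm : ℝ) (α β : ℂ) (Z : ℂ) : ℝ :=
  (1 - ‖refl Z‖ ^ 2) * ‖originLower σp σm α β Z‖ ^ 2

open Classical in
theorem tendsto_fluxDensity (σp σm : ℝ) (α β : ℂ) {η θ : ℝ} (hη : 0 < η) (hθ : Real.cos θ ≠ 0)
    (h1 : pt 1 θ ≠ poleAt (phase σp σm)) (h2 : pt 1 θ ≠ poleAt (-phase σp σm)) :
    Tendsto (fun n : ℕ => fluxDensity σp σm α β n (pt (radius η n) θ)) atTop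
      (𝓝 (if 0 < Real.cos θ then
        Real.exp (-(η * ((1 + pt 1 θ) / branchRoot (pt 1 θ)).re)) * bandDensity σp σm α β (pt 1 θ)
        else 0)) := by
  have hb := one_add_pt_one_sq_ne_zero hθ
  have hZ1 := norm_pt_one θ
  have hc := norm_phase σp σm
  have hc' : ‖-phase σp σm‖ = 1 := by rw [norm_neg, hc]
  have hZ := tendsto_pt_radius η θ
  have hf : Tendsto (fun n : ℕ => (‖pt (radius η n) θ‖ - ‖refl (pt (radius η n) θ)‖ ^ 2) *
      ‖originLower σp σm α β (pt (radius η n) θ)‖ ^ 2) atTop (𝓝 (bandDensity σp σm α β (pt 1 θ))) := by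
    have t1 := hZ.norm
    have t2 := ((continuousAt_refl hZ1.le hb).tendsto.comp hZ).norm
    have t3 := ((continuousAt_originLower σp σm α β hZ1.le hb (one_sub_refl_ne_zero_of_ne hc h1)
      (one_sub_refl_ne_zero_of_ne hc' h2)).tendsto.comp hZ).norm
    have := (t1.sub (t2.pow 2)).mul (t3.pow 2)
    rw [hZ1] at this
    exact this
  unfold fluxDensity
  split_ifs with h
  · exact (tendsto_norm_multSq_pow hη h).mul hf
  · have hneg : Real.cos θ < 0 := lt_of_le_of_ne (not_lt.1 h) hθ
    have t1 := ((continuousAt_multSq hZ1.le hb (pt_one_ne_zero θ)).tendsto.comp hZ).norm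
    -- On the left arc the multiplier is eventually below a fixed q < 1, so its n-th power vanishes
    -- in the limit.
    obtain ⟨q, hq1, hq2⟩ := exists_between (norm_multSq_pt_lt_one hneg)
    have hq0 : 0 ≤ q := (norm_nonneg _).trans hq1.le
    have t2 : Tendsto (fun n : ℕ => ‖multSq (pt (radius η n) θ)‖ ^ n) atTop (𝓝 0) := by
      refine squeeze_zero' (Eventually.of_forall fun n => by positivity) ?_
        (tendsto_pow_atTop_nhds_zero_of_lt_one hq0 hq2)
      filter_upwards [t1.eventually_lt_const hq1] with n hn
      exact pow_le_pow_left₀ (norm_nonneg _) hn.le n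
    have := t2.mul hf
    rwa [zero_mul] at this

theorem ae_pt_ne (W : ℂ) : ∀ᵐ θ : ℝ, pt 1 θ ≠ W := by
  have : {θ : ℝ | pt 1 θ = W}.Countable := by
    by_cases hW : ∃ θ₀, pt 1 θ₀ = W
    · obtain ⟨θ₀, rfl⟩ := hW
      have h : {θ : ℝ | pt 1 θ = pt 1 θ₀} ⊆ Set.range fun k : ℤ => θ₀ + k * (2 * Real.pi) := by
        intro θ hθ
        have h1 : Complex.exp (θ * Complex.I) = Complex.exp (θ₀ * Complex.I) := by
          simpa [pt] using hθ
        obtain ⟨k, hk⟩ := Complex.exp_eq_exp_iff_exists_int.1 h1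
        refine ⟨k, ?_⟩
        have h2 : ((θ : ℝ) : ℂ) = ((θ₀ + k * (2 * Real.pi) : ℝ) : ℂ) := by
          apply mul_right_cancel₀ Complex.I_ne_zero
          rw [hk]; push_cast; ring
        exact (Complex.ofReal_injective h2).symm
      exact (Set.countable_range _).mono h
    · have : {θ : ℝ | pt 1 θ = W} = ∅ := by
        ext θ; simp only [Set.mem_ofPred_eq, Set.mem_empty_iff_false, iff_false]
        exact fun h => hW ⟨θ, h⟩
      rw [this]; exact Set.countable_empty
  have h0 := this.measure_zero volume
  rw [ae_iff]
  simpa using h0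

/-- Laplace asymptotics of the flux. -/
theorem tendsto_circleMean_fluxDensity {σp σm : ℝ} {α β : ℂ} (h : ‖α‖ ^ 2 + ‖β‖ ^ 2 = 1) {η : ℝ}
    (hη : 0 < η) :
    Tendsto (fun n : ℕ => circleMean fun θ => fluxDensity σp σm α β n (pt (radius η n) θ)) atTop
      (𝓝 ((2 * Real.pi)⁻¹ * ∫ θ in (-(Real.pi / 2))..(Real.pi / 2),
        Real.exp (-(η * ((1 + pt 1 θ) / branchRoot (pt 1 θ)).re)) *
          bandDensity σp σm α β (pt 1 θ))) := by
  classical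
  have hc := norm_sgn_phase σp σm
  choose K hK0 hK using fun s => exists_pow_mul_resolv_le (hc s) hη
  have hpi := Real.pi_pos
  have main := intervalIntegral.tendsto_integral_filter_of_dominated_convergence (μ := volume)
    (a := -Real.pi) (b := Real.pi) (l := atTop)
    (F := fun (n : ℕ) θ => fluxDensity σp σm α β n (pt (radius η n) θ))
    (f := fun θ => if 0 < Real.cos θ then
        Real.exp (-(η * ((1 + pt 1 θ) / branchRoot (pt 1 θ)).re)) * bandDensity σp σm α β (pt 1 θ)
        else 0)
    (fun θ => ∑ s, 2 * (K s + 4 * (Real.sqrt |Real.cos θ|)⁻¹)) ?_ ?_ ?_ ?_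
  · have e : ∫ θ in (-Real.pi)..Real.pi, (if 0 < Real.cos θ then
        Real.exp (-(η * ((1 + pt 1 θ) / branchRoot (pt 1 θ)).re)) * bandDensity σp σm α β (pt 1 θ)
        else 0) = ∫ θ in (-(Real.pi / 2))..(Real.pi / 2),
        Real.exp (-(η * ((1 + pt 1 θ) / branchRoot (pt 1 θ)).re)) * bandDensity σp σm α β (pt 1 θ) := by
      rw [intervalIntegral.integral_of_le (by linarith), intervalIntegral.integral_of_le (by linarith),
        integral_Ioc_eq_integral_Ioo, integral_Ioc_eq_integral_Ioo,
        ← integral_indicator measurableSet_Ioo, ← integral_indicator measurableSet_Ioo]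
      congr 1
      ext θ
      by_cases h1 : θ ∈ Set.Ioo (-(Real.pi / 2)) (Real.pi / 2)
      · rw [Set.indicator_of_mem h1, Set.indicator_of_mem (show θ ∈ Set.Ioo (-Real.pi) Real.pi from
          ⟨by linarith [h1.1], by linarith [h1.2]⟩),
          if_pos (Real.cos_pos_of_mem_Ioo h1)]
      · rw [Set.indicator_of_notMem h1]
        by_cases h2 : θ ∈ Set.Ioo (-Real.pi) Real.pi
        · rw [Set.indicator_of_mem h2, if_neg]
          rw [not_lt]
          rcases le_or_gt (Real.pi / 2) θ with h3 | h3
          · exact Real.cos_nonpos_of_pi_div_two_le_of_le h3 (by linarith [h2.2])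
          · rw [← Real.cos_neg]
            refine Real.cos_nonpos_of_pi_div_two_le_of_le ?_ (by linarith [h2.1])
            by_contra h4
            exact h1 ⟨by linarith, h3⟩
        · rw [Set.indicator_of_notMem h2]
    rw [← e]
    unfold circleMean
    simp only [smul_eq_mul]
    exact main.const_mul _
  · filter_upwards [eventually_ge_atTop 1] with n hn
    exact (continuous_fluxDensity_pt σp σm α β n (radius_pos η n)
      (radius_lt_one hη hn)).aestronglyMeasurable
  · filter_upwards [eventually_ge_atTop 1] with n hn
    filter_upwards [ae_cos_ne_zero] with θ hθ _
    have hZ : ‖pt (radius η n) θ‖ < 1 := by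
      rw [norm_pt (radius_pos η n).le]; exact radius_lt_one hη hn
    rw [Real.norm_of_nonneg (fluxDensity_nonneg hZ n)]
    refine (fluxDensity_le h hZ n).trans (Finset.sum_le_sum fun s _ => ?_)
    have := hK s n hn θ hθ
    gcongr
  · have : ∀ s ∈ (Finset.univ : Finset Bool), IntervalIntegrable
        (fun θ => 2 * (K s + 4 * (Real.sqrt |Real.cos θ|)⁻¹)) volume (-Real.pi) Real.pi := fun s _ =>
      ((_root_.intervalIntegrable_const).add
        ((intervalIntegrable_inv_sqrt_abs_cos _ _).const_mul 4)).const_mul 2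
    have := IntervalIntegrable.sum _ this
    have e : (fun θ => ∑ s, 2 * (K s + 4 * (Real.sqrt |Real.cos θ|)⁻¹)) =
        ∑ s : Bool, fun θ => 2 * (K s + 4 * (Real.sqrt |Real.cos θ|)⁻¹) := by
      funext θ; rw [Finset.sum_apply]
    rw [e]
    exact this
  · filter_upwards [ae_cos_ne_zero, ae_pt_ne (poleAt (phase σp σm)),
      ae_pt_ne (poleAt (-phase σp σm))] with θ h1 h2 h3 _
    exact tendsto_fluxDensity σp σm α β hη h1 h2 h3

/-! ### Total energy by the mean value property. -/

theorem measurable_branchRoot : Measurable branchRoot := by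
  unfold branchRoot Complex.sqrt
  fun_prop

theorem measurable_refl : Measurable refl := by
  have := measurable_branchRoot
  unfold refl
  fun_prop

theorem measurable_resolv (c : ℂ) : Measurable (resolv c) := by
  have := measurable_refl
  unfold resolv
  fun_prop

theorem measurable_bandDensity (σp σm : ℝ) (α β : ℂ) : Measurable (bandDensity σp σm α β) := by
  have := measurable_refl
  have h1 := measurable_resolv (phase σp σm)
  have h2 := measurable_resolv (-phase σp σm)
  unfold bandDensity originLower
  fun_prop

theorem measurable_pt (ϱ : ℝ) : Measurable (pt ϱ) := (continuous_pt ϱ).measurable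

theorem branchRoot_zero : branchRoot 0 = 1 := branchRoot_eq (by simp) (by simp)

theorem resolv_zero (c : ℂ) : resolv c 0 = 1 := by
  simp [resolv, refl, branchRoot_zero]

/-- The mean value property on a centred circle. -/
theorem circleMean_of_differentiable {f : ℂ → ℂ} (hf : ∀ Z : ℂ, ‖Z‖ < 1 → DifferentiableAt ℂ f Z)
    {ϱ : ℝ} (h0 : 0 < ϱ) (h1 : ϱ < 1) : circleMean (fun θ => f (pt ϱ θ)) = f 0 := by
  have hb : ∀ z ∈ Metric.closedBall (0 : ℂ) |ϱ|, ‖z‖ < 1 := fun z hz => by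
    rw [mem_closedBall_zero_iff, abs_of_pos h0] at hz
    exact hz.trans_lt h1
  rw [← circleAverage_of_differentiable_on_off_countable (R := ϱ) (c := (0 : ℂ)) (f := f)
    Set.countable_empty (fun z hz => (hf z (hb z hz)).continuousAt.continuousWithinAt)
    (fun z hz => hf z (hb z (Metric.ball_subset_closedBall hz.1)))]
  have hp : Function.Periodic (fun θ => f (pt ϱ θ)) (2 * Real.pi) := by
    intro θ
    simp only [pt]
    push_cast
    rw [add_mul, Complex.exp_add, Complex.exp_two_pi_mul_I, mul_one]
  have h3 := hp.intervalIntegral_add_eq (-Real.pi) 0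
  rw [show -Real.pi + 2 * Real.pi = Real.pi by ring, zero_add] at h3
  rw [circleMean, Real.circleAverage_def, h3]
  simp only [circleMap_zero, pt]

theorem differentiableAt_remainder {c : ℂ} (hc : ‖c‖ = 1) {Z : ℂ} (hZ : ‖Z‖ ≤ 1) (hb : 1 + Z ^ 2 ≠ 0)
    (h : Z ≠ poleAt c) : DifferentiableAt ℂ (remainder c) Z := by
  have h1 := (hasDerivAt_branchRoot hZ hb).differentiableAt
  have h2 := one_sub_refl_ne_zero_of_ne hc h
  have h3 := one_sub_div_ne_zero hc (poleAt_ne_zero hc) h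
  have h4 : DifferentiableAt ℂ refl Z := by unfold refl; fun_prop
  unfold remainder resolv
  fun_prop (disch := assumption)

/-- The remainder is holomorphic in the open disc; at the centre the resolvent is 1 and its
principal part is `resid c`. -/
theorem circleMean_remainder {c : ℂ} (hc : ‖c‖ = 1) {ϱ : ℝ} (h0 : 0 < ϱ) (h1 : ϱ < 1) :
    circleMean (fun θ => remainder c (pt ϱ θ)) = 1 - resid c := by
  rw [circleMean_of_differentiable (fun Z hZ => differentiableAt_remainder hc hZ.le
    (one_add_sq_ne_zero hZ) (fun h => by
      rw [h, norm_poleAt hc] at hZ; exact lt_irrefl _ hZ)) h0 h1]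
  simp [remainder, resolv_zero]

theorem re_one_div_one_sub {w : ℂ} (hw : ‖w‖ = 1) (h : 1 - w ≠ 0) : (1 / (1 - w)).re = 1 / 2 := by
  have h1 : conj w = 1 / w := by
    rw [one_div, inv_eq_conj_of_norm_one hw]
  have h2 := ne_zero_of_norm_one hw
  have h3 : conj (1 / (1 - w)) = 1 - 1 / (1 - w) := by
    rw [map_div₀, map_sub, map_one, h1]
    have h4 : w - 1 ≠ 0 := fun h5 => h (by linear_combination -h5)
    have h6 : 1 - 1 / w = (w - 1) / w := by field_simp
    rw [h6]
    field_simp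
    ring
  have h4 := congrArg Complex.re h3
  rw [Complex.conj_re, Complex.sub_re, Complex.one_re] at h4
  linarith

theorem resid_im {c : ℂ} (hc : ‖c‖ = 1) : (resid c).im = 0 := by
  rcases resid_cases hc with h | h
  · rw [h.2.2, Complex.ofReal_im]
  · rw [h.2, Complex.zero_im]

section
variable {c : ℂ} (hc : ‖c‖ = 1)
include hc

theorem norm_remainder_pt_le {ϱ θ : ℝ} (h0 : 0 ≤ ϱ) (h1 : ϱ ≤ 1) (h : pt ϱ θ ≠ poleAt c)
    (hb : 1 + pt ϱ θ ^ 2 ≠ 0) (hθ : Real.cos θ ≠ 0) :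
    ‖remainder c (pt ϱ θ)‖ ≤ 2 + 4 * (Real.sqrt |Real.cos θ|)⁻¹ := by
  have h2 := norm_remainder_le hc (by rw [norm_pt h0]; exact h1) h hb
  have h3 := inv_norm_branchRoot_pt_le h0 hθ
  rw [div_eq_mul_inv] at h2
  linarith

theorem intervalIntegrable_remainder :
    IntervalIntegrable (fun θ => remainder c (pt 1 θ)) volume (-Real.pi) Real.pi := by
  have hg : IntervalIntegrable (fun θ => 2 + 4 * (Real.sqrt |Real.cos θ|)⁻¹) volume (-Real.pi) Real.pi :=
    intervalIntegrable_const.add ((intervalIntegrable_inv_sqrt_abs_cos _ _).const_mul 4)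
  refine hg.mono_fun' ?_ ?_
  · have := measurable_resolv c
    have h2 := measurable_pt 1
    unfold remainder
    exact Measurable.aestronglyMeasurable (by fun_prop)
  · refine ae_restrict_of_ae ?_
    filter_upwards [ae_cos_ne_zero, ae_pt_ne (poleAt c)] with θ h1 h2
    exact norm_remainder_pt_le hc zero_le_one le_rfl h2 (one_add_pt_one_sq_ne_zero h1) h1

theorem circleMean_remainder_one : circleMean (fun θ => remainder c (pt 1 θ)) = 1 - resid c := by
  have main := intervalIntegral.tendsto_integral_filter_of_dominated_convergence (μ := volume)
    (a := -Real.pi) (b := Real.pi) (l := atTop)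
    (F := fun (n : ℕ) θ => remainder c (pt (radius 1 n) θ)) (f := fun θ => remainder c (pt 1 θ))
    (fun θ => 2 + 4 * (Real.sqrt |Real.cos θ|)⁻¹) ?_ ?_ ?_ ?_
  · have h := main.const_smul (2 * Real.pi)⁻¹
    refine tendsto_nhds_unique h (tendsto_const_nhds.congr' ?_)
    filter_upwards [eventually_ge_atTop 1] with n hn
    exact (circleMean_remainder hc (radius_pos 1 n) (radius_lt_one one_pos hn)).symm
  · refine Eventually.of_forall fun n => ?_
    have := measurable_resolv c
    have h2 := measurable_pt (radius 1 n)
    unfold remainder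
    exact Measurable.aestronglyMeasurable (by fun_prop)
  · filter_upwards [eventually_ge_atTop 1] with n hn
    filter_upwards [ae_cos_ne_zero] with θ hθ _
    have hr := radius_lt_one one_pos hn
    have hZ : ‖pt (radius 1 n) θ‖ < 1 := by rw [norm_pt (radius_pos 1 n).le]; exact hr
    exact norm_remainder_pt_le hc (radius_pos 1 n).le hr.le
      (fun h => by rw [h, norm_poleAt hc] at hZ; exact lt_irrefl _ hZ) (one_add_sq_ne_zero hZ) hθ
  · exact intervalIntegrable_const.add ((intervalIntegrable_inv_sqrt_abs_cos _ _).const_mul 4)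
  · filter_upwards [ae_cos_ne_zero, ae_pt_ne (poleAt c)] with θ h1 h2 _
    exact ((differentiableAt_remainder hc (norm_pt_one θ).le (one_add_pt_one_sq_ne_zero h1)
      h2).continuousAt.tendsto).comp (tendsto_pt_radius 1 θ)

/-- On the circle Re 1/(1 - w) = 1/2, so the principal part retains only half of the residue it has
at the centre. The other half, lost in the passage to the boundary, is the bound-state mass. -/
theorem resolv_re_eq {θ : ℝ} (h : pt 1 θ ≠ poleAt c) :
    (resolv c (pt 1 θ)).re = (remainder c (pt 1 θ)).re + (resid c).re / 2 := by
  have h3 := one_sub_div_ne_zero hc (poleAt_ne_zero hc) h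
  have h4 := re_one_div_one_sub (by rw [norm_div, norm_pt_one, norm_poleAt hc, div_one]) h3
  have h5 : resolv c (pt 1 θ) = remainder c (pt 1 θ) +
      ((resid c).re : ℂ) * (1 / (1 - pt 1 θ / poleAt c)) := by
    have : ((resid c).re : ℂ) = resid c := Complex.ext (by simp) (by simp [resid_im hc])
    rw [this]
    unfold remainder; ring
  rw [h5, Complex.add_re, Complex.re_ofReal_mul, h4]
  ring

theorem intervalIntegrable_re_remainder :
    IntervalIntegrable (fun θ => (remainder c (pt 1 θ)).re) volume (-Real.pi) Real.pi :=
  ⟨(intervalIntegrable_remainder hc).1.re, (intervalIntegrable_remainder hc).2.re⟩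

theorem integral_re_remainder : ∫ θ in (-Real.pi)..Real.pi, (remainder c (pt 1 θ)).re =
    2 * Real.pi * (1 - (resid c).re) := by
  have h := congrArg Complex.re (circleMean_remainder_one hc)
  have hpi := Real.pi_pos
  rw [circleMean, Complex.smul_re, smul_eq_mul, intervalIntegral.integral_of_le (by linarith)] at h
  have h2 : (∫ θ in Set.Ioc (-Real.pi) Real.pi, remainder c (pt 1 θ)).re =
      ∫ θ in Set.Ioc (-Real.pi) Real.pi, (remainder c (pt 1 θ)).re :=
    (integral_re (intervalIntegrable_remainder hc).1).symm
  rw [h2, inv_mul_eq_iff_eq_mul₀ (by positivity)] at h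
  rw [intervalIntegral.integral_of_le (by linarith), h]
  simp

end

theorem resid_re_eq_boundMass (σp σm : ℝ) (s : Bool) :
    (resid (sgn s * phase σp σm)).re = 2 * boundMass σp σm s := by
  have hb := boundParam_eq σp σm s
  unfold boundMass
  rcases resid_cases (norm_sgn_phase σp σm s) with h | h
  · rw [if_pos (by linarith [h.2.1]), h.2.2, Complex.ofReal_re, hb]
    ring
  · rw [h.2]
    split_ifs with h1
    · have : boundParam σp σm s = -1 := by linarith [h.1]
      rw [this]; simp
    · simp

theorem sum_norm_modeCoeff_sq {σp σm : ℝ} {α β : ℂ} (h : ‖α‖ ^ 2 + ‖β‖ ^ 2 = 1) :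
    ∑ s, ‖modeCoeff σp σm α β s‖ ^ 2 = 2 := by
  have h1 := parallelogram_law_with_norm ℂ α ((phase σp σm)⁻¹ * Complex.exp (Complex.I * σp) * β)
  have h2 : ‖(phase σp σm)⁻¹ * Complex.exp (Complex.I * σp) * β‖ = ‖β‖ := by
    rw [norm_mul, norm_mul, norm_inv, norm_phase, norm_exp_I_mul_ofReal']; simp
  rw [h2] at h1
  rw [Fintype.sum_bool]
  simp only [modeCoeff, sgn, if_true, Bool.false_eq_true, if_false, one_mul, neg_one_mul, sub_neg_eq_add]
  nlinarith

section
variable {σp σm : ℝ} {α β : ℂ} (h : ‖α‖ ^ 2 + ‖β‖ ^ 2 = 1)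
include h

theorem energy_pt_ae : ∀ᵐ θ : ℝ, energy σp σm α β (pt 1 θ) =
    ∑ s, ‖modeCoeff σp σm α β s‖ ^ 2 *
      ((remainder (sgn s * phase σp σm) (pt 1 θ)).re + boundMass σp σm s) - 1 := by
  have hc := norm_phase σp σm
  have hc' : ‖-phase σp σm‖ = 1 := by rw [norm_neg, hc]
  filter_upwards [ae_pt_ne (poleAt (phase σp σm)), ae_pt_ne (poleAt (-phase σp σm))] with θ h1 h2
  have n2 := one_sub_refl_ne_zero_of_ne hc' h2
  rw [neg_mul, sub_neg_eq_add] at n2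
  rw [energy_eq h (one_sub_refl_ne_zero_of_ne hc h1) n2]
  congr 1
  refine Finset.sum_congr rfl fun s _ => ?_
  have h3 : pt 1 θ ≠ poleAt (sgn s * phase σp σm) := by
    cases s
    · simpa [sgn] using h2
    · simpa [sgn] using h1
  rw [resolv_re_eq (norm_sgn_phase σp σm s) h3, resid_re_eq_boundMass]
  ring

theorem intervalIntegrable_energy :
    IntervalIntegrable (fun θ => energy σp σm α β (pt 1 θ)) volume (-Real.pi) Real.pi := by
  have h1 : IntervalIntegrable (fun θ => ∑ s, ‖modeCoeff σp σm α β s‖ ^ 2 *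
      ((remainder (sgn s * phase σp σm) (pt 1 θ)).re + boundMass σp σm s) - 1) volume
      (-Real.pi) Real.pi := by
    simp only [Fintype.sum_bool]
    have := fun s => ((intervalIntegrable_re_remainder (norm_sgn_phase σp σm s)).add
      (intervalIntegrable_const (c := boundMass σp σm s))).const_mul (‖modeCoeff σp σm α β s‖ ^ 2)
    exact ((this true).add (this false)).sub intervalIntegrable_const
  refine h1.congr_ae (ae_restrict_of_ae ?_)
  filter_upwards [energy_pt_ae (σp := σp) (σm := σm) h] with θ hθ
  exact hθ.symm

theorem integral_energy : ∫ θ in (-Real.pi)..Real.pi, energy σp σm α β (pt 1 θ) =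
    2 * Real.pi * (1 - ∑ s, boundMass σp σm s * ‖modeCoeff σp σm α β s‖ ^ 2) := by
  have h2 := sum_norm_modeCoeff_sq (σp := σp) (σm := σm) h
  have hI := fun s => (intervalIntegrable_re_remainder (norm_sgn_phase σp σm s))
  have hJ := fun s => ((hI s).add
      (intervalIntegrable_const (c := boundMass σp σm s))).const_mul (‖modeCoeff σp σm α β s‖ ^ 2)
  rw [intervalIntegral.integral_congr_ae ((energy_pt_ae (σp := σp) (σm := σm) h).mono fun θ hθ _ => hθ)]
  rw [Fintype.sum_bool] at h2 ⊢
  simp only [Fintype.sum_bool]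
  rw [intervalIntegral.integral_sub ((hJ true).add (hJ false)) intervalIntegrable_const,
    intervalIntegral.integral_add (hJ true) (hJ false), intervalIntegral.integral_const_mul,
    intervalIntegral.integral_const_mul, intervalIntegral.integral_add (hI true) intervalIntegrable_const,
    intervalIntegral.integral_add (hI false) intervalIntegrable_const,
    integral_re_remainder (norm_sgn_phase σp σm true), integral_re_remainder (norm_sgn_phase σp σm false),
    resid_re_eq_boundMass, resid_re_eq_boundMass]
  simp only [intervalIntegral.integral_const, smul_eq_mul]
  linear_combination 2 * Real.pi * h2

/-- Outside the band reflection is total, so the left arc carries no energy and the integral over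
the right arc is the whole. -/
theorem integral_band_energy :
    ∫ θ in (-(Real.pi / 2))..(Real.pi / 2), energy σp σm α β (pt 1 θ) =
      2 * Real.pi * (1 - ∑ s, boundMass σp σm s * ‖modeCoeff σp σm α β s‖ ^ 2) := by
  have hpi := Real.pi_pos
  have hi := intervalIntegrable_energy (σp := σp) (σm := σm) h
  rw [← integral_energy h]
  have hz : ∀ a b, a ∈ Set.Icc (-Real.pi) Real.pi → b ∈ Set.Icc (-Real.pi) Real.pi →
      (∀ θ ∈ Set.uIoc a b, Real.cos θ ≤ 0) → ∫ θ in a..b, energy σp σm α β (pt 1 θ) = 0 := by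
    intro a b _ _ hcos
    rw [← intervalIntegral.integral_zero (a := a) (b := b) (μ := volume)]
    refine intervalIntegral.integral_congr_ae ?_
    filter_upwards [ae_cos_ne_zero] with θ h1 h2
    have h3 := norm_refl_pt_eq_one (lt_of_le_of_ne (hcos θ h2) h1)
    simp [energy, h3]
  have hsub : ∀ a b, a ∈ Set.Icc (-Real.pi) Real.pi → b ∈ Set.Icc (-Real.pi) Real.pi →
      IntervalIntegrable (fun θ => energy σp σm α β (pt 1 θ)) volume a b := by
    intro a b ha hb
    refine hi.mono_set ?_
    rw [Set.uIcc_of_le (show -Real.pi ≤ Real.pi by linarith)]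
    exact Set.uIcc_subset_Icc ha hb
  have m1 : -Real.pi ∈ Set.Icc (-Real.pi) Real.pi := ⟨le_rfl, by linarith⟩
  have m2 : -(Real.pi / 2) ∈ Set.Icc (-Real.pi) Real.pi := ⟨by linarith, by linarith⟩
  have m3 : Real.pi / 2 ∈ Set.Icc (-Real.pi) Real.pi := ⟨by linarith, by linarith⟩
  have m4 : Real.pi ∈ Set.Icc (-Real.pi) Real.pi := ⟨by linarith, le_rfl⟩
  rw [← intervalIntegral.integral_add_adjacent_intervals (hsub _ _ m1 m2) (hsub _ _ m2 m4),
    ← intervalIntegral.integral_add_adjacent_intervals (hsub _ _ m2 m3) (hsub _ _ m3 m4),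
    hz _ _ m1 m2, hz _ _ m3 m4, zero_add, add_zero]
  · intro θ hθ
    rw [Set.uIoc_of_le (by linarith)] at hθ
    exact Real.cos_nonpos_of_pi_div_two_le_of_le hθ.1.le (by linarith [hθ.2])
  · intro θ hθ
    rw [Set.uIoc_of_le (by linarith)] at hθ
    rw [← Real.cos_neg]
    exact Real.cos_nonpos_of_pi_div_two_le_of_le (by linarith [hθ.2]) (by linarith [hθ.1])

end

/-! ### Left and right fluxes, and the group velocity as coordinate. -/

theorem phase_reflect (σp σm : ℝ) : phase (Real.pi - σm) (Real.pi - σp) = phase σp σm := by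
  unfold phase
  congr 4
  ring

theorem originLower_reflect (σp σm : ℝ) (α β Z : ℂ) :
    originLower (Real.pi - σm) (Real.pi - σp) β α Z = originUpper σp σm α β Z := by
  have hc := phase_ne_zero σp σm
  have hc2 := phase_sq σp σm
  have h1 : Complex.exp (-(Complex.I * ((Real.pi - σm : ℝ) : ℂ))) = -Complex.exp (Complex.I * σm) := by
    rw [Complex.exp_neg, exp_I_pi_sub, Complex.exp_neg, ← neg_inv, inv_inv]
  have h2 : (phase σp σm)⁻¹ * Complex.exp (Complex.I * σp) =
      -(phase σp σm * Complex.exp (Complex.I * σm)) := by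
    rw [inv_mul_eq_iff_eq_mul₀ hc]
    have h3 : Complex.exp (-(Complex.I * σm)) * Complex.exp (Complex.I * σm) = 1 := by
      rw [← Complex.exp_add]; simp
    linear_combination (-Complex.exp (Complex.I * σp)) * h3 + Complex.exp (Complex.I * σm) * hc2
  unfold originLower originUpper
  rw [phase_reflect, h1, h2]
  ring

/-- The left flux is the right flux of the reflected walk, and together they exhaust the energy. -/
theorem bandDensity_add_bandDensity_reflect (σp σm : ℝ) (α β Z : ℂ) :
    bandDensity σp σm α β Z + bandDensity (Real.pi - σm) (Real.pi - σp) β α Z =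
      energy σp σm α β Z := by
  unfold bandDensity energy
  rw [originLower_reflect]
  ring

/-- The speeds of the two-phase walk lie in this interval, up to sign. -/
def speeds : Set ℝ := Set.Ioo 0 (1 / Real.sqrt 2)

/-- The angle on the unit circle with group velocity `v`. -/
noncomputable def ang (v : ℝ) : ℝ := Real.arccos (v ^ 2 / (1 - v ^ 2))

section
variable {v : ℝ} (hv : v ∈ speeds)
include hv

theorem two_mul_sq_lt_one : 2 * v ^ 2 < 1 := by
  have h1 := hv.2
  have h2 : 0 < Real.sqrt 2 := by positivity
  rw [lt_div_iff₀ h2] at h1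
  have h3 : (v * Real.sqrt 2) ^ 2 < 1 := by
    have := hv.1
    have h4 : 0 < v * Real.sqrt 2 := mul_pos hv.1 h2
    nlinarith
  rw [mul_pow, real_sqrtTwo_sq] at h3
  linarith

theorem sqrt_pos_of_mem : 0 < Real.sqrt (1 - 2 * v ^ 2) :=
  Real.sqrt_pos.2 (by linarith [two_mul_sq_lt_one hv])

theorem sq_sqrt_of_mem : Real.sqrt (1 - 2 * v ^ 2) ^ 2 = 1 - 2 * v ^ 2 :=
  Real.sq_sqrt (by linarith [two_mul_sq_lt_one hv])

theorem one_sub_sq_pos : 0 < 1 - v ^ 2 := by nlinarith [two_mul_sq_lt_one hv, sq_nonneg v]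

theorem ratio_lt_one : v ^ 2 / (1 - v ^ 2) < 1 := by
  rw [div_lt_one (one_sub_sq_pos hv)]; linarith [two_mul_sq_lt_one hv]

theorem ratio_pos : 0 < v ^ 2 / (1 - v ^ 2) := div_pos (pow_pos hv.1 2) (one_sub_sq_pos hv)

theorem cos_ang : Real.cos (ang v) = v ^ 2 / (1 - v ^ 2) :=
  Real.cos_arccos (by linarith [ratio_pos hv]) (ratio_lt_one hv).le

theorem sqrt_one_sub_ratio_sq :
    Real.sqrt (1 - (v ^ 2 / (1 - v ^ 2)) ^ 2) = Real.sqrt (1 - 2 * v ^ 2) / (1 - v ^ 2) := by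
  have h := one_sub_sq_pos hv
  have e : 1 - (v ^ 2 / (1 - v ^ 2)) ^ 2 = (1 - 2 * v ^ 2) / (1 - v ^ 2) ^ 2 := by
    field_simp; ring
  rw [e, Real.sqrt_div' _ (by positivity), Real.sqrt_sq h.le]

theorem sin_ang : Real.sin (ang v) = Real.sqrt (1 - 2 * v ^ 2) / (1 - v ^ 2) := by
  rw [ang, Real.sin_arccos, sqrt_one_sub_ratio_sq hv]

theorem ang_mem : ang v ∈ Set.Ioo 0 (Real.pi / 2) :=
  ⟨Real.arccos_pos.2 (ratio_lt_one hv), Real.arccos_lt_pi_div_two.2 (ratio_pos hv)⟩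

theorem hasDerivAt_ang :
    HasDerivAt ang (-(2 * v / ((1 - v ^ 2) * Real.sqrt (1 - 2 * v ^ 2)))) v := by
  have h := one_sub_sq_pos hv
  have hp := sqrt_pos_of_mem hv
  have h1 : HasDerivAt (fun x : ℝ => x ^ 2 / (1 - x ^ 2))
      ((2 * v * (1 - v ^ 2) - v ^ 2 * (-(2 * v))) / (1 - v ^ 2) ^ 2) v := by
    have h2 : HasDerivAt (fun x : ℝ => x ^ 2) (2 * v) v := by simpa using hasDerivAt_pow 2 v
    exact h2.div (h2.const_sub 1) h.ne'
  have h2 := (Real.hasDerivAt_arccos (x := v ^ 2 / (1 - v ^ 2)) (by linarith [ratio_pos hv])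
    (ratio_lt_one hv).ne).comp v h1
  refine (congrArg (fun d => HasDerivAt ang d v) ?_).mpr h2
  rw [sqrt_one_sub_ratio_sq hv]
  field_simp
  ring

end

theorem sign_sq {τ : ℝ} (hτ : τ = 1 ∨ τ = -1) : τ ^ 2 = 1 := by
  rcases hτ with rfl | rfl <;> norm_num

theorem injOn_ang : Set.InjOn ang speeds := by
  intro v hv w hw h
  have h1 := congrArg Real.cos h
  rw [cos_ang hv, cos_ang hw, div_eq_div_iff (one_sub_sq_pos hv).ne' (one_sub_sq_pos hw).ne'] at h1
  have h2 : v ^ 2 = w ^ 2 := by linarith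
  exact (pow_left_inj₀ hv.1.le hw.1.le (by norm_num)).1 h2

theorem image_ang : ang '' speeds = Set.Ioo 0 (Real.pi / 2) := by
  ext θ
  constructor
  · rintro ⟨v, hv, rfl⟩
    exact ang_mem hv
  · intro hθ
    have hc : 0 < Real.cos θ := Real.cos_pos_of_mem_Ioo ⟨by linarith [hθ.1, Real.pi_pos], hθ.2⟩
    have hc1 : Real.cos θ < 1 := by
      rw [← Real.cos_zero]
      exact Real.cos_lt_cos_of_nonneg_of_le_pi_div_two le_rfl hθ.2.le hθ.1
    have hs : Real.sqrt (Real.cos θ / (1 + Real.cos θ)) ^ 2 = Real.cos θ / (1 + Real.cos θ) :=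
      Real.sq_sqrt (by positivity)
    -- The solution v of cos θ = v²/(1 - v²).
    refine ⟨Real.sqrt (Real.cos θ / (1 + Real.cos θ)), ⟨Real.sqrt_pos.2 (by positivity), ?_⟩, ?_⟩
    · rw [Real.sqrt_lt' (by positivity), div_pow, one_pow, real_sqrtTwo_sq,
        div_lt_div_iff₀ (by positivity) two_pos]
      linarith
    · rw [ang, hs]
      have e : Real.cos θ / (1 + Real.cos θ) / (1 - Real.cos θ / (1 + Real.cos θ)) = Real.cos θ := by
        field_simp; ring
      rw [e, Real.arccos_cos hθ.1.le (by linarith [hθ.2, Real.pi_pos])]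

section
variable {v τ : ℝ} (hv : v ∈ speeds) (hτ : τ = 1 ∨ τ = -1)
include hv hτ

theorem pt_ang : pt 1 (τ * ang v) =
    ((v ^ 2 : ℝ) + (τ * Real.sqrt (1 - 2 * v ^ 2) : ℝ) * Complex.I) / ((1 - v ^ 2 : ℝ) : ℂ) := by
  have h1 : Real.cos (τ * ang v) = v ^ 2 / (1 - v ^ 2) := by
    rcases hτ with rfl | rfl
    · rw [one_mul, cos_ang hv]
    · rw [neg_one_mul, Real.cos_neg, cos_ang hv]
  have h2 : Real.sin (τ * ang v) = τ * (Real.sqrt (1 - 2 * v ^ 2) / (1 - v ^ 2)) := by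
    rcases hτ with rfl | rfl
    · rw [one_mul, one_mul, sin_ang hv]
    · rw [neg_one_mul, neg_one_mul, Real.sin_neg, sin_ang hv]
  rw [pt, Complex.exp_mul_I, ← Complex.ofReal_cos, ← Complex.ofReal_sin, h1, h2]
  push_cast
  ring

/-- In the coordinate v the square root becomes rational in v and √(1 - 2v²). The candidate has the
right square, and its real part v/(1 - v²) > 0 selects the principal branch. -/
theorem branchRoot_pt_ang : branchRoot (pt 1 (τ * ang v)) =
    (v : ℂ) * (1 + (τ * Real.sqrt (1 - 2 * v ^ 2) : ℝ) * Complex.I) / ((1 - v ^ 2 : ℝ) : ℂ) := by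
  have h0 := one_sub_sq_pos hv
  have h0' : ((1 - v ^ 2 : ℝ) : ℂ) ≠ 0 := by exact_mod_cast h0.ne'
  have hp : ((τ * Real.sqrt (1 - 2 * v ^ 2) : ℝ) : ℂ) ^ 2 = ((1 - 2 * v ^ 2 : ℝ) : ℂ) := by
    rw [← Complex.ofReal_pow, mul_pow, sign_sq hτ, one_mul, sq_sqrt_of_mem hv]
  apply branchRoot_eq
  · rw [pt_ang hv hτ]
    set P := ((τ * Real.sqrt (1 - 2 * v ^ 2) : ℝ) : ℂ)
    rw [div_pow, div_pow, eq_comm, ← sub_eq_zero, ← mul_left_inj' (pow_ne_zero 2 h0'), zero_mul]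
    rw [sub_mul, add_mul, div_mul_cancel₀ _ (pow_ne_zero 2 h0'), div_mul_cancel₀ _ (pow_ne_zero 2 h0')]
    push_cast at hp ⊢
    linear_combination (P ^ 2 * (1 - (v : ℂ) ^ 2)) * Complex.I_sq - (1 - (v : ℂ) ^ 2) * hp
  · have e : (v : ℂ) * (1 + (τ * Real.sqrt (1 - 2 * v ^ 2) : ℝ) * Complex.I) / ((1 - v ^ 2 : ℝ) : ℂ) =
        ((v / (1 - v ^ 2) : ℝ) : ℂ) * (1 + (τ * Real.sqrt (1 - 2 * v ^ 2) : ℝ) * Complex.I) := by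
      push_cast; ring
    rw [e, Complex.re_ofReal_mul]
    simp only [Complex.add_re, Complex.one_re, Complex.re_ofReal_mul, Complex.I_re, mul_zero, add_zero,
      mul_one]
    exact div_pos hv.1 h0

theorem refl_pt_ang : refl (pt 1 (τ * ang v)) =
    (1 + (τ * Real.sqrt (1 - 2 * v ^ 2) : ℝ) * Complex.I) / ((Real.sqrt 2 : ℝ) * (1 + v : ℝ)) := by
  have h0 := one_sub_sq_pos hv
  have h0' : ((1 - v ^ 2 : ℝ) : ℂ) ≠ 0 := by exact_mod_cast h0.ne'
  have h1 : ((1 + v : ℝ) : ℂ) ≠ 0 := by exact_mod_cast (by linarith [hv.1] : (1 + v : ℝ) ≠ 0)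
  have h2 := sqrtTwo_ne_zero
  rw [refl, branchRoot_pt_ang hv hτ, pt_ang hv hτ]
  set P := ((τ * Real.sqrt (1 - 2 * v ^ 2) : ℝ) : ℂ)
  rw [div_eq_div_iff h2 (mul_ne_zero h2 h1), ← mul_left_inj' h0']
  have e : (1 + ((v ^ 2 : ℝ) + P * Complex.I) / ((1 - v ^ 2 : ℝ) : ℂ) -
      (v : ℂ) * (1 + P * Complex.I) / ((1 - v ^ 2 : ℝ) : ℂ)) * ((1 - v ^ 2 : ℝ) : ℂ) =
      ((1 - v ^ 2 : ℝ) : ℂ) + ((v ^ 2 : ℝ) + P * Complex.I) - (v : ℂ) * (1 + P * Complex.I) := by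
    field_simp
  rw [mul_right_comm, e]
  push_cast
  ring

/-- This identifies v as the group velocity: the Laplace exponent on the band is η/v. -/
theorem one_add_div_branchRoot_re :
    ((1 + pt 1 (τ * ang v)) / branchRoot (pt 1 (τ * ang v))).re = 1 / v := by
  have h0 := one_sub_sq_pos hv
  have h0' : ((1 - v ^ 2 : ℝ) : ℂ) ≠ 0 := by exact_mod_cast h0.ne'
  have hv0 : (v : ℂ) ≠ 0 := by exact_mod_cast hv.1.ne'
  have h1 : (1 + (τ * Real.sqrt (1 - 2 * v ^ 2) : ℝ) * Complex.I : ℂ) ≠ 0 := by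
    intro h
    have := congrArg Complex.re h
    simp only [Complex.add_re, Complex.one_re, Complex.re_ofReal_mul, Complex.I_re, mul_zero,
      add_zero, Complex.zero_re] at this
    exact one_ne_zero this
  have e : (1 + pt 1 (τ * ang v)) / branchRoot (pt 1 (τ * ang v)) = ((1 / v : ℝ) : ℂ) := by
    rw [branchRoot_pt_ang hv hτ, pt_ang hv hτ]
    set P := ((τ * Real.sqrt (1 - 2 * v ^ 2) : ℝ) : ℂ)
    have e1 : 1 + ((v ^ 2 : ℝ) + P * Complex.I) / ((1 - v ^ 2 : ℝ) : ℂ) =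
        (1 + P * Complex.I) / ((1 - v ^ 2 : ℝ) : ℂ) := by
      rw [eq_div_iff h0', add_mul, div_mul_cancel₀ _ h0']
      push_cast; ring
    rw [e1, Complex.ofReal_div, Complex.ofReal_one]
    field_simp
  rw [e, Complex.ofReal_re]

theorem norm_refl_pt_ang_sq :
    ‖refl (pt 1 (τ * ang v))‖ ^ 2 = (1 - v) / (1 + v) := by
  have h1 : 0 < 1 + v := by linarith [hv.1]
  rw [refl_pt_ang hv hτ, norm_div, div_pow, norm_mul, Complex.norm_real, Complex.norm_real,
    ← Complex.normSq_eq_norm_sq, Complex.normSq_apply, mul_pow, Real.norm_eq_abs, Real.norm_eq_abs,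
    sq_abs, sq_abs, real_sqrtTwo_sq]
  simp only [Complex.add_re, Complex.one_re, Complex.re_ofReal_mul, Complex.I_re, mul_zero,
      add_zero, Complex.add_im, Complex.one_im, Complex.im_ofReal_mul, Complex.I_im, zero_add, mul_one]
  rw [div_eq_div_iff (by positivity) h1.ne']
  have := sq_sqrt_of_mem hv
  linear_combination (Real.sqrt (1 - 2 * v ^ 2)) ^ 2 * (1 + v) * sign_sq hτ + (1 + v) * this

end

/-! ### The explicit band density and the weight. -/

theorem norm_add_sq_eq (z w : ℂ) : ‖z + w‖ ^ 2 = ‖z‖ ^ 2 + ‖w‖ ^ 2 + 2 * (conj z * w).re := by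
  rw [← Complex.normSq_eq_norm_sq, ← Complex.normSq_eq_norm_sq, ← Complex.normSq_eq_norm_sq]
  simp only [Complex.normSq_apply, Complex.mul_re, Complex.conj_re, Complex.conj_im, Complex.add_re,
    Complex.add_im]
  ring

theorem re_mul_exp_mul (k γ P : ℝ) :
    ((k : ℂ) * (Complex.exp (γ * Complex.I) * (1 + P * Complex.I))).re =
      k * (Real.cos γ - P * Real.sin γ) := by
  rw [Complex.re_ofReal_mul, Complex.exp_mul_I, ← Complex.ofReal_cos, ← Complex.ofReal_sin]
  simp only [Complex.mul_re, Complex.add_re, Complex.add_im, Complex.ofReal_re, Complex.ofReal_im,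
    Complex.I_re, Complex.I_im, Complex.mul_im, Complex.one_re, Complex.one_im]
  ring

section
variable {σp σm a b φ₁ φ₂ : ℝ} {α β : ℂ} (hab : a ^ 2 + b ^ 2 = 1)
  (hα : α = a * Complex.exp (Complex.I * φ₁)) (hβ : β = b * Complex.exp (Complex.I * φ₂))
include hab hα hβ

/-- Solving the origin system gives d (1 + e f y²) = β + f y α with e = e^{iσ₊} and f = e^{-iσ₋}.
The squared norms of the two brackets are elementary because y is explicit in v, and 1 - |y|² =
2v/(1 + v). Positivity holds because |y| < 1 keeps the first bracket away from zero. -/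
theorem bandDensity_pt_ang {v τ : ℝ} (hv : v ∈ speeds) (hτ : τ = 1 ∨ τ = -1) :
    0 < 1 + v ^ 2 + v ^ 2 * Real.cos (σp - σm) - Real.sin (σp - σm) * (τ * Real.sqrt (1 - 2 * v ^ 2)) ∧
    bandDensity σp σm α β (pt 1 (τ * ang v)) *
      (1 + v ^ 2 + v ^ 2 * Real.cos (σp - σm) - Real.sin (σp - σm) * (τ * Real.sqrt (1 - 2 * v ^ 2))) =
      v * (1 + v * (b ^ 2 - a ^ 2) + Real.sqrt 2 * a * b * (Real.cos (φ₁ - φ₂ - σm) -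
        τ * Real.sqrt (1 - 2 * v ^ 2) * Real.sin (φ₁ - φ₂ - σm))) := by
  have hv1 : 0 < 1 + v := by linarith [hv.1]
  have hs0 : 0 < Real.sqrt 2 := by positivity
  have hs2 := real_sqrtTwo_sq
  have hyn := norm_refl_pt_ang_sq hv hτ
  have hP2 : (τ * Real.sqrt (1 - 2 * v ^ 2)) ^ 2 = 1 - 2 * v ^ 2 := by
    rw [mul_pow, sign_sq hτ, one_mul, sq_sqrt_of_mem hv]
  have hy : refl (pt 1 (τ * ang v)) = ((1 / (Real.sqrt 2 * (1 + v)) : ℝ) : ℂ) *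
      (1 + (τ * Real.sqrt (1 - 2 * v ^ 2) : ℝ) * Complex.I) := by
    rw [refl_pt_ang hv hτ]; push_cast; ring
  set P := τ * Real.sqrt (1 - 2 * v ^ 2) with hP
  set m := 1 / (Real.sqrt 2 * (1 + v)) with hm
  have hm1 : m * (1 + v) * Real.sqrt 2 = 1 := by rw [hm]; field_simp
  set Z := pt 1 (τ * ang v)
  set y := refl Z with hydef
  have hy1 : ‖y‖ < 1 := by
    have : ‖y‖ ^ 2 < 1 := by rw [hyn, div_lt_one hv1]; linarith [hv.1]
    nlinarith [norm_nonneg y]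
  have hc := norm_phase σp σm
  have n1 : 1 - phase σp σm * y ≠ 0 := fun h => by
    have : ‖phase σp σm * y‖ = 1 := by rw [← sub_eq_zero.1 h]; simp
    rw [norm_mul, hc, one_mul] at this; linarith
  have n2 : 1 + phase σp σm * y ≠ 0 := fun h => by
    have : ‖phase σp σm * y‖ = 1 := by rw [eq_neg_of_add_eq_zero_right h]; simp
    rw [norm_mul, hc, one_mul] at this; linarith
  obtain ⟨hu, hd⟩ := origin_system σp σm α β (Z := Z) n1 n2
  have hD : originLower σp σm α β Z * (1 + Complex.exp (Complex.I * σp) *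
      Complex.exp (-(Complex.I * σm)) * y ^ 2) = β + Complex.exp (-(Complex.I * σm)) * y * α := by
    linear_combination hd + Complex.exp (-(Complex.I * σm)) * y * hu
  have hDn := congrArg (fun w => ‖w‖ ^ 2) hD
  simp only [norm_mul (originLower σp σm α β Z), mul_pow] at hDn
  have e1 : ‖Complex.exp (-(Complex.I * σm))‖ = 1 := by
    have := norm_exp_I_mul_ofReal' (-σm)
    simpa using this
  have hN : ‖β + Complex.exp (-(Complex.I * σm)) * y * α‖ ^ 2 =
      b ^ 2 + a ^ 2 * ((1 - v) / (1 + v)) + 2 * (a * b * m *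
        (Real.cos (φ₁ - φ₂ - σm) - P * Real.sin (φ₁ - φ₂ - σm))) := by
    have hβn : ‖β‖ ^ 2 = b ^ 2 := by
      rw [hβ, norm_mul, norm_exp_I_mul_ofReal', mul_one, Complex.norm_real, Real.norm_eq_abs, sq_abs]
    have hαn : ‖α‖ ^ 2 = a ^ 2 := by
      rw [hα, norm_mul, norm_exp_I_mul_ofReal', mul_one, Complex.norm_real, Real.norm_eq_abs, sq_abs]
    have e2 : conj β * (Complex.exp (-(Complex.I * σm)) * y * α) = ((a * b * m : ℝ) : ℂ) *
        (Complex.exp (((φ₁ - φ₂ - σm : ℝ) : ℂ) * Complex.I) * (1 + P * Complex.I)) := by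
      have e3 : Complex.exp (((φ₁ - φ₂ - σm : ℝ) : ℂ) * Complex.I) = Complex.exp (Complex.I * φ₁) *
          Complex.exp (-(Complex.I * φ₂)) * Complex.exp (-(Complex.I * σm)) := by
        rw [← Complex.exp_add, ← Complex.exp_add]; congr 1; push_cast; ring
      have e4 : conj (Complex.exp (Complex.I * φ₂)) = Complex.exp (-(Complex.I * φ₂)) := by
        rw [← Complex.exp_conj]; simp
      rw [hβ, hα, map_mul, e4, Complex.conj_ofReal, e3, hy]
      push_cast; ring
    rw [norm_add_sq_eq, e2, re_mul_exp_mul, norm_mul, norm_mul, e1, one_mul, mul_pow, hyn, hβn, hαn]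
    ring
  have hDen : ‖1 + Complex.exp (Complex.I * σp) * Complex.exp (-(Complex.I * σm)) * y ^ 2‖ ^ 2 *
      (1 + v) ^ 2 = 2 * (1 + v ^ 2 + v ^ 2 * Real.cos (σp - σm) - Real.sin (σp - σm) * P) := by
    have e2 : conj (1 : ℂ) * (Complex.exp (Complex.I * σp) * Complex.exp (-(Complex.I * σm)) * y ^ 2) =
        ((m ^ 2 : ℝ) : ℂ) * (Complex.exp (((σp - σm : ℝ) : ℂ) * Complex.I) *
          ((1 - P ^ 2 : ℝ) + (2 * P : ℝ) * Complex.I)) := by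
      have e3 : Complex.exp (((σp - σm : ℝ) : ℂ) * Complex.I) = Complex.exp (Complex.I * σp) *
          Complex.exp (-(Complex.I * σm)) := by
        rw [← Complex.exp_add]; congr 1; push_cast; ring
      rw [e3, hy, map_one]
      push_cast
      linear_combination (Complex.exp (Complex.I * σp) * Complex.exp (-(Complex.I * σm)) * (m : ℂ) ^ 2 *
        (P : ℂ) ^ 2) * Complex.I_sq
    have e5 : (((m ^ 2 : ℝ) : ℂ) * (Complex.exp (((σp - σm : ℝ) : ℂ) * Complex.I) *
          ((1 - P ^ 2 : ℝ) + (2 * P : ℝ) * Complex.I))).re =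
        m ^ 2 * (Real.cos (σp - σm) * (1 - P ^ 2) - Real.sin (σp - σm) * (2 * P)) := by
      rw [Complex.re_ofReal_mul, Complex.exp_mul_I, ← Complex.ofReal_cos, ← Complex.ofReal_sin]
      simp only [Complex.mul_re, Complex.add_re, Complex.add_im, Complex.ofReal_re, Complex.ofReal_im,
        Complex.I_re, Complex.I_im, Complex.mul_im]
      ring
    rw [norm_add_sq_eq, e2, e5, norm_one, norm_mul, norm_mul, e1, norm_exp_I_mul_ofReal', norm_pow, hyn, hP2]
    have e6 : (1 - v) / (1 + v) * (1 + v) = 1 - v := div_mul_cancel₀ _ hv1.ne'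
    have e7 : m ^ 2 * (1 + v) ^ 2 * 2 = 1 := by
      have := congrArg (fun x => x ^ 2) hm1
      simp only [mul_pow, hs2] at this
      linarith
    linear_combination ((1 - v) / (1 + v) * (1 + v) + (1 - v)) * e6 +
      (2 * v ^ 2 * Real.cos (σp - σm) - 2 * Real.sin (σp - σm) * P) * e7
  have hne : 1 + Complex.exp (Complex.I * σp) * Complex.exp (-(Complex.I * σm)) * y ^ 2 ≠ 0 := by
    intro h
    have h2 : ‖Complex.exp (Complex.I * σp) * Complex.exp (-(Complex.I * σm)) * y ^ 2‖ = 1 := by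
      rw [eq_neg_of_add_eq_zero_right h]; simp
    rw [norm_mul, norm_mul, e1, norm_exp_I_mul_ofReal', norm_pow] at h2
    nlinarith [norm_nonneg y]
  have hpos := norm_pos_iff.2 hne
  refine ⟨?_, ?_⟩
  · have : 0 < ‖1 + Complex.exp (Complex.I * σp) * Complex.exp (-(Complex.I * σm)) * y ^ 2‖ ^ 2 *
      (1 + v) ^ 2 := by positivity
    linarith
  · rw [hN] at hDn
    have hb : bandDensity σp σm α β Z * (1 + v) = 2 * v * ‖originLower σp σm α β Z‖ ^ 2 := by
      unfold bandDensity
      rw [← hydef, hyn]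
      have e6 : (1 - v) / (1 + v) * (1 + v) = 1 - v := div_mul_cancel₀ _ hv1.ne'
      linear_combination (-‖originLower σp σm α β Z‖ ^ 2) * e6
    have hs : Real.sqrt 2 * (m * (1 + v)) * Real.sqrt 2 = Real.sqrt 2 := by
      linear_combination Real.sqrt 2 * hm1
    have e6 : (1 - v) / (1 + v) * (1 + v) = 1 - v := div_mul_cancel₀ _ hv1.ne'
    have e8 : 2 * m * (1 + v) = Real.sqrt 2 := by linear_combination hs - m * (1 + v) * hs2
    apply mul_left_cancel₀ (mul_pos two_pos hv1).ne'
    set S := 1 + v ^ 2 + v ^ 2 * Real.cos (σp - σm) - Real.sin (σp - σm) * P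
    set L := ‖originLower σp σm α β Z‖ ^ 2
    set G := Real.cos (φ₁ - φ₂ - σm) - P * Real.sin (φ₁ - φ₂ - σm)
    linear_combination 2 * S * hb - 2 * v * L * hDen + 2 * v * (1 + v) ^ 2 * hDn +
      2 * v * (1 + v) * a ^ 2 * e6 + 2 * v * (1 + v) * a * b * G * e8 + 2 * v * (1 + v) * hab

/-- The angles ±`ang v` share the speed v. Their denominators differ only in the sign of √(1 - 2v²),
so the common denominator is polynomial in v and is the quartic of the weight. -/
theorem weight_eq_bandDensity {v : ℝ} (hv : v ∈ speeds) :
    weight σp σm a b (φ₁ - φ₂) v = v * (bandDensity σp σm α β (pt 1 (ang v)) +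
      bandDensity σp σm α β (pt 1 (-ang v))) := by
  obtain ⟨p1, h1⟩ := bandDensity_pt_ang (σp := σp) (σm := σm) hab hα hβ hv (Or.inl rfl)
  obtain ⟨p2, h2⟩ := bandDensity_pt_ang (σp := σp) (σm := σm) hab hα hβ hv (Or.inr rfl)
  simp only [one_mul] at h1 p1
  simp only [neg_one_mul] at h2 p2
  have hp := sq_sqrt_of_mem hv
  set p := Real.sqrt (1 - 2 * v ^ 2)
  have hσ : σp - σm = 2 * ((σp - σm) / 2) := by ring
  unfold weight
  rw [gam, if_pos hv.1.le, Real.sign_of_pos hv.1]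
  simp only [mul_one]
  set σ := (σp - σm) / 2
  rw [hσ] at h1 h2 p1 p2
  set γ := φ₁ - φ₂ - σm
  set x := bandDensity σp σm α β (pt 1 (ang v))
  set x' := bandDensity σp σm α β (pt 1 (-ang v))
  have hc2 : Real.cos (2 * σ) = 2 * Real.cos σ ^ 2 - 1 := Real.cos_two_mul σ
  have hsc : Real.sin σ ^ 2 = 1 - Real.cos σ ^ 2 := Real.sin_sq σ
  have hs2 : Real.sin (2 * σ) ^ 2 = 1 - (2 * Real.cos σ ^ 2 - 1) ^ 2 := by
    rw [Real.sin_sq, hc2]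
  rw [hc2] at h1 h2 p1 p2 ⊢
  set C := Real.cos σ
  set F := Real.sin (2 * σ)
  have hden : 4 * C ^ 4 * v ^ 4 + 4 * C ^ 2 * (1 + 2 * Real.sin σ ^ 2) * v ^ 2 + (2 * C ^ 2 - 1) ^ 2 =
      (1 + v ^ 2 + v ^ 2 * (2 * C ^ 2 - 1) - F * p) * (1 + v ^ 2 + v ^ 2 * (2 * C ^ 2 - 1) - F * -p) := by
    rw [hsc]
    linear_combination p ^ 2 * hs2 + (1 - (2 * C ^ 2 - 1) ^ 2) * hp
  rw [hden, div_eq_iff (mul_pos p1 p2).ne']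
  set S := 1 + v ^ 2 + v ^ 2 * (2 * C ^ 2 - 1) - F * p
  set S' := 1 + v ^ 2 + v ^ 2 * (2 * C ^ 2 - 1) - F * -p
  linear_combination (-(v * S')) * h1 - v * S * h2 + 2 * v ^ 2 * Real.sqrt 2 * a * b * Real.sin γ * F * hp

theorem weight_nonneg {v : ℝ} (hv : v ∈ speeds) : 0 ≤ weight σp σm a b (φ₁ - φ₂) v := by
  rw [weight_eq_bandDensity hab hα hβ hv]
  have key : ∀ τ : ℝ, τ = 1 ∨ τ = -1 → 0 ≤ bandDensity σp σm α β (pt 1 (τ * ang v)) := fun τ hτ => by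
    unfold bandDensity
    rw [norm_refl_pt_ang_sq hv hτ]
    have h1 : 0 < 1 + v := by linarith [hv.1]
    have : (1 - v) / (1 + v) ≤ 1 := by rw [div_le_one h1]; linarith [hv.1]
    exact mul_nonneg (by linarith) (by positivity)
  have h1 := key 1 (Or.inl rfl)
  have h2 := key (-1) (Or.inr rfl)
  rw [one_mul] at h1
  rw [neg_one_mul] at h2
  have := hv.1
  positivity

end

theorem weight_reflect (σp σm a b φ : ℝ) {v : ℝ} (hv : 0 < v) :
    weight (Real.pi - σm) (Real.pi - σp) b a (-φ) v = weight σp σm a b φ (-v) := by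
  have e1 : (Real.pi - σm - (Real.pi - σp)) / 2 = (σp - σm) / 2 := by ring
  have e2 : -φ - (Real.pi - σp) = (-φ + σp) - Real.pi := by ring
  unfold weight gam
  rw [e1, if_pos hv.le, if_neg (by linarith), Real.sign_of_pos hv, Real.sign_of_neg (by linarith), e2]
  simp only [Real.cos_sub_pi, Real.sin_sub_pi]
  congr 1 <;> ring

theorem konnoDensity_eq {v : ℝ} (hv : v ∈ speeds) : konnoDensity v (1 / Real.sqrt 2) =
    (Real.pi * (1 - v ^ 2) * Real.sqrt (1 - 2 * v ^ 2))⁻¹ := by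
  have hpos : 0 < 1 / Real.sqrt 2 := by positivity
  have hs : (1 / Real.sqrt 2) ^ 2 = 1 / 2 := by rw [div_pow, one_pow, real_sqrtTwo_sq]
  rw [konnoDensity, Set.indicator_of_mem (show v ∈ Set.Ioo (-(1 / Real.sqrt 2)) (1 / Real.sqrt 2) from
    ⟨by linarith [hv.1], hv.2⟩), hs]
  have e1 : (1 : ℝ) / 2 - v ^ 2 = 1 / 2 * (1 - 2 * v ^ 2) := by ring
  have e2 : (1 : ℝ) - 1 / 2 = 1 / 2 := by norm_num
  have h1 := one_sub_sq_pos hv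
  have h2 := sqrt_pos_of_mem hv
  rw [e1, e2, Real.sqrt_mul (by norm_num)]
  have h3 : 0 < Real.sqrt (1 / 2) := by positivity
  field_simp

theorem konnoDensity_neg (x r : ℝ) : konnoDensity (-x) r = konnoDensity x r := by
  unfold konnoDensity Set.indicator
  simp only [Set.mem_Ioo, neg_sq, neg_lt_neg_iff, neg_lt (a := x), and_comm (a := x < r)]

theorem konnoDensity_eq_zero {x : ℝ} (hx : 1 / Real.sqrt 2 ≤ |x|) : konnoDensity x (1 / Real.sqrt 2) = 0 := by
  rw [konnoDensity, Set.indicator_of_notMem]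
  rintro ⟨h1, h2⟩
  exact absurd (abs_lt.2 ⟨h1, h2⟩) (not_lt.2 hx)

theorem weight_zero (σp σm a b φ : ℝ) : weight σp σm a b φ 0 = 0 := by
  simp [weight]

theorem weight_mul_konnoDensity_nonneg {a b : ℝ} (hab : a ^ 2 + b ^ 2 = 1) (σp σm φ₁ φ₂ x : ℝ) :
    0 ≤ weight σp σm a b (φ₁ - φ₂) x * konnoDensity x (1 / Real.sqrt 2) := by
  have pos : ∀ {σp σm a b φ₁ φ₂ v : ℝ}, a ^ 2 + b ^ 2 = 1 → v ∈ speeds →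
      0 ≤ weight σp σm a b (φ₁ - φ₂) v * konnoDensity v (1 / Real.sqrt 2) := by
    intro σp σm a b φ₁ φ₂ v hab hv
    have := weight_nonneg (σp := σp) (σm := σm) hab rfl rfl hv (φ₁ := φ₁) (φ₂ := φ₂)
    rw [konnoDensity_eq hv]
    have h1 := one_sub_sq_pos hv
    positivity
  rcases le_or_gt (1 / Real.sqrt 2) |x| with h | h
  · rw [konnoDensity_eq_zero h, mul_zero]
  rcases lt_trichotomy x 0 with hx | rfl | hx
  · rw [abs_of_neg hx] at h
    have h1 := pos (σp := Real.pi - σm) (σm := Real.pi - σp) (a := b) (b := a) (φ₁ := φ₂) (φ₂ := φ₁)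
      (v := -x) (by linarith) ⟨by linarith, h⟩
    rwa [← neg_sub φ₁ φ₂, weight_reflect _ _ _ _ _ (by linarith), neg_neg, konnoDensity_neg] at h1
  · rw [weight_zero, zero_mul]
  · rw [abs_of_pos hx] at h
    exact pos hab ⟨hx, h⟩

/-! ### Change of variables from angle to speed. -/

theorem norm_refl_pt_le_one {θ : ℝ} (hθ : Real.cos θ ≠ 0) : ‖refl (pt 1 θ)‖ ≤ 1 := by
  have h1 := norm_refl_le_norm_reflConj (norm_pt_one θ).le (one_add_pt_one_sq_ne_zero hθ)
  have h2 := congrArg norm (refl_mul_reflConj (pt 1 θ))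
  rw [norm_mul, norm_pt_one] at h2
  nlinarith [norm_nonneg (refl (pt 1 θ))]

theorem bandDensity_nonneg (σp σm : ℝ) (α β : ℂ) {θ : ℝ} (hθ : Real.cos θ ≠ 0) :
    0 ≤ bandDensity σp σm α β (pt 1 θ) := by
  have h := norm_refl_pt_le_one hθ
  unfold bandDensity
  exact mul_nonneg (by nlinarith [norm_nonneg (refl (pt 1 θ))]) (by positivity)

theorem bandDensity_le_energy (σp σm : ℝ) (α β : ℂ) {θ : ℝ} (hθ : Real.cos θ ≠ 0) :
    bandDensity σp σm α β (pt 1 θ) ≤ energy σp σm α β (pt 1 θ) := by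
  rw [← bandDensity_add_bandDensity_reflect]
  exact le_add_of_nonneg_right (bandDensity_nonneg _ _ _ _ hθ)

theorem re_one_add_div_branchRoot_nonneg {θ : ℝ} (hθ : Real.cos θ ≠ 0) :
    0 ≤ ((1 + pt 1 θ) / branchRoot (pt 1 θ)).re := by
  have h := re_one_add_mul_conj_branchRoot_nonneg (norm_pt_one θ).le (one_add_pt_one_sq_ne_zero hθ)
  have e : (1 + pt 1 θ) / branchRoot (pt 1 θ) =
      (((Complex.normSq (branchRoot (pt 1 θ)))⁻¹ : ℝ) : ℂ) * ((1 + pt 1 θ) * conj (branchRoot (pt 1 θ))) := by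
    rw [div_eq_mul_inv, Complex.inv_def]; ring
  rw [e, Complex.re_ofReal_mul]
  exact mul_nonneg (inv_nonneg.2 (Complex.normSq_nonneg _)) h

/-- The Laplace integrand on the unit circle. -/
noncomputable def laplaceDensity (σp σm : ℝ) (α β : ℂ) (η θ : ℝ) : ℝ :=
  Real.exp (-(η * ((1 + pt 1 θ) / branchRoot (pt 1 θ)).re)) * bandDensity σp σm α β (pt 1 θ)

theorem intervalIntegrable_laplaceDensity {σp σm : ℝ} {α β : ℂ} (h : ‖α‖ ^ 2 + ‖β‖ ^ 2 = 1) {η : ℝ}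
    (hη : 0 ≤ η) : IntervalIntegrable (laplaceDensity σp σm α β η) volume (-Real.pi) Real.pi := by
  refine (intervalIntegrable_energy (σp := σp) (σm := σm) h).mono_fun' ?_ ?_
  · have h1 := measurable_bandDensity σp σm α β
    have h2 := measurable_pt 1
    have h3 := measurable_branchRoot
    unfold laplaceDensity
    exact Measurable.aestronglyMeasurable (by fun_prop)
  · refine ae_restrict_of_ae ?_
    filter_upwards [ae_cos_ne_zero] with θ hθ
    have h1 := bandDensity_nonneg σp σm α β hθ
    have h2 := re_one_add_div_branchRoot_nonneg hθ
    unfold laplaceDensity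
    rw [Real.norm_of_nonneg (by positivity)]
    refine le_trans (mul_le_of_le_one_left h1 ?_) (bandDensity_le_energy σp σm α β hθ)
    rw [Real.exp_le_one_iff, neg_nonpos]
    positivity

/-- The absolutely continuous part of the limit law. -/
noncomputable def density (σp σm a b φ x : ℝ) : ℝ :=
  weight σp σm a b φ x * konnoDensity x (1 / Real.sqrt 2)

theorem measurableSet_speeds : MeasurableSet speeds := measurableSet_Ioo

section
variable {σp σm a b φ₁ φ₂ : ℝ} {α β : ℂ} (hab : a ^ 2 + b ^ 2 = 1)
  (hα : α = a * Complex.exp (Complex.I * φ₁)) (hβ : β = b * Complex.exp (Complex.I * φ₂))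
include hab hα hβ

/-- The Jacobian 2v/((1 - v²)√(1 - 2v²)) equals 2πv f_K(v; 1/√2), and the factor v combines with the
two band densities into the weight. This is where Konno's density comes from. -/
theorem abs_deriv_mul_laplaceDensity {η v : ℝ} (hv : v ∈ speeds) :
    |-(2 * v / ((1 - v ^ 2) * Real.sqrt (1 - 2 * v ^ 2)))| •
      (laplaceDensity σp σm α β η (-ang v) + laplaceDensity σp σm α β η (ang v)) =
      2 * Real.pi * (Real.exp (-(η / v)) * density σp σm a b (φ₁ - φ₂) v) := by
  have h0 := one_sub_sq_pos hv
  have hp := sqrt_pos_of_mem hv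
  have hv0 := hv.1
  have hpi := Real.pi_pos
  have r1 := one_add_div_branchRoot_re hv (Or.inl rfl)
  have r2 := one_add_div_branchRoot_re hv (Or.inr rfl)
  rw [one_mul] at r1
  rw [neg_one_mul] at r2
  unfold laplaceDensity density
  rw [r1, r2, weight_eq_bandDensity hab hα hβ hv, konnoDensity_eq hv, abs_neg, abs_of_pos (by positivity),
    smul_eq_mul, mul_one_div]
  field_simp
  ring

theorem integral_laplaceDensity_aux {η : ℝ} (hη : 0 ≤ η) :
    IntegrableOn (fun v => 2 * Real.pi * (Real.exp (-(η / v)) * density σp σm a b (φ₁ - φ₂) v)) speeds ∧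
    ∫ θ in (-(Real.pi / 2))..(Real.pi / 2), laplaceDensity σp σm α β η θ =
      ∫ v in speeds, 2 * Real.pi * (Real.exp (-(η / v)) * density σp σm a b (φ₁ - φ₂) v) := by
  have hpi := Real.pi_pos
  have hnorm := norm_sq_add_norm_sq a b φ₁ φ₂ α β hab hα hβ
  have hi := intervalIntegrable_laplaceDensity (σp := σp) (σm := σm) hnorm hη
  have hsub : ∀ c d, c ∈ Set.Icc (-Real.pi) Real.pi → d ∈ Set.Icc (-Real.pi) Real.pi →
      IntervalIntegrable (laplaceDensity σp σm α β η) volume c d := by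
    intro c d hc hd
    refine hi.mono_set ?_
    rw [Set.uIcc_of_le (show -Real.pi ≤ Real.pi by linarith)]
    exact Set.uIcc_subset_Icc hc hd
  have i1 := hsub (-(Real.pi / 2)) 0 ⟨by linarith, by linarith⟩ ⟨by linarith, by linarith⟩
  have i2 := hsub 0 (Real.pi / 2) ⟨by linarith, by linarith⟩ ⟨by linarith, by linarith⟩
  have i1' : IntervalIntegrable (fun θ => laplaceDensity σp σm α β η (-θ)) volume 0 (Real.pi / 2) := by
    have := (IntervalIntegrable.iff_comp_neg).1 i1.symm
    simpa using this
  have isum := i1'.add i2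
  have hcong : Set.EqOn (fun v => |-(2 * v / ((1 - v ^ 2) * Real.sqrt (1 - 2 * v ^ 2)))| •
      (laplaceDensity σp σm α β η (-ang v) + laplaceDensity σp σm α β η (ang v)))
      (fun v => 2 * Real.pi * (Real.exp (-(η / v)) * density σp σm a b (φ₁ - φ₂) v)) speeds :=
    fun v hv => abs_deriv_mul_laplaceDensity hab hα hβ hv
  have hder : ∀ v ∈ speeds, HasDerivWithinAt ang
      (-(2 * v / ((1 - v ^ 2) * Real.sqrt (1 - 2 * v ^ 2)))) speeds v :=
    fun v hv => (hasDerivAt_ang hv).hasDerivWithinAt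
  constructor
  · rw [← integrableOn_congr_fun hcong measurableSet_speeds]
    have := integrableOn_image_iff_integrableOn_abs_deriv_smul measurableSet_speeds hder injOn_ang
      (fun θ => laplaceDensity σp σm α β η (-θ) + laplaceDensity σp σm α β η θ)
    rw [← this, image_ang]
    exact ((intervalIntegrable_iff_integrableOn_Ioc_of_le (by linarith)).1 isum).mono_set
      Set.Ioo_subset_Ioc_self
  · rw [← intervalIntegral.integral_add_adjacent_intervals i1 i2]
    have e1 : ∫ θ in (-(Real.pi / 2))..0, laplaceDensity σp σm α β η θ =
        ∫ θ in (0 : ℝ)..(Real.pi / 2), laplaceDensity σp σm α β η (-θ) := by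
      rw [intervalIntegral.integral_comp_neg, neg_zero]
    rw [e1, ← intervalIntegral.integral_add i1' i2, intervalIntegral.integral_of_le (by linarith),
      integral_Ioc_eq_integral_Ioo, ← image_ang,
      integral_image_eq_integral_abs_deriv_smul measurableSet_speeds hder injOn_ang]
    exact setIntegral_congr_fun measurableSet_speeds hcong

theorem integrableOn_density : IntegrableOn (density σp σm a b (φ₁ - φ₂)) speeds := by
  have h := (integral_laplaceDensity_aux (σp := σp) (σm := σm) hab hα hβ le_rfl).1
  have hpi := Real.pi_pos
  have := h.const_mul (2 * Real.pi)⁻¹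
  refine IntegrableOn.congr_fun this (fun v _ => ?_) measurableSet_speeds
  simp only [zero_div, neg_zero, Real.exp_zero, one_mul]
  rw [inv_mul_cancel_left₀ (by positivity)]

theorem integral_laplaceDensity {η : ℝ} (hη : 0 ≤ η) :
    (2 * Real.pi)⁻¹ * ∫ θ in (-(Real.pi / 2))..(Real.pi / 2), laplaceDensity σp σm α β η θ =
      ∫ v in speeds, Real.exp (-(η / v)) * density σp σm a b (φ₁ - φ₂) v := by
  have hpi := Real.pi_pos
  rw [(integral_laplaceDensity_aux hab hα hβ hη).2, integral_const_mul,
    inv_mul_cancel_left₀ (by positivity)]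

theorem localizedMass_eq_sum_modeCoeff : localizedMass σp σm a b (φ₁ - φ₂) =
    ∑ s, boundMass σp σm s * ‖modeCoeff σp σm α β s‖ ^ 2 := by
  rw [localizedMass_eq]
  refine Finset.sum_congr rfl fun s _ => ?_
  rw [modeCoeff, norm_modeCoeff_sq σp σm a b φ₁ φ₂ α β hab hα hβ]

/-- The two integrals are the right fluxes of the walk and of its reflection at η = 0; their sum is
the band energy, already evaluated as 2π(1 - C). -/
theorem integral_density_add : (∫ v in speeds, density σp σm a b (φ₁ - φ₂) v) +
    ∫ v in speeds, density σp σm a b (φ₁ - φ₂) (-v) = 1 - localizedMass σp σm a b (φ₁ - φ₂) := by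
  have hpi := Real.pi_pos
  have hnorm := norm_sq_add_norm_sq a b φ₁ φ₂ α β hab hα hβ
  have hnorm' : ‖β‖ ^ 2 + ‖α‖ ^ 2 = 1 := by linarith
  have h1 := integral_laplaceDensity (σp := σp) (σm := σm) hab hα hβ le_rfl
  have h2 := integral_laplaceDensity (σp := Real.pi - σm) (σm := Real.pi - σp) (a := b) (b := a)
    (φ₁ := φ₂) (φ₂ := φ₁) (by linarith) hβ hα le_rfl
  have h3 : ∀ v ∈ speeds, density (Real.pi - σm) (Real.pi - σp) b a (φ₂ - φ₁) v =
      density σp σm a b (φ₁ - φ₂) (-v) := fun v hv => by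
    rw [density, density, ← neg_sub φ₁ φ₂, weight_reflect _ _ _ _ _ hv.1, konnoDensity_neg]
  simp only [zero_div, neg_zero, Real.exp_zero, one_mul] at h1 h2
  rw [setIntegral_congr_fun measurableSet_speeds h3] at h2
  rw [← h1, ← h2, ← mul_add, localizedMass_eq_sum_modeCoeff hab hα hβ,
    inv_mul_eq_iff_eq_mul₀ (by positivity), ← integral_band_energy hnorm]
  have hsub : ∀ {σp σm : ℝ} {α β : ℂ}, ‖α‖ ^ 2 + ‖β‖ ^ 2 = 1 →
      IntervalIntegrable (laplaceDensity σp σm α β 0) volume (-(Real.pi / 2)) (Real.pi / 2) := by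
    intro σp σm α β h
    refine (intervalIntegrable_laplaceDensity h le_rfl).mono_set ?_
    rw [Set.uIcc_of_le (by linarith), Set.uIcc_of_le (by linarith)]
    exact Set.Icc_subset_Icc (by linarith) (by linarith)
  rw [← intervalIntegral.integral_add (hsub hnorm) (hsub hnorm')]
  refine intervalIntegral.integral_congr fun θ _ => ?_
  simp only [laplaceDensity, zero_mul, neg_zero, Real.exp_zero, one_mul]
  exact bandDensity_add_bandDensity_reflect σp σm α β (pt 1 θ)

/-- Abel asymptotics of the right tails. -/
theorem tendsto_abel_tail {η : ℝ} (hη : 0 < η) :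
    Tendsto (fun n : ℕ => (1 - radius η n) * ∑' t, radius η n ^ t * tail σp σm α β n t) atTop
      (𝓝 (∫ v in speeds, Real.exp (-(η / v)) * density σp σm a b (φ₁ - φ₂) v)) := by
  have hnorm := norm_sq_add_norm_sq a b φ₁ φ₂ α β hab hα hβ
  have h := tendsto_circleMean_fluxDensity (σp := σp) (σm := σm) hnorm hη
  have h2 := integral_laplaceDensity (σp := σp) (σm := σm) hab hα hβ hη.le
  unfold laplaceDensity at h2
  rw [h2] at h
  refine h.congr' ?_
  filter_upwards [eventually_ge_atTop 1] with n hn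
  exact (abel_tail σp σm α β hnorm n hn (radius_pos η n) (radius_lt_one hη hn)).symm

end

/-! ### Weighted Abel means. -/

theorem radius_natCast (m n : ℕ) : radius m n = radius 1 n ^ m := by
  rw [radius, radius, ← Real.exp_nat_mul]; congr 1; ring

/-- The weighted Abel mean of a sequence. -/
noncomputable def abelMean (φ : ℝ → ℝ) (n : ℕ) (a : ℕ → ℝ) : ℝ :=
  (1 - radius 1 n) * ∑' t, radius 1 n ^ t * φ (radius 1 n ^ t) * a t

theorem radius_pow_mem {n : ℕ} (hn : 1 ≤ n) (t : ℕ) : radius 1 n ^ t ∈ Set.Icc (0 : ℝ) 1 :=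
  ⟨pow_nonneg (radius_pos 1 n).le t,
    pow_le_one₀ (radius_pos 1 n).le (radius_lt_one one_pos hn).le⟩

theorem summable_abelMean {φ : ℝ → ℝ} {M : ℝ} (hφ : ∀ q ∈ Set.Icc (0 : ℝ) 1, |φ q| ≤ M) {n : ℕ}
    (hn : 1 ≤ n) {a : ℕ → ℝ} (ha0 : ∀ t, 0 ≤ a t) (ha1 : ∀ t, a t ≤ 1) :
    Summable fun t => radius 1 n ^ t * φ (radius 1 n ^ t) * a t := by
  have h0 := (radius_pos 1 n).le
  refine Summable.of_norm_bounded ((summable_geometric_of_lt_one h0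
    (radius_lt_one one_pos hn)).mul_right M) fun t => ?_
  rw [norm_mul, norm_mul, Real.norm_of_nonneg (pow_nonneg h0 t), Real.norm_of_nonneg (ha0 t)]
  have h1 := hφ _ (radius_pow_mem hn t)
  calc _ ≤ radius 1 n ^ t * ‖φ (radius 1 n ^ t)‖ * 1 := by gcongr; exact ha1 t
    _ ≤ radius 1 n ^ t * M := by rw [mul_one]; gcongr; exact h1

theorem abs_abelMean_sub_le {φ ψ : ℝ → ℝ} {M M' ε : ℝ} (hφ : ∀ q ∈ Set.Icc (0 : ℝ) 1, |φ q| ≤ M)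
    (hψ : ∀ q ∈ Set.Icc (0 : ℝ) 1, |ψ q| ≤ M') (h : ∀ q ∈ Set.Icc (0 : ℝ) 1, |φ q - ψ q| ≤ ε) {n : ℕ}
    (hn : 1 ≤ n) {a : ℕ → ℝ} (ha0 : ∀ t, 0 ≤ a t) (ha1 : ∀ t, a t ≤ 1) :
    |abelMean φ n a - abelMean ψ n a| ≤ ε := by
  have h0 := (radius_pos 1 n).le
  have hr1 := radius_lt_one one_pos hn
  have s1 := summable_abelMean hφ hn ha0 ha1
  have s2 := summable_abelMean hψ hn ha0 ha1
  have hg := (hasSum_geometric_of_lt_one h0 hr1).mul_right ε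
  have hb : ‖∑' t, (radius 1 n ^ t * φ (radius 1 n ^ t) * a t - radius 1 n ^ t * ψ (radius 1 n ^ t) * a t)‖ ≤
      (1 - radius 1 n)⁻¹ * ε := by
    refine tsum_of_norm_bounded hg fun t => ?_
    rw [← sub_mul, ← mul_sub, norm_mul, norm_mul, Real.norm_of_nonneg (pow_nonneg h0 t),
      Real.norm_of_nonneg (ha0 t)]
    have h1 := h _ (radius_pow_mem hn t)
    calc _ ≤ radius 1 n ^ t * ‖φ (radius 1 n ^ t) - ψ (radius 1 n ^ t)‖ * 1 := by gcongr; exact ha1 t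
      _ ≤ radius 1 n ^ t * ε := by rw [mul_one]; gcongr; exact h1
  unfold abelMean
  rw [← mul_sub, ← s1.tsum_sub s2, abs_mul, abs_of_pos (by linarith)]
  calc _ ≤ (1 - radius 1 n) * ((1 - radius 1 n)⁻¹ * ε) := by
        have : 0 ≤ 1 - radius 1 n := by linarith
        gcongr
        exact hb
    _ = ε := by rw [mul_inv_cancel_left₀ (by linarith)]

theorem tendsto_ratio_radius (k : ℕ) :
    Tendsto (fun n : ℕ => (1 - radius 1 n) / (1 - radius 1 n ^ (k + 1))) atTop (𝓝 (1 / (k + 1 : ℝ))) := by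
  have h1 : Tendsto (fun n : ℕ => (∑ i ∈ Finset.range (k + 1), radius 1 n ^ i)⁻¹) atTop
      (𝓝 (∑ i ∈ Finset.range (k + 1), (1 : ℝ) ^ i)⁻¹) := by
    refine Tendsto.inv₀ (tendsto_finsetSum _ fun i _ => (tendsto_radius 1).pow i) ?_
    simp; positivity
  have e : (∑ i ∈ Finset.range (k + 1), (1 : ℝ) ^ i)⁻¹ = 1 / (k + 1 : ℝ) := by simp
  rw [e] at h1
  refine h1.congr' ?_
  filter_upwards [eventually_ge_atTop 1] with n hn
  have hr1 := radius_lt_one one_pos hn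
  have h0 := radius_pos 1 n
  have h2 := mul_neg_geom_sum (radius 1 n) (k + 1)
  rw [← h2, div_mul_eq_div_div, div_self (by linarith), one_div]

section Weierstrass
variable {Ω : Type*} [MeasurableSpace Ω] {μ : Measure Ω} {κ g : Ω → ℝ}
  (hκ : Measurable κ) (hκ01 : ∀ᵐ ω ∂μ, κ ω ∈ Set.Icc (0 : ℝ) 1) (hg : Integrable g μ)
  {a : ℕ → ℕ → ℝ} (ha0 : ∀ n t, 0 ≤ a n t) (ha1 : ∀ n t, a n t ≤ 1)
  (hmom : ∀ m : ℕ, 1 ≤ m → Tendsto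
    (fun n : ℕ => (1 - radius m n) * ∑' t, radius m n ^ t * a n t) atTop (𝓝 (∫ ω, κ ω ^ m * g ω ∂μ)))

include hκ hκ01 hg in
theorem integrable_pow_mul (m : ℕ) : Integrable (fun ω => κ ω ^ m * g ω) μ := by
  refine hg.bdd_mul (c := 1) (hκ.pow_const m).aestronglyMeasurable ?_
  filter_upwards [hκ01] with ω hω
  rw [norm_pow, Real.norm_of_nonneg hω.1]
  exact pow_le_one₀ hω.1 hω.2

-- As `radius 1 n ^ (k + 1)` is `radius (k + 1) n`, the weight q^k turns the mean into an ordinary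
-- Abel mean at η = k + 1. The ratio of normalisations tends to 1/(k + 1), the factor produced by
-- integrating q^k.
include hmom in
theorem tendsto_abelMean_pow (k : ℕ) : Tendsto (fun n => abelMean (fun q => q ^ k) n (a n)) atTop
    (𝓝 (∫ ω, (∫ q in (0 : ℝ)..κ ω, q ^ k) * g ω ∂μ)) := by
  have h := (tendsto_ratio_radius k).mul (hmom (k + 1) (by omega))
  have e : ∫ ω, (∫ q in (0 : ℝ)..κ ω, q ^ k) * g ω ∂μ =
      1 / (k + 1 : ℝ) * ∫ ω, κ ω ^ (k + 1) * g ω ∂μ := by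
    rw [← integral_const_mul]
    refine integral_congr_ae (Eventually.of_forall fun ω => ?_)
    simp only [integral_pow]
    rw [zero_pow (by omega)]; ring
  rw [e]
  refine h.congr' ?_
  filter_upwards [eventually_ge_atTop 1] with n hn
  have hr1 := radius_lt_one one_pos hn
  have h0 := radius_pos 1 n
  have h2 : radius 1 n ^ (k + 1) < 1 := pow_lt_one₀ h0.le hr1 (by omega)
  rw [radius_natCast, ← mul_assoc, div_mul_cancel₀ _ (by linarith)]
  unfold abelMean
  congr 1
  refine tsum_congr fun t => ?_
  have : (radius 1 n ^ (k + 1)) ^ t = radius 1 n ^ t * (radius 1 n ^ t) ^ k := by ring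
  rw [this]

include hκ hκ01 hg ha0 ha1 hmom in
theorem tendsto_abelMean_polynomial (p : Polynomial ℝ) :
    Tendsto (fun n => abelMean (fun q => p.eval q) n (a n)) atTop
    (𝓝 (∫ ω, (∫ q in (0 : ℝ)..κ ω, p.eval q) * g ω ∂μ)) := by
  have h := tendsto_finsetSum (Finset.range (p.natDegree + 1)) fun i _ =>
    (tendsto_abelMean_pow hmom i).const_mul (p.coeff i)
  have e : ∫ ω, (∫ q in (0 : ℝ)..κ ω, p.eval q) * g ω ∂μ =
      ∑ i ∈ Finset.range (p.natDegree + 1), p.coeff i * ∫ ω, (∫ q in (0 : ℝ)..κ ω, q ^ i) * g ω ∂μ := by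
    have hi : ∀ i ∈ Finset.range (p.natDegree + 1),
        Integrable (fun ω => p.coeff i * ((∫ q in (0 : ℝ)..κ ω, q ^ i) * g ω)) μ := by
      intro i _
      refine Integrable.const_mul ?_ _
      have h1 := (integrable_pow_mul hκ hκ01 hg (i + 1)).const_mul ((i : ℝ) + 1)⁻¹
      refine h1.congr (Eventually.of_forall fun ω => ?_)
      simp only [integral_pow]
      rw [zero_pow (by omega)]; ring
    simp_rw [← integral_const_mul]
    rw [← integral_finsetSum _ hi]
    refine integral_congr_ae (Eventually.of_forall fun ω => ?_)
    simp only [Polynomial.eval_eq_sum_range]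
    rw [intervalIntegral.integral_finsetSum (fun i _ => (by fun_prop : Continuous fun q : ℝ =>
      p.coeff i * q ^ i).intervalIntegrable _ _), Finset.sum_mul]
    refine Finset.sum_congr rfl fun i _ => ?_
    rw [intervalIntegral.integral_const_mul]; ring
  rw [e]
  refine h.congr' ?_
  filter_upwards [eventually_ge_atTop 1] with n hn
  unfold abelMean
  have hs : ∀ i ∈ Finset.range (p.natDegree + 1), Summable fun t =>
      p.coeff i * (radius 1 n ^ t * (radius 1 n ^ t) ^ i * a n t) := fun i _ => by
    refine Summable.mul_left _ (summable_abelMean (φ := fun q => q ^ i) (M := 1) ?_ hn (ha0 n) (ha1 n))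
    intro q hq
    rw [abs_of_nonneg (pow_nonneg hq.1 i)]
    exact pow_le_one₀ hq.1 hq.2
  have e2 : ∀ t, radius 1 n ^ t * p.eval (radius 1 n ^ t) * a n t = ∑ i ∈ Finset.range (p.natDegree + 1),
      p.coeff i * (radius 1 n ^ t * (radius 1 n ^ t) ^ i * a n t) := fun t => by
    rw [Polynomial.eval_eq_sum_range, Finset.mul_sum, Finset.sum_mul]
    exact Finset.sum_congr rfl fun i _ => by ring
  simp_rw [e2]
  rw [Summable.tsum_finsetSum hs, Finset.mul_sum]
  refine Finset.sum_congr rfl fun i _ => ?_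
  rw [tsum_mul_left]; ring

include hκ hκ01 hg ha0 ha1 hmom in
/-- Weighted Abel means converge for continuous weights. -/
theorem tendsto_abelMean {φ : ℝ → ℝ} (hφ : Continuous φ) :
    Tendsto (fun n => abelMean φ n (a n)) atTop (𝓝 (∫ ω, (∫ q in (0 : ℝ)..κ ω, φ q) * g ω ∂μ)) := by
  set A := ∫ ω, ‖g ω‖ ∂μ with hA
  have hA0 : 0 ≤ A := integral_nonneg fun _ => norm_nonneg _
  have bdd : ∀ ψ : ℝ → ℝ, Continuous ψ → ∃ M, ∀ q ∈ Set.Icc (0 : ℝ) 1, |ψ q| ≤ M := fun ψ hψ => by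
    obtain ⟨M, hM⟩ := isCompact_Icc.exists_bound_of_continuousOn (s := Set.Icc (0 : ℝ) 1) hψ.continuousOn
    exact ⟨M, hM⟩
  have hint : ∀ ψ : ℝ → ℝ, Continuous ψ → Integrable (fun ω => (∫ q in (0 : ℝ)..κ ω, ψ q) * g ω) μ := by
    intro ψ hψ
    obtain ⟨M, hM⟩ := bdd ψ hψ
    have hc : Continuous fun x : ℝ => ∫ q in (0 : ℝ)..x, ψ q :=
      intervalIntegral.continuous_primitive (fun a b => hψ.intervalIntegrable a b) 0
    refine hg.bdd_mul (c := M) (hc.measurable.comp hκ).aestronglyMeasurable ?_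
    filter_upwards [hκ01] with ω hω
    have := intervalIntegral.norm_integral_le_of_norm_le_const (a := 0) (b := κ ω) (f := ψ) (C := M)
      (fun q hq => by
        rw [Set.uIoc_of_le hω.1] at hq
        exact hM q ⟨hq.1.le, hq.2.trans hω.2⟩)
    rw [sub_zero, abs_of_nonneg hω.1] at this
    have hM0 : 0 ≤ M := (abs_nonneg _).trans (hM 0 ⟨le_rfl, zero_le_one⟩)
    exact this.trans (mul_le_of_le_one_right hM0 hω.2)
  rw [Metric.tendsto_atTop]
  intro ε hε
  -- A uniform polynomial error δ costs at most δ in the means and δA in the limit; both stay within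
  -- ε/3.
  set δ := ε / (3 * (A + 1)) with hδ
  have hδ0 : 0 < δ := by positivity
  have hδA : δ * A < ε / 3 := by
    rw [hδ, div_mul_eq_mul_div, div_lt_div_iff₀ (by positivity) (by norm_num)]
    nlinarith
  have hδ1 : δ ≤ ε / 3 := by
    rw [hδ]
    exact div_le_div_of_nonneg_left hε.le (by norm_num) (by linarith)
  obtain ⟨p, hp⟩ := exists_polynomial_near_of_continuousOn 0 1 φ hφ.continuousOn δ hδ0
  have hpc : Continuous fun q => p.eval q := p.continuous
  have hp' : ∀ q ∈ Set.Icc (0 : ℝ) 1, |φ q - p.eval q| ≤ δ := fun q hq => by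
    rw [abs_sub_comm]; exact (hp q hq).le
  obtain ⟨M, hM⟩ := bdd φ hφ
  obtain ⟨M', hM'⟩ := bdd _ hpc
  obtain ⟨N, hN⟩ := Metric.tendsto_atTop.1
    (tendsto_abelMean_polynomial hκ hκ01 hg ha0 ha1 hmom p) (ε / 3) (by positivity)
  have hlim : |(∫ ω, (∫ q in (0 : ℝ)..κ ω, p.eval q) * g ω ∂μ) -
      ∫ ω, (∫ q in (0 : ℝ)..κ ω, φ q) * g ω ∂μ| ≤ δ * A := by
    rw [← integral_sub (hint _ hpc) (hint _ hφ), hA, ← integral_const_mul]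
    rw [← Real.norm_eq_abs]
    refine norm_integral_le_of_norm_le (hg.norm.const_mul δ) ?_
    filter_upwards [hκ01] with ω hω
    rw [← sub_mul, norm_mul]
    gcongr
    rw [← intervalIntegral.integral_sub (hpc.intervalIntegrable _ _) (hφ.intervalIntegrable _ _)]
    have := intervalIntegral.norm_integral_le_of_norm_le_const (a := 0) (b := κ ω)
      (f := fun q => p.eval q - φ q) (C := δ)
      (fun q hq => by
        rw [Set.uIoc_of_le hω.1] at hq
        exact (hp q ⟨hq.1.le, hq.2.trans hω.2⟩).le)
    rw [sub_zero, abs_of_nonneg hω.1] at this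
    exact this.trans (mul_le_of_le_one_right hδ0.le hω.2)
  refine ⟨max N 1, fun n hn => ?_⟩
  have h1 := abs_abelMean_sub_le hM hM' hp' (le_of_max_le_right hn) (ha0 n) (ha1 n)
  have h2 := hN n (le_of_max_le_left hn)
  rw [Real.dist_eq] at h2 ⊢
  rw [abs_le] at h1 hlim
  rw [abs_lt] at h2 ⊢
  constructor <;> linarith

end Weierstrass

/-- The constant sequence 1 has all its Abel moments equal to 1, which corresponds to a unit mass at
κ = 1. It serves as the normalisation for bump-weighted averages. -/
theorem tendsto_abelMean_one {φ : ℝ → ℝ} (hφ : Continuous φ) :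
    Tendsto (fun n => abelMean φ n fun _ => 1) atTop (𝓝 (∫ q in (0 : ℝ)..1, φ q)) := by
  have h := tendsto_abelMean (μ := Measure.dirac (0 : ℝ)) (κ := fun _ => 1) (g := fun _ => 1)
    (a := fun _ _ => 1) measurable_const (Eventually.of_forall fun _ => ⟨zero_le_one, le_rfl⟩)
    (integrable_const _) (fun _ _ => zero_le_one) (fun _ _ => le_rfl) (fun m hm => by
      have : Tendsto (fun _ : ℕ => (1 : ℝ)) atTop (𝓝 1) := tendsto_const_nhds
      simp only [one_pow, mul_one, integral_const, probReal_univ, smul_eq_mul]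
      refine this.congr' ?_
      filter_upwards [eventually_ge_atTop 1] with n hn
      have hm' : (0 : ℝ) < m := by exact_mod_cast hm
      have := radius_lt_one hm' hn
      rw [tsum_geometric_of_lt_one (radius_pos _ _).le this, mul_inv_cancel₀ (by linarith)]) hφ
  simpa using h

/-! ### The Tauberian theorem. -/

/-- A continuous bump supported in `[q₁, q₂]`. -/
noncomputable def bump (q₁ q₂ q : ℝ) : ℝ := max 0 ((q - q₁) * (q₂ - q))

theorem continuous_bump (q₁ q₂ : ℝ) : Continuous (bump q₁ q₂) := by unfold bump; fun_prop

theorem bump_nonneg (q₁ q₂ q : ℝ) : 0 ≤ bump q₁ q₂ q := le_max_left _ _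

theorem mem_of_bump_ne_zero {q₁ q₂ q : ℝ} (h : q₁ < q₂) (hq : bump q₁ q₂ q ≠ 0) : q ∈ Set.Ioo q₁ q₂ := by
  by_contra hn
  apply hq
  unfold bump
  rw [max_eq_left]
  rw [Set.mem_Ioo, not_and_or, not_lt, not_lt] at hn
  rcases hn with hn | hn
  · exact mul_nonpos_of_nonpos_of_nonneg (by linarith) (by linarith)
  · exact mul_nonpos_of_nonneg_of_nonpos (by linarith) (by linarith)

theorem integral_bump_pos {q₁ q₂ : ℝ} (h0 : 0 ≤ q₁) (h : q₁ < q₂) (h1 : q₂ ≤ 1) : 0 < ∫ q in (0 : ℝ)..1, bump q₁ q₂ q := by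
  refine intervalIntegral.integral_pos zero_lt_one (continuous_bump _ _).continuousOn
    (fun _ _ => bump_nonneg _ _ _) ⟨(q₁ + q₂) / 2, ⟨by linarith, by linarith⟩, ?_⟩
  unfold bump
  exact lt_max_of_lt_right (mul_pos (by linarith) (by linarith))

theorem integral_bump_eq_zero {q₁ q₂ κ : ℝ} (h : q₁ < q₂) (hκ0 : 0 ≤ κ) (hκ : κ ≤ q₁) :
    ∫ q in (0 : ℝ)..κ, bump q₁ q₂ q = 0 := by
  refine (intervalIntegral.integral_congr fun q hq => ?_).trans intervalIntegral.integral_zero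
  rw [Set.uIcc_of_le hκ0] at hq
  by_contra hn
  exact absurd (mem_of_bump_ne_zero h hn).1 (not_lt.2 (hq.2.trans hκ))

theorem integral_bump_eq {q₁ q₂ κ : ℝ} (h : q₁ < q₂) (hκ : q₂ ≤ κ) (hκ1 : κ ≤ 1) :
    ∫ q in (0 : ℝ)..κ, bump q₁ q₂ q = ∫ q in (0 : ℝ)..1, bump q₁ q₂ q := by
  have hi := fun a b => (continuous_bump q₁ q₂).intervalIntegrable (μ := volume) a b
  rw [← intervalIntegral.integral_add_adjacent_intervals (hi 0 κ) (hi κ 1)]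
  have : ∫ q in κ..1, bump q₁ q₂ q = 0 := by
    refine (intervalIntegral.integral_congr fun q hq => ?_).trans intervalIntegral.integral_zero
    rw [Set.uIcc_of_le hκ1] at hq
    by_contra hn
    exact absurd (mem_of_bump_ne_zero h hn).2 (not_lt.2 (hκ.trans hq.1))
  rw [this, add_zero]

theorem integral_bump_nonneg {q₁ q₂ κ : ℝ} (hκ0 : 0 ≤ κ) : 0 ≤ ∫ q in (0 : ℝ)..κ, bump q₁ q₂ q :=
  intervalIntegral.integral_nonneg hκ0 fun _ _ => bump_nonneg _ _ _

theorem integral_bump_le {q₁ q₂ κ : ℝ} (hκ1 : κ ≤ 1) :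
    ∫ q in (0 : ℝ)..κ, bump q₁ q₂ q ≤ ∫ q in (0 : ℝ)..1, bump q₁ q₂ q := by
  have hi := fun a b => (continuous_bump q₁ q₂).intervalIntegrable (μ := volume) a b
  rw [← intervalIntegral.integral_add_adjacent_intervals (hi 0 κ) (hi κ 1)]
  exact le_add_of_nonneg_right (intervalIntegral.integral_nonneg hκ1 fun q _ => bump_nonneg _ _ _)

theorem abelMean_mono {φ : ℝ → ℝ} {M : ℝ} (hφ : ∀ q ∈ Set.Icc (0 : ℝ) 1, |φ q| ≤ M)
    (hφ0 : ∀ q, 0 ≤ φ q) {n : ℕ} (hn : 1 ≤ n) {a b : ℕ → ℝ} (ha0 : ∀ t, 0 ≤ a t) (ha1 : ∀ t, a t ≤ 1)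
    (hb0 : ∀ t, 0 ≤ b t) (hb1 : ∀ t, b t ≤ 1) (h : ∀ t, φ (radius 1 n ^ t) ≠ 0 → a t ≤ b t) :
    abelMean φ n a ≤ abelMean φ n b := by
  have hr := radius_lt_one one_pos hn
  refine mul_le_mul_of_nonneg_left ((summable_abelMean hφ hn ha0 ha1).tsum_le_tsum (fun t => ?_)
    (summable_abelMean hφ hn hb0 hb1)) (by linarith)
  by_cases h0 : φ (radius 1 n ^ t) = 0
  · simp [h0]
  · exact mul_le_mul_of_nonneg_left (h t h0)
      (mul_nonneg (pow_nonneg (radius_pos 1 n).le t) (hφ0 _))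

theorem abelMean_const (φ : ℝ → ℝ) (n : ℕ) (c : ℝ) :
    abelMean φ n (fun _ => c) = c * abelMean φ n fun _ => 1 := by
  simp only [abelMean, tsum_mul_right]; ring

/-- Each step in n buys one unit of time in either direction, so comparison holds throughout the
light cone |s - t| ≤ k. -/
theorem le_of_abs_sub_le {u : ℕ → ℕ → ℝ} (h₁ : ∀ n t, u (n + 1) (t + 1) ≤ u n t)
    (h₂ : ∀ n t, u (n + 1) t ≤ u n (t + 1)) (h₃ : ∀ n t, u (n + 1) t ≤ u n t) (k n t s : ℕ)
    (h : s ≤ t + k) (h' : t ≤ s + k) : u (n + k) s ≤ u n t := by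
  induction k generalizing s with
  | zero =>
    obtain rfl : s = t := by omega
    exact le_rfl
  | succ k ih =>
    rw [← add_assoc]
    rcases lt_trichotomy s t with hs | rfl | hs
    · exact (h₂ _ _).trans (ih (s + 1) (by omega) (by omega))
    · exact (h₃ _ _).trans (ih s (by omega) (by omega))
    · obtain ⟨r, rfl⟩ : ∃ r, s = r + 1 := ⟨s - 1, by omega⟩
      exact (h₁ _ _).trans (ih r (by omega) (by omega))

theorem radius_pow_eq (n t : ℕ) : radius 1 n ^ t = Real.exp (-((t : ℝ) / n)) := by
  rw [radius, ← Real.exp_nat_mul]; congr 1; ring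

theorem bounds_of_bump_ne_zero {A B : ℝ} (hAB : A < B) {n t : ℕ} (hn : 1 ≤ n)
    (h : bump (Real.exp (-B)) (Real.exp (-A)) (radius 1 n ^ t) ≠ 0) :
    A * n < t ∧ (t : ℝ) < B * n := by
  have h1 := mem_of_bump_ne_zero (Real.exp_lt_exp.2 (neg_lt_neg hAB)) h
  have hn' : (0 : ℝ) < n := by exact_mod_cast hn
  rw [radius_pow_eq, Set.mem_Ioo, Real.exp_lt_exp, Real.exp_lt_exp, neg_lt_neg_iff, neg_lt_neg_iff,
    div_lt_iff₀ hn', lt_div_iff₀ hn'] at h1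
  exact ⟨h1.2, h1.1⟩

theorem abs_bump_le {q₁ q₂ : ℝ} (h0 : 0 ≤ q₁) (h : q₁ < q₂) (h1 : q₂ ≤ 1) :
    ∀ q ∈ Set.Icc (0 : ℝ) 1, |bump q₁ q₂ q| ≤ 1 := by
  intro q hq
  by_cases hn : bump q₁ q₂ q = 0
  · simp [hn]
  · have := mem_of_bump_ne_zero h hn
    rw [abs_of_nonneg (bump_nonneg _ _ _)]
    exact max_le zero_le_one (mul_le_one₀ (by linarith [hq.2]) (by linarith [this.2])
      (by linarith [hq.1]))

section Tauberian
variable {μ : Measure ℝ} {g : ℝ → ℝ} {u : ℕ → ℕ → ℝ}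
  (hμ : ∀ᵐ v ∂μ, 0 < v) (hg : Integrable g μ) (hg0 : ∀ v, 0 ≤ g v)
  (hu0 : ∀ n t, 0 ≤ u n t) (hu1 : ∀ n t, u n t ≤ 1)
  (h₁ : ∀ n t, u (n + 1) (t + 1) ≤ u n t) (h₂ : ∀ n t, u (n + 1) t ≤ u n (t + 1))
  (h₃ : ∀ n t, u (n + 1) t ≤ u n t)
  (hmom : ∀ η : ℝ, 0 < η → Tendsto
    (fun n : ℕ => (1 - radius η n) * ∑' t, radius η n ^ t * u n t) atTop
      (𝓝 (∫ v, Real.exp (-(η / v)) * g v ∂μ)))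

theorem measurable_exp_neg_inv : Measurable fun v : ℝ => Real.exp (-(1 / v)) := by
  fun_prop

include hμ in
theorem exp_neg_inv_mem : ∀ᵐ v ∂μ, Real.exp (-(1 / v)) ∈ Set.Icc (0 : ℝ) 1 := by
  filter_upwards [hμ] with v hv
  exact ⟨(Real.exp_pos _).le, Real.exp_le_one_iff.2 (by
    have : 0 < 1 / v := by positivity
    linarith)⟩

include hμ hg hu0 hu1 hmom in
theorem tendsto_abelMean_speed {φ : ℝ → ℝ} (hφ : Continuous φ) :
    Tendsto (fun n => abelMean φ n (u n)) atTop
      (𝓝 (∫ v, (∫ q in (0 : ℝ)..Real.exp (-(1 / v)), φ q) * g v ∂μ)) := by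
  refine tendsto_abelMean measurable_exp_neg_inv (exp_neg_inv_mem hμ) hg hu0 hu1 (fun m hm => ?_) hφ
  have h := hmom m (by exact_mod_cast hm)
  have e : ∀ v : ℝ, Real.exp (-(1 / v)) ^ m = Real.exp (-(m / v)) := fun v => by
    rw [← Real.exp_nat_mul]; congr 1; ring
  simpa only [e] using h

theorem measurable_primitive_bump (q₁ q₂ : ℝ) :
    Measurable fun v : ℝ => ∫ q in (0 : ℝ)..Real.exp (-(1 / v)), bump q₁ q₂ q :=
  (intervalIntegral.continuous_primitive
    (fun a b => (continuous_bump q₁ q₂).intervalIntegrable a b) 0).measurable.comp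
    measurable_exp_neg_inv

include hμ hg in
theorem integrable_primitive_bump_mul (q₁ q₂ : ℝ) :
    Integrable (fun v => (∫ q in (0 : ℝ)..Real.exp (-(1 / v)), bump q₁ q₂ q) * g v) μ := by
  refine hg.bdd_mul (c := ∫ q in (0 : ℝ)..1, bump q₁ q₂ q)
    (measurable_primitive_bump q₁ q₂).aestronglyMeasurable ?_
  filter_upwards [exp_neg_inv_mem hμ] with v hv
  rw [Real.norm_of_nonneg (integral_bump_nonneg hv.1)]
  exact integral_bump_le hv.2

-- For v > y the endpoint e^{-1/v} lies beyond the whole bump, so the primitive is the full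
-- integral; elsewhere it is nonnegative. The companion bound places the bump to the right of
-- e^{-1/y} instead, where slower speeds contribute nothing.
include hμ hg hg0 in
theorem le_integral_primitive_bump {q₁ y : ℝ} (hy : 0 < y) (h : q₁ < Real.exp (-(1 / y))) :
    (∫ q in (0 : ℝ)..1, bump q₁ (Real.exp (-(1 / y))) q) * ∫ v in Set.Ioi y, g v ∂μ ≤
      ∫ v, (∫ q in (0 : ℝ)..Real.exp (-(1 / v)), bump q₁ (Real.exp (-(1 / y))) q) * g v ∂μ := by
  rw [← integral_const_mul, ← integral_indicator measurableSet_Ioi]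
  refine integral_mono_ae ((hg.const_mul _).indicator measurableSet_Ioi)
    (integrable_primitive_bump_mul hμ hg _ _) ?_
  filter_upwards [exp_neg_inv_mem hμ] with v hv
  by_cases hvy : v ∈ Set.Ioi y
  · rw [Set.indicator_of_mem hvy, integral_bump_eq h _ hv.2]
    exact Real.exp_le_exp.2 (neg_le_neg (one_div_le_one_div_of_le hy (le_of_lt hvy)))
  · rw [Set.indicator_of_notMem hvy]
    exact mul_nonneg (integral_bump_nonneg hv.1) (hg0 v)

include hμ hg hg0 in
theorem integral_primitive_bump_le {q₂ y : ℝ} (h : Real.exp (-(1 / y)) < q₂) :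
    ∫ v, (∫ q in (0 : ℝ)..Real.exp (-(1 / v)), bump (Real.exp (-(1 / y))) q₂ q) * g v ∂μ ≤
      (∫ q in (0 : ℝ)..1, bump (Real.exp (-(1 / y))) q₂ q) * ∫ v in Set.Ioi y, g v ∂μ := by
  rw [← integral_const_mul, ← integral_indicator measurableSet_Ioi]
  refine integral_mono_ae (integrable_primitive_bump_mul hμ hg _ _)
    ((hg.const_mul _).indicator measurableSet_Ioi) ?_
  filter_upwards [exp_neg_inv_mem hμ, hμ] with v hv hv0
  by_cases hvy : v ∈ Set.Ioi y
  · rw [Set.indicator_of_mem hvy]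
    exact mul_le_mul_of_nonneg_right (integral_bump_le hv.2) (hg0 v)
  · rw [Set.indicator_of_notMem hvy, integral_bump_eq_zero h hv.1, zero_mul]
    exact Real.exp_le_exp.2 (neg_le_neg (one_div_le_one_div_of_le hv0 (not_lt.1 hvy)))

-- The value u (n t) t dominates u N s for all s in a window around t once N exceeds n t by δt. A
-- bump-weighted Abel mean over that window is thus at most u (n t) t times its normalisation, while
-- its limit captures all speeds above x + δ.
include hμ hg hg0 hu0 hu1 h₁ h₂ h₃ hmom in
theorem eventually_lt_of_lt_integral {x δ c : ℝ} (hx : 0 < x) (hδ : 0 < δ) {n : ℕ → ℕ}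
    (hn : Tendsto (fun t : ℕ => (n t : ℝ) / t) atTop (𝓝 x))
    (hc : c < ∫ v in Set.Ioi (x + δ), g v ∂μ) : ∀ᶠ t in atTop, c < u (n t) t := by
  set y := x + δ with hy
  have hy0 : 0 < y := by positivity
  -- The bump confines s to N/y < s < BN. With N ∼ yt this is between about t and (1 + δ/2)t,
  -- eventually within δt of t.
  set B := (1 + δ / 2) / y with hB
  have hAB : 1 / y < B := div_lt_div_of_pos_right (by linarith) hy0
  have hq := Real.exp_lt_exp.2 (neg_lt_neg hAB)
  have hq1 : Real.exp (-(1 / y)) ≤ 1 := Real.exp_le_one_iff.2 (by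
    have : 0 < 1 / y := by positivity
    linarith)
  set N : ℕ → ℕ := fun t => n t + ⌈δ * t⌉₊ with hN
  have hNt : Tendsto (fun t : ℕ => (N t : ℝ) / t) atTop (𝓝 y) := by
    have := hn.add ((tendsto_nat_ceil_mul_div_atTop hδ.le).comp tendsto_natCast_atTop_atTop)
    refine this.congr fun t => ?_
    simp [hN, add_div]
  have hNinf : Tendsto N atTop atTop := by
    refine tendsto_atTop_mono (fun t => Nat.le_add_left _ _) ?_
    exact tendsto_nat_ceil_atTop.comp (tendsto_natCast_atTop_atTop.const_mul_atTop hδ)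
  set φ := bump (Real.exp (-B)) (Real.exp (-(1 / y))) with hφ
  have hφc : Continuous φ := continuous_bump _ _
  have hI := integral_bump_pos (Real.exp_pos _).le hq hq1
  have l1 := (tendsto_abelMean_speed hμ hg hu0 hu1 hmom hφc).comp hNinf
  have l2 := (tendsto_abelMean_one hφc).comp hNinf
  have l3 := (l1.div l2 hI.ne').eventually_const_lt (lt_of_lt_of_le hc
    ((le_div_iff₀ hI).2 (by
      rw [mul_comm]; exact le_integral_primitive_bump hμ hg hg0 hy0 hq)))
  have e1 : ∀ᶠ t : ℕ in atTop, (1 - δ) * y < (N t : ℝ) / t :=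
    hNt.eventually_const_lt (by nlinarith)
  have e2 : ∀ᶠ t : ℕ in atTop, (N t : ℝ) / t < (1 + δ) / (1 + δ / 2) * y :=
    hNt.eventually_lt_const (lt_mul_of_one_lt_left hy0 ((one_lt_div (by positivity)).2 (by linarith)))
  filter_upwards [l3, l2.eventually_const_lt hI, e1, e2, hNinf.eventually_ge_atTop 1,
    eventually_ge_atTop 1] with t h3 hp h1 h2 hN1 ht
  have ht' : (0 : ℝ) < t := by exact_mod_cast ht
  rw [lt_div_iff₀ ht'] at h1
  rw [div_lt_iff₀ ht'] at h2
  refine lt_of_lt_of_le h3 ((div_le_iff₀ hp).2 ?_)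
  simp only [Function.comp]
  rw [← abelMean_const]
  refine abelMean_mono (abs_bump_le (Real.exp_pos _).le hq hq1) (bump_nonneg _ _) hN1 (hu0 _) (hu1 _)
    (fun _ => hu0 _ _) (fun _ => hu1 _ _) fun s hs => ?_
  have hs := bounds_of_bump_ne_zero hAB hN1 hs
  have hk := Nat.le_ceil (δ * t)
  refine le_of_abs_sub_le h₁ h₂ h₃ _ _ _ _ ?_ ?_
  · have : (s : ℝ) ≤ t + ⌈δ * t⌉₊ := by
      have h4 : B * N t ≤ (1 + δ) * t := by
        rw [hB, div_mul_eq_mul_div, div_le_iff₀ hy0]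
        have : (1 + δ / 2) * (N t : ℝ) ≤ (1 + δ / 2) * ((1 + δ) / (1 + δ / 2) * y * t) := by gcongr
        refine this.trans_eq ?_
        field_simp
      linarith [hs.2]
    exact_mod_cast this
  · have : (t : ℝ) ≤ s + ⌈δ * t⌉₊ := by
      have h4 : (1 - δ) * t ≤ 1 / y * N t := by
        rw [div_mul_eq_mul_div, le_div_iff₀ hy0]; linarith
      linarith [hs.1]
    exact_mod_cast this

include hμ hg hg0 hu0 hu1 h₁ h₂ h₃ hmom in
theorem eventually_lt_of_integral_lt {x δ c : ℝ} (hδ : 0 < δ) (hδ1 : δ ≤ 1) (hδx : δ < x) {n : ℕ → ℕ}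
    (hn : Tendsto (fun t : ℕ => (n t : ℝ) / t) atTop (𝓝 x))
    (hc : ∫ v in Set.Ioi (x - δ), g v ∂μ < c) : ∀ᶠ t in atTop, u (n t) t < c := by
  set y := x - δ with hy
  have hy0 : 0 < y := sub_pos.2 hδx
  -- Mirror choice: AN < s < N/y, with N lowered by δt, now keeps s in the light cone where u (n t)
  -- t is the smaller value.
  set A := (1 - δ / 2) / y with hA
  have hA0 : 0 ≤ A := div_nonneg (by linarith) hy0.le
  have hAB : A < 1 / y := div_lt_div_of_pos_right (by linarith) hy0
  have hq := Real.exp_lt_exp.2 (neg_lt_neg hAB)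
  have hq1 : Real.exp (-A) ≤ 1 := Real.exp_le_one_iff.2 (by linarith)
  set N : ℕ → ℕ := fun t => n t - ⌈δ * t⌉₊ with hN
  have hlt : ∀ᶠ t : ℕ in atTop, ⌈δ * t⌉₊ ≤ n t := by
    have hk := (tendsto_nat_ceil_mul_div_atTop hδ.le).comp tendsto_natCast_atTop_atTop
    filter_upwards [hk.eventually_lt hn hδx, eventually_ge_atTop 1] with t h ht
    have ht' : (0 : ℝ) < t := by exact_mod_cast ht
    have := (div_lt_div_iff_of_pos_right ht').1 h
    exact_mod_cast this.le
  have hNt : Tendsto (fun t : ℕ => (N t : ℝ) / t) atTop (𝓝 y) := by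
    have := hn.sub ((tendsto_nat_ceil_mul_div_atTop hδ.le).comp tendsto_natCast_atTop_atTop)
    refine this.congr' ?_
    filter_upwards [hlt] with t ht
    simp [hN, Nat.cast_sub ht, sub_div]
  have hNinf : Tendsto N atTop atTop := by
    rw [← tendsto_natCast_atTop_iff (R := ℝ)]
    have := hNt.pos_mul_atTop hy0 (tendsto_natCast_atTop_atTop (R := ℝ))
    refine this.congr' ?_
    filter_upwards [eventually_ge_atTop 1] with t ht
    have ht' : (0 : ℝ) < t := by exact_mod_cast ht
    exact div_mul_cancel₀ _ ht'.ne'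
  set φ := bump (Real.exp (-(1 / y))) (Real.exp (-A)) with hφ
  have hφc : Continuous φ := continuous_bump _ _
  have hI := integral_bump_pos (Real.exp_pos _).le hq hq1
  have l1 := (tendsto_abelMean_speed hμ hg hu0 hu1 hmom hφc).comp hNinf
  have l2 := (tendsto_abelMean_one hφc).comp hNinf
  have l3 := (l1.div l2 hI.ne').eventually_lt_const (lt_of_le_of_lt
    ((div_le_iff₀ hI).2 (by
      rw [mul_comm]; exact integral_primitive_bump_le hμ hg hg0 hq)) hc)
  have e2 : ∀ᶠ t : ℕ in atTop, (N t : ℝ) / t < (1 + δ) * y :=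
    hNt.eventually_lt_const (by nlinarith)
  have e1 : ∀ᶠ t : ℕ in atTop, (1 - δ) / (1 - δ / 2) * y < (N t : ℝ) / t :=
    hNt.eventually_const_lt (mul_lt_of_lt_one_left hy0 ((div_lt_one (by linarith)).2 (by linarith)))
  filter_upwards [l3, l2.eventually_const_lt hI, e1, e2, hNinf.eventually_ge_atTop 1,
    eventually_ge_atTop 1, hlt] with t h3 hp h1 h2 hN1 ht hle
  have ht' : (0 : ℝ) < t := by exact_mod_cast ht
  rw [lt_div_iff₀ ht'] at h1
  rw [div_lt_iff₀ ht'] at h2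
  refine lt_of_le_of_lt ((le_div_iff₀ hp).2 ?_) h3
  simp only [Function.comp]
  rw [← abelMean_const]
  refine abelMean_mono (abs_bump_le (Real.exp_pos _).le hq hq1) (bump_nonneg _ _) hN1
    (fun _ => hu0 _ _) (fun _ => hu1 _ _) (hu0 _) (hu1 _) fun s hs => ?_
  have hs := bounds_of_bump_ne_zero hAB hN1 hs
  have hk := Nat.le_ceil (δ * t)
  have hnN : N t + ⌈δ * t⌉₊ = n t := Nat.sub_add_cancel hle
  rw [← hnN]
  refine le_of_abs_sub_le h₁ h₂ h₃ _ _ _ _ ?_ ?_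
  · have : (t : ℝ) ≤ s + ⌈δ * t⌉₊ := by
      have h4 : (1 - δ) * t ≤ A * N t := by
        rw [hA, div_mul_eq_mul_div, le_div_iff₀ hy0]
        have h5 : 0 < 1 - δ / 2 := by linarith
        have : (1 - δ / 2) * ((1 - δ) / (1 - δ / 2) * y * t) ≤ (1 - δ / 2) * (N t : ℝ) := by gcongr
        have h6 : (1 - δ / 2) * ((1 - δ) / (1 - δ / 2)) = 1 - δ := by
          rw [mul_div_assoc', mul_comm, mul_div_assoc, div_self h5.ne', mul_one]
        calc _ = (1 - δ / 2) * ((1 - δ) / (1 - δ / 2)) * y * t := by rw [h6]; ring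
          _ = (1 - δ / 2) * ((1 - δ) / (1 - δ / 2) * y * t) := by ring
          _ ≤ _ := this
      linarith [hs.1]
    exact_mod_cast this
  · have : (s : ℝ) ≤ t + ⌈δ * t⌉₊ := by
      have h4 : 1 / y * N t ≤ (1 + δ) * t := by
        rw [div_mul_eq_mul_div, div_le_iff₀ hy0]; linarith
      linarith [hs.2]
    exact_mod_cast this

include hg in
theorem continuous_integral_Ioi [NullSingletonClass μ] : Continuous fun y => ∫ v in Set.Ioi y, g v ∂μ := by
  have h := intervalIntegral.continuous_primitive (μ := μ) (fun a b => hg.intervalIntegrable (a := a) (b := b)) 0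
  have e : (fun y => ∫ v in Set.Ioi y, g v ∂μ) =
      fun y => (∫ v in Set.Ioi 0, g v ∂μ) - ∫ v in (0 : ℝ)..y, g v ∂μ := by
    funext y
    rw [eq_sub_iff_add_eq, add_comm]
    exact intervalIntegral.integral_interval_add_Ioi hg.integrableOn hg.integrableOn
  rw [e]
  exact continuous_const.sub h

include hμ hg hg0 hu0 hu1 h₁ h₂ h₃ hmom in
/-- A Tauberian theorem: convergence of the Abel means of `u n` at scale `n` implies convergence of
`u (n t) t` along `n t ∼ x t`, under the monotonicity of a walk with unit speed. -/
theorem tendsto_of_tendsto_abelMean [NullSingletonClass μ] {x : ℝ} (hx : 0 < x) {n : ℕ → ℕ}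
    (hn : Tendsto (fun t : ℕ => (n t : ℝ) / t) atTop (𝓝 x)) :
    Tendsto (fun t => u (n t) t) atTop (𝓝 (∫ v in Set.Ioi x, g v ∂μ)) := by
  -- Without atoms the tail integral is continuous, so the margin δ in the two one-sided bounds can
  -- shrink to zero.
  have hG := continuous_integral_Ioi (μ := μ) hg
  have hp : Tendsto (fun δ : ℝ => x + δ) (𝓝[>] 0) (𝓝 x) := by
    have : Tendsto (fun δ : ℝ => x + δ) (𝓝 0) (𝓝 (x + 0)) :=
      tendsto_const_nhds.add tendsto_id
    rw [add_zero] at this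
    exact this.mono_left nhdsWithin_le_nhds
  have hm : Tendsto (fun δ : ℝ => x - δ) (𝓝[>] 0) (𝓝 x) := by
    have : Tendsto (fun δ : ℝ => x - δ) (𝓝 0) (𝓝 (x - 0)) :=
      tendsto_const_nhds.sub tendsto_id
    rw [sub_zero] at this
    exact this.mono_left nhdsWithin_le_nhds
  have hpos : ∀ᶠ δ : ℝ in 𝓝[>] 0, 0 < δ := self_mem_nhdsWithin
  have hlt : ∀ c : ℝ, 0 < c → ∀ᶠ δ : ℝ in 𝓝[>] 0, δ < c := fun c hc =>
    nhdsWithin_le_nhds (Iio_mem_nhds hc)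
  refine tendsto_order.2 ⟨fun c hc => ?_, fun c hc => ?_⟩
  · obtain ⟨δ, hδ, hc'⟩ := (hpos.and (((hG.tendsto x).comp hp).eventually_const_lt hc)).exists
    exact eventually_lt_of_lt_integral hμ hg hg0 hu0 hu1 h₁ h₂ h₃ hmom hx hδ hn hc'
  · obtain ⟨δ, ⟨hδ, h1, h2⟩, hc'⟩ := ((hpos.and ((hlt 1 one_pos).and (hlt x hx))).and
      (((hG.tendsto x).comp hm).eventually_lt_const hc)).exists
    exact eventually_lt_of_integral_lt hμ hg hg0 hu0 hu1 h₁ h₂ h₃ hmom hδ h1.le h2 hn hc'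

end Tauberian

/-! ### Weak convergence of the rescaled law. -/

theorem isPiSystem_Ioc_ne (z : ℝ) :
    IsPiSystem {s : Set ℝ | ∃ a b : ℝ, a ≠ z ∧ b ≠ z ∧ s = Set.Ioc a b} := by
  rintro _ ⟨a, b, ha, hb, rfl⟩ _ ⟨c, d, hc, hd, rfl⟩ -
  refine ⟨max a c, min b d, ?_, ?_, Set.Ioc_inter_Ioc⟩
  · rcases max_choice a c with h | h <;> rwa [h]
  · rcases min_choice b d with h | h <;> rwa [h]

/-- Convergence of the distribution functions off one point implies weak convergence. -/
theorem tendsto_probabilityMeasure_of_tendsto_Iic {μ : ℕ → ProbabilityMeasure ℝ}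
    {ν : ProbabilityMeasure ℝ} {z : ℝ}
    (h : ∀ x, x ≠ z → Tendsto (fun t => (μ t : Measure ℝ).real (Set.Iic x)) atTop
      (𝓝 ((ν : Measure ℝ).real (Set.Iic x)))) : Tendsto μ atTop (𝓝 ν) := by
  refine (isPiSystem_Ioc_ne z).tendsto_probabilityMeasure_of_tendsto_of_mem ?_ ?_ ?_
  · rintro _ ⟨a, b, -, -, rfl⟩
    exact measurableSet_Ioc
  · intro u hu x hx
    obtain ⟨ε, hε, hb⟩ := Metric.isOpen_iff.1 hu x hx
    obtain ⟨a, ha, haz⟩ := (Set.Ioo_infinite (sub_lt_self x hε)).exists_notMem_finset {z}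
    obtain ⟨b, hb', hbz⟩ := (Set.Ioo_infinite (lt_add_of_pos_right x hε)).exists_notMem_finset {z}
    rw [Finset.mem_singleton] at haz hbz
    refine ⟨_, ⟨a, b, haz, hbz, rfl⟩, Ioc_mem_nhds ha.2 hb'.1, fun y hy => hb ?_⟩
    rw [Real.ball_eq_Ioo]
    exact ⟨ha.1.trans hy.1, hy.2.trans_lt hb'.2⟩
  · rintro _ ⟨a, b, ha, hb, rfl⟩
    have e : ∀ ρ : ProbabilityMeasure ℝ, a ≤ b → ((ρ (Set.Ioc a b) : NNReal) : ℝ) =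
        (ρ : Measure ℝ).real (Set.Iic b) - (ρ : Measure ℝ).real (Set.Iic a) := fun ρ hab => by
      rw [← measureReal_sdiff (Set.Iic_subset_Iic.2 hab) measurableSet_Iic, Set.Iic_sdiff_Iic]
      rfl
    rcases le_total a b with hab | hab
    · rw [← NNReal.tendsto_coe]
      simp only [e _ hab]
      exact (h b hb).sub (h a ha)
    · simp [Set.Ioc_eq_empty (not_lt.2 hab)]

theorem rescaledLaw_apply (σp σm : ℝ) (α β : ℂ) (t : ℕ) {s : Set ℝ} (hs : MeasurableSet s) :
    rescaledLaw σp σm α β t s = ENNReal.ofReal (∑' x : ℤ,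
      Set.indicator {x : ℤ | (x : ℝ) / t ∈ s} (prob σp σm α β t) x) := by
  have hm : Measurable fun x : ℤ => (x : ℝ) / (t : ℝ) := measurable_of_countable _
  rw [rescaledLaw, positionLaw, Measure.map_apply hm hs, Measure.sum_apply _ (hm hs),
    ENNReal.ofReal_tsum_of_nonneg (fun x => Set.indicator_nonneg (fun x _ => prob_nonneg _ _ _ _ _ _) x)
      ((summable_prob σp σm α β t).indicator _)]
  refine tsum_congr fun x => ?_
  rw [Measure.smul_apply, Measure.dirac_apply' _ (hm hs)]
  by_cases hx : (x : ℝ) / t ∈ s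
  · have h1 : x ∈ (fun x : ℤ => (x : ℝ) / (t : ℝ)) ⁻¹' s := hx
    have h2 : x ∈ {x : ℤ | (x : ℝ) / t ∈ s} := hx
    rw [Set.indicator_of_mem h1, Set.indicator_of_mem h2]; simp
  · have h1 : x ∉ (fun x : ℤ => (x : ℝ) / (t : ℝ)) ⁻¹' s := hx
    have h2 : x ∉ {x : ℤ | (x : ℝ) / t ∈ s} := hx
    rw [Set.indicator_of_notMem h1, Set.indicator_of_notMem h2]; simp

theorem rescaledLaw_real (σp σm : ℝ) (α β : ℂ) (t : ℕ) {s : Set ℝ} (hs : MeasurableSet s) :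
    (rescaledLaw σp σm α β t).real s =
      ∑' x : ℤ, Set.indicator {x : ℤ | (x : ℝ) / t ∈ s} (prob σp σm α β t) x := by
  rw [Measure.real, rescaledLaw_apply _ _ _ _ _ hs, ENNReal.toReal_ofReal]
  exact tsum_nonneg fun x => Set.indicator_nonneg (fun x _ => prob_nonneg _ _ _ _ _ _) x

/-- This includes t = 0, where division by zero gives 0 and the law is the unit mass at the origin.
-/
theorem isProbabilityMeasure_rescaledLaw (σp σm : ℝ) {α β : ℂ} (h : ‖α‖ ^ 2 + ‖β‖ ^ 2 = 1) (t : ℕ) :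
    IsProbabilityMeasure (rescaledLaw σp σm α β t) := by
  refine ⟨?_⟩
  rw [rescaledLaw_apply _ _ _ _ _ MeasurableSet.univ]
  simp [tsum_prob σp σm α β h t]

theorem rescaledLaw_real_Ioi (σp σm : ℝ) (α β : ℂ) {t : ℕ} (ht : 1 ≤ t) {x : ℝ} (hx : 0 < x) :
    (rescaledLaw σp σm α β t).real (Set.Ioi x) = tail σp σm α β (⌊x * t⌋₊ : ℕ) t := by
  have ht' : (0 : ℝ) < t := by exact_mod_cast ht
  have hi : Function.Injective fun k : ℕ => ((⌊x * t⌋₊ : ℕ) : ℤ) + 1 + (k : ℤ) := fun k l h => by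
    have : ((⌊x * t⌋₊ : ℕ) : ℤ) + 1 + (k : ℤ) = ((⌊x * t⌋₊ : ℕ) : ℤ) + 1 + (l : ℤ) := h
    omega
  have key : ∀ y : ℤ, (y : ℝ) / t ∈ Set.Ioi x ↔ ((⌊x * t⌋₊ : ℕ) : ℤ) + 1 ≤ y := fun y => by
    rw [Set.mem_Ioi, lt_div_iff₀ ht', Int.natCast_floor_eq_floor (by positivity), Int.add_one_le_iff,
      Int.floor_lt]
  rw [rescaledLaw_real _ _ _ _ _ measurableSet_Ioi, tail, ← hi.tsum_eq]
  · refine tsum_congr fun k => Set.indicator_of_mem ?_ _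
    exact (key _).2 (by omega)
  · intro y hy
    have h1 := (key y).1 (Set.mem_of_indicator_ne_zero (Function.mem_support.1 hy) :
      y ∈ {y : ℤ | (y : ℝ) / t ∈ _})
    exact ⟨(y - ((⌊x * t⌋₊ : ℕ) + 1)).toNat, by
      show ((⌊x * t⌋₊ : ℕ) : ℤ) + 1 + ((y - ((⌊x * t⌋₊ : ℕ) + 1)).toNat : ℤ) = y
      omega⟩

theorem rescaledLaw_real_Iic (σp σm : ℝ) (α β : ℂ) {t : ℕ} (ht : 1 ≤ t) {x : ℝ} (hx : x < 0) :
    (rescaledLaw σp σm α β t).real (Set.Iic x) =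
      tail (Real.pi - σm) (Real.pi - σp) β α (⌈-x * t⌉₊ - 1 : ℕ) t := by
  have ht' : (0 : ℝ) < t := by exact_mod_cast ht
  -- Being at or below xt means that the reflected walk is at or above m, that is, beyond m - 1.
  -- Since x < 0, m is at least 1 and the natural subtraction is exact.
  set m := ⌈-x * t⌉₊ with hm
  have hm1 : 1 ≤ m := Nat.one_le_ceil_iff.2 (mul_pos (neg_pos.2 hx) ht')
  have hi : Function.Injective fun k : ℕ => -(((m - 1 : ℕ) : ℤ) + 1 + (k : ℤ)) := fun k l h => by
    have : -(((m - 1 : ℕ) : ℤ) + 1 + (k : ℤ)) = -(((m - 1 : ℕ) : ℤ) + 1 + (l : ℤ)) := h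
    omega
  have key : ∀ y : ℤ, (y : ℝ) / t ∈ Set.Iic x ↔ (m : ℤ) ≤ -y := fun y => by
    rw [Set.mem_Iic, div_le_iff₀ ht', hm,
      Int.natCast_ceil_eq_ceil (mul_nonneg (neg_pos.2 hx).le ht'.le), Int.ceil_le]
    push_cast
    constructor <;> intro h <;> linarith
  rw [rescaledLaw_real _ _ _ _ _ measurableSet_Iic, tail, ← hi.tsum_eq]
  · refine tsum_congr fun k => ?_
    rw [prob_reflect]
    refine Set.indicator_of_mem (?_ : _ ∈ {y : ℤ | (y : ℝ) / t ∈ Set.Iic x}) _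
    exact (key _).2 (by omega)
  · intro y hy
    have h1 := (key y).1 (Set.mem_of_indicator_ne_zero (Function.mem_support.1 hy) :
      y ∈ {y : ℤ | (y : ℝ) / t ∈ _})
    exact ⟨(-y - m).toNat, by
      show -(((m - 1 : ℕ) : ℤ) + 1 + ((-y - m).toNat : ℤ)) = y
      omega⟩

theorem density_nonneg {a b : ℝ} (hab : a ^ 2 + b ^ 2 = 1) (σp σm φ x : ℝ) :
    0 ≤ density σp σm a b φ x := by
  have h := weight_mul_konnoDensity_nonneg hab σp σm φ 0 x
  rwa [sub_zero] at h

theorem density_eq_zero (σp σm a b φ : ℝ) {x : ℝ} (hx : 1 / √2 ≤ |x|) : density σp σm a b φ x = 0 := by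
  rw [density, konnoDensity_eq_zero hx, mul_zero]

theorem density_reflect (σp σm a b φ : ℝ) {v : ℝ} (hv : 0 < v) :
    density (Real.pi - σm) (Real.pi - σp) b a (-φ) v = density σp σm a b φ (-v) := by
  rw [density, density, weight_reflect _ _ _ _ _ hv, konnoDensity_neg]

theorem density_eq_zero_of_notMem_speeds (σp σm a b φ : ℝ) {x : ℝ} (h0 : 0 < x) (hx : x ∉ speeds) :
    density σp σm a b φ x = 0 := by
  refine density_eq_zero _ _ _ _ _ ?_
  rw [abs_of_pos h0]
  by_contra h
  exact hx ⟨h0, not_le.1 h⟩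

theorem speeds_subset : speeds ⊆ Set.Ioi 0 := fun _ hv => hv.1

section Law
variable {σp σm a b φ₁ φ₂ : ℝ} {α β : ℂ} (hab : a ^ 2 + b ^ 2 = 1)
  (hα : α = a * Complex.exp (Complex.I * φ₁)) (hβ : β = b * Complex.exp (Complex.I * φ₂))
include hab hα hβ

theorem integrableOn_density_Ioi : IntegrableOn (density σp σm a b (φ₁ - φ₂)) (Set.Ioi 0) :=
  (integrableOn_density hab hα hβ).of_forall_sdiff_eq_zero measurableSet_Ioi fun _ hx =>
    density_eq_zero_of_notMem_speeds _ _ _ _ _ hx.1 hx.2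

theorem integrableOn_density_Ioi_neg :
    IntegrableOn (fun v => density σp σm a b (φ₁ - φ₂) (-v)) (Set.Ioi 0) := by
  have h := integrableOn_density_Ioi (σp := Real.pi - σm) (σm := Real.pi - σp)
    (by rw [add_comm]; exact hab : b ^ 2 + a ^ 2 = 1) hβ hα
  refine h.congr_fun (fun v hv => ?_) measurableSet_Ioi
  rw [← neg_sub φ₁ φ₂]
  exact density_reflect _ _ _ _ _ hv

theorem integrable_density : Integrable (density σp σm a b (φ₁ - φ₂)) := by
  rw [← integrableOn_univ, ← Set.Iic_union_Ioi (a := (0 : ℝ)), integrableOn_union]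
  refine ⟨?_, integrableOn_density_Ioi hab hα hβ⟩
  have h := integrableOn_density_Ioi_neg (σp := σp) (σm := σm) hab hα hβ
  rw [integrableOn_Iic_iff_integrableOn_Iio]
  have h2 := (integrable_indicator_iff measurableSet_Ioi).2 h
  have h3 := h2.comp_neg
  rw [← integrable_indicator_iff measurableSet_Iio]
  refine h3.congr (Eventually.of_forall fun x => ?_)
  by_cases hx : x < 0
  · have h1 : -x ∈ Set.Ioi (0 : ℝ) := neg_pos.2 hx
    simp [hx]
  · simp [hx]

theorem integral_density :
    ∫ v, density σp σm a b (φ₁ - φ₂) v = 1 - localizedMass σp σm a b (φ₁ - φ₂) := by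
  have hi := integrable_density (σp := σp) (σm := σm) hab hα hβ
  rw [← integral_density_add hab hα hβ, add_comm,
    ← setIntegral_eq_of_subset_of_forall_sdiff_eq_zero measurableSet_Ioi speeds_subset
      (f := density σp σm a b (φ₁ - φ₂)) fun x hx => density_eq_zero_of_notMem_speeds _ _ _ _ _ hx.1 hx.2,
    ← setIntegral_eq_of_subset_of_forall_sdiff_eq_zero measurableSet_Ioi speeds_subset
      (f := fun v => density σp σm a b (φ₁ - φ₂) (-v)) fun x hx => by
        rw [← density_reflect _ _ _ _ _ hx.1]
        exact density_eq_zero_of_notMem_speeds _ _ _ _ _ hx.1 hx.2,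
    integral_comp_neg_Ioi, neg_zero, intervalIntegral.integral_Iic_add_Ioi hi.integrableOn hi.integrableOn]

theorem limitLaw_apply_of_zero_notMem {s : Set ℝ} (hs : MeasurableSet s) (h0 : (0 : ℝ) ∉ s) :
    limitLaw σp σm a b (φ₁ - φ₂) s = ENNReal.ofReal (∫ v in s, density σp σm a b (φ₁ - φ₂) v) := by
  rw [limitLaw, Measure.add_apply, Measure.smul_apply, Measure.dirac_apply' _ hs,
    Set.indicator_of_notMem h0, smul_zero, zero_add, withDensity_apply _ hs,
    ofReal_integral_eq_lintegral_ofReal (integrable_density hab hα hβ).integrableOn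
      (Eventually.of_forall fun v => density_nonneg hab _ _ _ _)]
  rfl

theorem isProbabilityMeasure_limitLaw : IsProbabilityMeasure (limitLaw σp σm a b (φ₁ - φ₂)) := by
  refine ⟨?_⟩
  have h : ∫⁻ v, ENNReal.ofReal (weight σp σm a b (φ₁ - φ₂) v * konnoDensity v (1 / √2)) =
      ENNReal.ofReal (1 - localizedMass σp σm a b (φ₁ - φ₂)) := by
    rw [← integral_density (σp := σp) (σm := σm) hab hα hβ,
      ofReal_integral_eq_lintegral_ofReal (integrable_density hab hα hβ)
      (Eventually.of_forall fun v => density_nonneg hab _ _ _ _)]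
    rfl
  rw [limitLaw, Measure.add_apply, Measure.smul_apply, measure_univ, smul_eq_mul, mul_one,
    withDensity_apply _ MeasurableSet.univ, setLIntegral_univ, h, ← ENNReal.ofReal_add
    (localizedMass_nonneg hab _ _ _) (by linarith [localizedMass_lt_one hab σp σm (φ₁ - φ₂)])]
  simp

theorem limitLaw_real_of_zero_notMem {s : Set ℝ} (hs : MeasurableSet s) (h0 : (0 : ℝ) ∉ s) :
    (limitLaw σp σm a b (φ₁ - φ₂)).real s = ∫ v in s, density σp σm a b (φ₁ - φ₂) v := by
  rw [Measure.real, limitLaw_apply_of_zero_notMem hab hα hβ hs h0, ENNReal.toReal_ofReal]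
  exact setIntegral_nonneg hs fun v _ => density_nonneg hab _ _ _ _

theorem tendsto_tail {x : ℝ} (hx : 0 < x) {n : ℕ → ℕ}
    (hn : Tendsto (fun t : ℕ => (n t : ℝ) / t) atTop (𝓝 x)) :
    Tendsto (fun t => tail σp σm α β (n t) t) atTop
      (𝓝 (∫ v in Set.Ioi x, density σp σm a b (φ₁ - φ₂) v)) := by
  have h1 := norm_sq_add_norm_sq a b φ₁ φ₂ α β hab hα hβ
  -- Restricting Lebesgue measure to `speeds` makes every v positive and loses nothing, as the
  -- density vanishes at the other positive speeds.
  have h := tendsto_of_tendsto_abelMean (μ := volume.restrict speeds)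
    (g := density σp σm a b (φ₁ - φ₂)) (u := fun n t => tail σp σm α β n t)
    ((ae_restrict_mem measurableSet_speeds).mono fun v hv => hv.1) (integrableOn_density hab hα hβ)
    (density_nonneg hab _ _ _) (fun _ _ => tail_nonneg _ _ _ _ _ _)
    (fun _ _ => tail_le_one _ _ _ _ h1 _ _)
    (fun n t => by simpa using tail_succ_succ_le σp σm α β n t)
    (fun n t => by simpa using tail_succ_le_tail_succ σp σm α β n t)
    (fun n t => by simpa using tail_succ_le σp σm α β n t)
    (fun η hη => tendsto_abel_tail hab hα hβ hη) hx hn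
  rw [Measure.restrict_restrict measurableSet_Ioi] at h
  rwa [setIntegral_eq_of_subset_of_forall_sdiff_eq_zero measurableSet_Ioi Set.inter_subset_left
    fun v hv => density_eq_zero_of_notMem_speeds _ _ _ _ _ (hx.trans hv.1) fun hm => hv.2 ⟨hv.1, hm⟩]

theorem tendsto_rescaledLaw_real_Ioi {x : ℝ} (hx : 0 < x) :
    Tendsto (fun t => (rescaledLaw σp σm α β t).real (Set.Ioi x)) atTop
      (𝓝 ((limitLaw σp σm a b (φ₁ - φ₂)).real (Set.Ioi x))) := by
  rw [limitLaw_real_of_zero_notMem hab hα hβ measurableSet_Ioi (not_lt.2 hx.le)]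
  refine (tendsto_tail hab hα hβ hx ((tendsto_nat_floor_mul_div_atTop hx.le).comp
    tendsto_natCast_atTop_atTop)).congr' ?_
  filter_upwards [eventually_ge_atTop 1] with t ht
  exact (rescaledLaw_real_Ioi _ _ _ _ ht hx).symm

theorem tendsto_rescaledLaw_real_Iic {x : ℝ} (hx : x < 0) :
    Tendsto (fun t => (rescaledLaw σp σm α β t).real (Set.Iic x)) atTop
      (𝓝 ((limitLaw σp σm a b (φ₁ - φ₂)).real (Set.Iic x))) := by
  have hx' : 0 < -x := neg_pos.2 hx
  have e : ∫ v in Set.Iic x, density σp σm a b (φ₁ - φ₂) v =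
      ∫ v in Set.Ioi (-x), density (Real.pi - σm) (Real.pi - σp) b a (φ₂ - φ₁) v := by
    conv_lhs => rw [← neg_neg x]
    rw [← integral_comp_neg_Ioi]
    refine setIntegral_congr_fun measurableSet_Ioi fun v hv => ?_
    rw [← neg_sub φ₁ φ₂]
    exact (density_reflect _ _ _ _ _ (hx'.trans hv)).symm
  rw [limitLaw_real_of_zero_notMem hab hα hβ measurableSet_Iic (not_le.2 hx), e]
  have hn : Tendsto (fun t : ℕ => ((⌈-x * t⌉₊ - 1 : ℕ) : ℝ) / t) atTop (𝓝 (-x)) := by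
    have h := ((tendsto_nat_ceil_mul_div_atTop hx'.le).comp (tendsto_natCast_atTop_atTop (R := ℝ))).sub
      tendsto_one_div_atTop_nhds_zero_nat
    rw [sub_zero] at h
    refine h.congr' ?_
    filter_upwards [eventually_ge_atTop 1] with t ht
    have ht' : (0 : ℝ) < t := by exact_mod_cast ht
    have hm1 : 1 ≤ ⌈-x * t⌉₊ := Nat.one_le_ceil_iff.2 (mul_pos hx' ht')
    rw [Nat.cast_sub hm1, Nat.cast_one, sub_div]
    rfl
  refine (tendsto_tail (by rw [add_comm]; exact hab : b ^ 2 + a ^ 2 = 1) hβ hα hx' hn).congr' ?_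
  filter_upwards [eventually_ge_atTop 1] with t ht
  exact (rescaledLaw_real_Iic _ _ _ _ ht hx).symm

theorem tendsto_rescaledLaw (hlaw : ∀ t, IsProbabilityMeasure (rescaledLaw σp σm α β t))
    (hlim : IsProbabilityMeasure (limitLaw σp σm a b (φ₁ - φ₂))) :
    Tendsto (β := ProbabilityMeasure ℝ) (fun t : ℕ => ⟨rescaledLaw σp σm α β t, hlaw t⟩) atTop
      (𝓝 ⟨limitLaw σp σm a b (φ₁ - φ₂), hlim⟩) := by
  -- The limit law can have an atom only at 0, which is the one point left out. Negative x is a left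
  -- tail, positive x the complement of a right tail.
  refine tendsto_probabilityMeasure_of_tendsto_Iic (z := 0) fun x hx => ?_
  rcases lt_or_gt_of_ne hx with h | h
  · exact tendsto_rescaledLaw_real_Iic hab hα hβ h
  · have e : ∀ ρ : Measure ℝ, IsProbabilityMeasure ρ →
        ρ.real (Set.Iic x) = 1 - ρ.real (Set.Ioi x) := fun ρ _ => by
      rw [← probReal_compl_eq_one_sub measurableSet_Ioi, Set.compl_Ioi]
    simp only [ProbabilityMeasure.coe_mk, e _ hlim, e _ (hlaw _)]
    exact (tendsto_rescaledLaw_real_Ioi hab hα hβ h).const_sub 1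

end Law

end TwoPhaseWalk

theorem theorem1 (σp σm : ℝ) (hσp : σp ∈ Set.Ico 0 (2 * Real.pi))
    (hσm : σm ∈ Set.Ico 0 (2 * Real.pi)) (a b φ₁ φ₂ : ℝ) (ha : 0 ≤ a) (hb : 0 ≤ b)
    (hab : a ^ 2 + b ^ 2 = 1) (α β : ℂ) (hα : α = a * Complex.exp (Complex.I * φ₁))
    (hβ : β = b * Complex.exp (Complex.I * φ₂)) :
    (∀ x : ℤ, Tendsto
        (fun T : ℕ => (∑ t ∈ Finset.range T, TwoPhaseWalk.prob σp σm α β t x) / (T : ℝ)) atTop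
        (𝓝 (TwoPhaseWalk.timeAveragedLimit σp σm a b (φ₁ - φ₂) x))) ∧
      Summable (TwoPhaseWalk.timeAveragedLimit σp σm a b (φ₁ - φ₂)) ∧
      0 ≤ TwoPhaseWalk.localizedMass σp σm a b (φ₁ - φ₂) ∧
      TwoPhaseWalk.localizedMass σp σm a b (φ₁ - φ₂) < 1 ∧
      (∀ x : ℝ, 0 ≤ TwoPhaseWalk.weight σp σm a b (φ₁ - φ₂) x *
        TwoPhaseWalk.konnoDensity x (1 / Real.sqrt 2)) ∧
      ∃ (hlaw : ∀ t : ℕ, IsProbabilityMeasure (TwoPhaseWalk.rescaledLaw σp σm α β t))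
        (hlim : IsProbabilityMeasure (TwoPhaseWalk.limitLaw σp σm a b (φ₁ - φ₂))),
        Tendsto (β := ProbabilityMeasure ℝ)
          (fun t : ℕ => ⟨TwoPhaseWalk.rescaledLaw σp σm α β t, hlaw t⟩) atTop
          (𝓝 ⟨TwoPhaseWalk.limitLaw σp σm a b (φ₁ - φ₂), hlim⟩) := by
  refine ⟨TwoPhaseWalk.tendsto_average_prob_int σp σm a b φ₁ φ₂ α β hab hα hβ,
    (TwoPhaseWalk.hasSum_timeAveragedLimit _ _ _ _ _).summable,
    TwoPhaseWalk.localizedMass_nonneg hab _ _ _, TwoPhaseWalk.localizedMass_lt_one hab _ _ _,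
    TwoPhaseWalk.weight_mul_konnoDensity_nonneg hab _ _ _ _, ?_⟩
  exact ⟨TwoPhaseWalk.isProbabilityMeasure_rescaledLaw σp σm
      (TwoPhaseWalk.norm_sq_add_norm_sq a b φ₁ φ₂ α β hab hα hβ),
    TwoPhaseWalk.isProbabilityMeasure_limitLaw hab hα hβ,
    TwoPhaseWalk.tendsto_rescaledLaw hab hα hβ _ _⟩
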